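/- Let $V$ be a vertex operator algebra (in the sense of Frenkel–Lepowsky–Meurman and Frenkel–Huang–Lepowsky). A discretely $\mathbb{R}$-graded $V$-module is an $\mathbb{R}$-graded $V$-module whose subspace spanned by the elements of weight at most $r$ is finite-dimensional for every $r\in\mathbb{R}$. A $V$-module $W$ is $C_1$-cofinite if $\dim W/C_1(W)<\infty$, where $C_1(W)$ is the span of all $u_{-1}w$ with $u\in V_+=\coprod_{n>0}V_{(n)}$ and $w\in W$. The contragredient module of $W$ is denoted by $W'$. Let $p\ge 1$, let $W_0,\dots,W_{p+1}$ be discretely $\mathbb{R}$-graded $C_1$-cofinite $V$-modules, and let $w_i\in W_i$ for $i=0,\dots,p+1$. Fix one of the singular points $z_i=0$, $z_i=\infty$ ($1\le i\le p$) or $z_i=z_j$ ($1\le i\ne j\le p$). Then there exist integers $m_1,\dots,m_p\ge 1$ and $$a_{k,l}(z_1,\dots,z_p)\in\mathbb{C}[z_1^{\pm1},\dots,z_p^{\pm1},(z_i-z_j)^{-1}\ (i<j)],\qquad 1\le k\le m_l,\ 1\le l\le p,$$ such that both of the following hold. (1) For all discretely $\mathbb{R}$-graded $V$-modules $\tilde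 W_1,\dots,\tilde W_{p-1}$ and all intertwining operators $\mathcal{Y}_1,\dots,\mathcal{Y}_p$ of types $\binom{W_0'}{W_1\tilde W_1},\binom{\tilde W_1}{W_2\tilde W_2},\dots,\binom{\tilde W_{p-1}}{W_pW_{p+1}}$ (for $p=1$, one operator of type $\binom{W_0'}{W_1W_2}$), the series $$\langle w_0,\mathcal{Y}_1(w_1,z_1)\cdots\mathcal{Y}_p(w_p,z_p)w_{p+1}\rangle$$ in real powers of $z_1,\dots,z_p$ satisfies the expansions in the region $|z_1|>\cdots>|z_p|>0$ of the system $$\frac{\partial^{m_l}\varphi}{\partial z_l^{m_l}}+\sum_{k=1}^{m_l}a_{k,l}(z_1,\dots,z_p)\frac{\partial^{m_l-k}\varphi}{\partial z_l^{m_l-k}}=0,\qquad l=1,\dots,p.$$ (2) The chosen singular point of this system is regular (in the sense of Fuchs). That is, for all $l$ and all $1\le k\le m_l$: if the singular point is $z_i=0$ (respectively $z_i=z_j$), then $z_i^k a_{k,l}$ (respectively $(z_i-z_j)^k a_{k,l}$) has no pole along the divisor $z_i=0$ (respectively $z_i=z_j$); if it is $z_i=\infty$, then $z_i^k a_{k,i}$,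 and $z_i^{-k}a_{k,l}$ for $l\ne i$, have no pole along $z_i=\infty$. In other words, if $t=z_i$, $t=z_i-z_j$ or $t=1/z_i$ is the equation of the divisor, each equation can be written in terms of $t$ times first-order derivations, with coefficients having no pole along $t=0$. -/

import Mathlib

universe u v

/-! ## Vertex operator algebras and their modules -/

/-- The data of a complex vector space on which the elements `a` of `V` act by modes `a_n`,
`n ∈ ℤ`; in generating form `Y(a, x) = ∑ a_n x^{-n-1}`, and `Y a n` is `a_n`. -/
structure ModData (V : Type u) : Type (max u (v + 1)) where
  carrier : Type v
  [addCommGroup : AddCommGroup carrier]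
  [module : Module ℂ carrier]
  Y : V → ℤ → Module.End ℂ carrier

attribute [instance] ModData.addCommGroup ModData.module

/-- The Virasoro mode `L(n) = ω_{n+1}`. -/
def ModData.L {V : Type u} (W : ModData.{u, v} V) (ω : V) (n : ℤ) : Module.End ℂ W.carrier :=
  W.Y ω (n + 1)

/-- The subspace of vectors of weight `r`: the eigenspace of `L(0)` for the eigenvalue `r`. -/
def ModData.wt {V : Type u} (W : ModData.{u, v} V) (ω : V) (r : ℝ) : Submodule ℂ W.carrier :=
  Module.End.eigenspace (W.L ω 0) (r : ℂ)

/-- The Jacobi identity for one element `a` acting by modes `a₁`, `a₂`, `a₃` on the spaces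
`M₁`, `M₂`, `M₃` and for a map `I(v, x) w = ∑ₙ (I v n w) x^{-n-1}`, written out coefficient by
coefficient: it is the equality of the coefficients of
`x₀^{-l-1} x₁^{-m-1} x₂^{-n-1}` in
`x₀⁻¹ δ((x₁-x₂)/x₀) Y₃(a, x₁) I(v, x₂) w - x₀⁻¹ δ((-x₂+x₁)/x₀) I(v, x₂) Y₂(a, x₁) w`
`= x₂⁻¹ δ((x₁-x₀)/x₂) I(Y₁(a, x₀) v, x₂) w`.
The exponents `n` of the map `I` range over `R` (`ℤ` for vertex operators, `ℝ` for intertwining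
operators). All the sums are finite in the presence of the truncation axioms. -/
def JacobiIdentity {R : Type*} [Ring R] {M₁ M₂ M₃ : Type*}
    [AddCommGroup M₁] [Module ℂ M₁] [AddCommGroup M₂] [Module ℂ M₂]
    [AddCommGroup M₃] [Module ℂ M₃]
    (a₁ : ℤ → Module.End ℂ M₁) (a₂ : ℤ → Module.End ℂ M₂) (a₃ : ℤ → Module.End ℂ M₃)
    (I : M₁ → R → M₂ → M₃) : Prop :=
  ∀ (l m : ℤ) (n : R) (v : M₁) (w : M₂),
    ∑ᶠ j : ℕ, ((Ring.choose m j : ℤ) : ℂ) • I (a₁ (l + j) v) ((m : R) + n - (j : R)) w =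
    ∑ᶠ j : ℕ, ((-1 : ℂ) ^ j * ((Ring.choose l j : ℤ) : ℂ)) •
      (a₃ (m + l - j) (I v (n + (j : R)) w) -
        ((-1 : ℂ) ^ l) • I v (n + (l : R) - (j : R)) (a₂ (m + j) w))

/-- The Virasoro relations with central charge `c`. -/
def VirasoroRelations {M : Type*} [AddCommGroup M] [Module ℂ M]
    (L : ℤ → Module.End ℂ M) (c : ℂ) : Prop :=
  ∀ m n : ℤ, L m * L n - L n * L m =
    ((m : ℂ) - (n : ℂ)) • L (m + n) +
      if m + n = 0 then ((((m : ℂ) ^ 3 - (m : ℂ)) / 12) * c) • (1 : Module.End ℂ M) else 0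

/-- A vertex operator algebra structure on the complex vector space `V`. The homogeneous
subspace `V_(n)` is the eigenspace of `L(0) = ω_1` for the eigenvalue `n`. -/
structure VOA (V : Type u) [AddCommGroup V] [Module ℂ V] where
  Y : V →ₗ[ℂ] (ℤ → Module.End ℂ V)
  one : V
  ω : V
  c : ℂ
  truncation : ∀ a b : V, ∃ N : ℤ, ∀ n : ℤ, N ≤ n → Y a n b = 0
  vacuum : ∀ n : ℤ, Y one n = if n = -1 then 1 else 0
  creation : ∀ (a : V) (n : ℤ), 0 ≤ n → Y a n one = 0
  creation_one : ∀ a : V, Y a (-1) one = a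
  jacobi : ∀ a : V, JacobiIdentity (R := ℤ) (Y a) (Y a) (Y a) (fun b n w => Y b n w)
  virasoro : VirasoroRelations (fun n => Y ω (n + 1)) c
  derivative : ∀ (a : V) (n : ℤ), Y (Y ω 0 a) n = (-(n : ℂ)) • Y a (n - 1)
  grading : DirectSum.IsInternal
    (fun n : ℤ => Module.End.eigenspace (Y ω 1) (n : ℂ))
  finiteDimensional : ∀ n : ℤ,
    FiniteDimensional ℂ (Module.End.eigenspace (Y ω 1) (n : ℂ))
  bounded_below : ∃ N : ℤ, ∀ n : ℤ, n < N →
    Module.End.eigenspace (Y ω 1) (n : ℂ) = ⊥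

section ModuleTheory

variable {V : Type u} [AddCommGroup V] [Module ℂ V]

/-- The homogeneous subspace `V_(n)`. -/
def VOA.gr (A : VOA V) (n : ℤ) : Submodule ℂ V := Module.End.eigenspace (A.Y A.ω 1) (n : ℂ)

/-- The component of `a` in `V_(n)`. -/
noncomputable def VOA.component (A : VOA V) (n : ℤ) (a : V) : V :=
  (((LinearEquiv.ofBijective (DirectSum.coeLinearMap A.gr) A.grading).symm a) n : A.gr n)

/-- `V_+ = ∐_{n > 0} V_(n)`. -/
def VOA.plus (A : VOA V) : Submodule ℂ V := ⨆ n : ℤ, ⨆ _ : 0 < n, A.gr n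

/-- An `ℝ`-graded `V`-module `W = ∐_{r ∈ ℝ} W_(r)`, where `W_(r)` is the eigenspace of `L(0)`
for the eigenvalue `r`. -/
structure IsVOAModule (A : VOA V) (W : ModData.{u, v} V) : Prop where
  map_add : ∀ (a b : V) (n : ℤ), W.Y (a + b) n = W.Y a n + W.Y b n
  map_smul : ∀ (t : ℂ) (a : V) (n : ℤ), W.Y (t • a) n = t • W.Y a n
  truncation : ∀ (a : V) (w : W.carrier), ∃ N : ℤ, ∀ n : ℤ, N ≤ n → W.Y a n w = 0
  vacuum : ∀ n : ℤ, W.Y A.one n = if n = -1 then 1 else 0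
  jacobi : ∀ a : V, JacobiIdentity (R := ℤ) (A.Y a) (W.Y a) (W.Y a) (fun b n w => W.Y b n w)
  virasoro : VirasoroRelations (W.L A.ω) A.c
  derivative : ∀ (a : V) (n : ℤ), W.Y (A.Y A.ω 0 a) n = (-(n : ℂ)) • W.Y a (n - 1)
  grading : DirectSum.IsInternal (fun r : ℝ => W.wt A.ω r)
  finiteDimensional : ∀ r : ℝ, FiniteDimensional ℂ (W.wt A.ω r)
  bounded_below : ∃ N : ℝ, ∀ r : ℝ, r < N → W.wt A.ω r = ⊥

/-- A discretely `ℝ`-graded `V`-module: for every real `r` the subspace spanned by the elements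
of weight at most `r` is finite-dimensional. -/
structure IsDiscreteModule (A : VOA V) (W : ModData.{u, v} V) : Prop where
  isModule : IsVOAModule A W
  discrete : ∀ r : ℝ, FiniteDimensional ℂ (⨆ s : ℝ, ⨆ _ : s ≤ r, W.wt A.ω s : Submodule ℂ W.carrier)

/-- `C₁(W)`, the span of all `a_{-1} w` with `a ∈ V_+`. -/
def C1 (A : VOA V) (W : ModData.{u, v} V) : Submodule ℂ W.carrier :=
  Submodule.span ℂ {x | ∃ a ∈ A.plus, ∃ w : W.carrier, x = W.Y a (-1) w}

/-- `W` is `C₁`-cofinite. -/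
def IsC1Cofinite (A : VOA V) (W : ModData.{u, v} V) : Prop :=
  FiniteDimensional ℂ (W.carrier ⧸ C1 A W)

/-! ## The contragredient module -/

/-- `a_n` maps `W_(r)` into `W_(r + h - n - 1)` when `a` has weight `h`. -/
theorem mode_mem_wt (A : VOA V) (W : ModData.{u, v} V)
    (hsmul : ∀ (t : ℂ) (a : V) (n : ℤ), W.Y (t • a) n = t • W.Y a n)
    (hjac : ∀ a : V, JacobiIdentity (R := ℤ) (A.Y a) (W.Y a) (W.Y a) (fun b n w => W.Y b n w))
    (hder : ∀ (a : V) (n : ℤ), W.Y (A.Y A.ω 0 a) n = (-(n : ℂ)) • W.Y a (n - 1))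
    {h : ℤ} {a : V} (ha : a ∈ A.gr h) {r : ℝ} {w : W.carrier} (hw : w ∈ W.wt A.ω r) (n : ℤ) :
    W.Y a n w ∈ W.wt A.ω (r + h - n - 1) := by
  have ha' : A.Y A.ω 1 a = (h : ℂ) • a := Module.End.mem_eigenspace_iff.1 ha
  have hw' : W.Y A.ω 1 w = (r : ℂ) • w := by
    have := Module.End.mem_eigenspace_iff.1 hw
    simpa [ModData.L] using this
  have key := hjac A.ω 0 1 n a w
  rw [finsum_eq_sum_of_support_subset (s := {0, 1})] at key
  · rw [finsum_eq_single _ 0] at key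
    · have e : (1 : ℤ) + n = n + 1 := by ring
      simp [e, hder, ha', hw', hsmul] at key
      refine Module.End.mem_eigenspace_iff.2 ?_
      have hL : W.L A.ω 0 (W.Y a n w) = W.Y A.ω 1 (W.Y a n w) := by simp [ModData.L]
      rw [hL, ← sub_eq_zero]
      have key' := sub_eq_zero.2 key.symm
      rw [← key']
      push_cast
      module
    · intro j hj
      have : Ring.choose (0 : ℤ) j = 0 := by
        have := Ring.choose_natCast (R := ℤ) 0 j
        simp [Nat.choose_eq_zero_of_lt (Nat.pos_of_ne_zero hj)] at this
        exact this
      simp [this]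
  · intro j hj
    by_contra hj'
    apply hj
    have h2 : 1 < j := by
      simp at hj'
      omega
    have : Ring.choose (1 : ℤ) j = 0 := by
      have := Ring.choose_natCast (R := ℤ) 1 j
      simp [Nat.choose_eq_zero_of_lt h2] at this
      exact this
    simp [this]

/-- `L(1)^k a` has weight `h - k` when `a` has weight `h`. -/
theorem L1_pow_mem_gr (A : VOA V) {h : ℤ} {a : V} (ha : a ∈ A.gr h) (k : ℕ) :
    ((A.Y A.ω 2) ^ k) a ∈ A.gr (h - k) := by
  induction k with
  | zero => simpa using ha
  | succ k ih =>
    have hv : A.Y A.ω 1 (((A.Y A.ω 2) ^ k) a) = ((h - k : ℤ) : ℂ) • ((A.Y A.ω 2) ^ k) a :=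
      Module.End.mem_eigenspace_iff.1 ih
    have h0 := A.virasoro 0 1
    have h1 := LinearMap.congr_fun h0 (((A.Y A.ω 2) ^ k) a)
    simp [hv] at h1
    refine Module.End.mem_eigenspace_iff.2 ?_
    rw [pow_succ', Module.End.mul_apply, sub_eq_iff_eq_add.1 h1]
    push_cast
    module

/-- The operator on `W` adjoint to the mode `a_n` on the contragredient module. It is given by
`∑ₙ a*_n x^{-n-1} = Y(e^{x L(1)} (-x⁻²)^{L(0)} a, x⁻¹)`; for `a` of weight `h` this reads
`a*_n = (-1)^h ∑_{k ≥ 0} (1/k!) (L(1)^k a)_{2h-k-n-2}`. -/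
noncomputable def adjointMode (A : VOA V) (W : ModData.{u, v} V) (a : V) (n : ℤ) :
    Module.End ℂ W.carrier :=
  ∑ᶠ h : ℤ, ∑ᶠ k : ℕ, ((-1 : ℂ) ^ h / (k.factorial : ℂ)) •
    W.Y (((A.Y A.ω 2) ^ k) (A.component h a)) (2 * h - k - n - 2)

/-- The graded dual `∐_r W_(r)^*`, as the space of the linear functionals on `W` that vanish on
all but finitely many of the weight spaces `W_(r)`. -/
def gradedDual (A : VOA V) (W : ModData.{u, v} V) : Submodule ℂ (Module.Dual ℂ W.carrier) where
  carrier := {f | {r : ℝ | ∃ w ∈ W.wt A.ω r, f w ≠ 0}.Finite}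
  zero_mem' := by simp
  add_mem' := by
    intro f g hf hg
    refine (hf.union hg).subset ?_
    rintro r ⟨w, hw, h⟩
    by_cases h1 : f w = 0
    · exact Or.inr ⟨w, hw, by simpa [h1] using h⟩
    · exact Or.inl ⟨w, hw, h1⟩
  smul_mem' := by
    intro t f hf
    refine hf.subset ?_
    rintro r ⟨w, hw, h⟩
    exact ⟨w, hw, by intro h0; simp [h0] at h⟩

theorem comp_adjointMode_mem (A : VOA V) (W : ModData.{u, v} V) (hW : IsVOAModule A W)
    (a : V) (n : ℤ) (f : Module.Dual ℂ W.carrier) (hf : f ∈ gradedDual A W) :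
    f ∘ₗ adjointMode A W a n ∈ gradedDual A W := by
  have H : ∀ T S : Module.End ℂ W.carrier, f ∘ₗ T ∈ gradedDual A W → f ∘ₗ S ∈ gradedDual A W →
      f ∘ₗ (T + S) ∈ gradedDual A W := by
    intro T S hT hS
    rw [LinearMap.comp_add]
    exact add_mem hT hS
  have H0 : f ∘ₗ (0 : Module.End ℂ W.carrier) ∈ gradedDual A W := by
    rw [LinearMap.comp_zero]
    exact zero_mem _
  unfold adjointMode
  refine finsum_induction (fun T => f ∘ₗ T ∈ gradedDual A W) H0 H fun h => ?_
  refine finsum_induction (fun T => f ∘ₗ T ∈ gradedDual A W) H0 H fun k => ?_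
  rw [LinearMap.comp_smul]
  refine Submodule.smul_mem _ _ ?_
  have hmem : ((A.Y A.ω 2) ^ k) (A.component h a) ∈ A.gr (h - k) :=
    L1_pow_mem_gr A (Subtype.property _) k
  refine (hf.image (fun r => r - ((h - k : ℤ) : ℝ) + ((2 * h - k - n - 2 : ℤ) : ℝ) + 1)).subset ?_
  rintro r ⟨w, hw, hne⟩
  exact ⟨_, ⟨_, mode_mem_wt A W hW.map_smul hW.jacobi hW.derivative hmem hw _, hne⟩, by ring⟩

/-- The contragredient module `W'`: the graded dual of `W` with the modes
`⟨a_n f, w⟩ = ⟨f, a*_n w⟩`. -/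
noncomputable def contragredient (A : VOA V) (W : ModData.{u, v} V) (hW : IsVOAModule A W) :
    ModData.{u, v} V where
  carrier := gradedDual A W
  Y := fun a n =>
    { toFun := fun f => ⟨f.1 ∘ₗ adjointMode A W a n, comp_adjointMode_mem A W hW a n f.1 f.2⟩
      map_add' := fun f g => by ext; rfl
      map_smul' := fun t f => by ext; rfl }

/-! ## Intertwining operators and their products -/

/-- An intertwining operator `Y(w₁, x) w₂ = ∑_{n ∈ ℝ} (mode n w₁ w₂) x^{-n-1}` of type
`W₃ choose W₁ W₂`. -/
structure IntertwiningOperator (A : VOA V) (W₃ W₁ W₂ : ModData.{u, v} V) where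
  mode : ℝ → W₁.carrier →ₗ[ℂ] W₂.carrier →ₗ[ℂ] W₃.carrier
  truncation : ∀ (w₁ : W₁.carrier) (w₂ : W₂.carrier), ∃ N : ℝ, ∀ n : ℝ, N ≤ n → mode n w₁ w₂ = 0
  jacobi : ∀ a : V, JacobiIdentity (R := ℝ) (W₁.Y a) (W₂.Y a) (W₃.Y a)
    (fun w₁ n w₂ => mode n w₁ w₂)
  derivative : ∀ (w₁ : W₁.carrier) (n : ℝ),
    mode n (W₁.L A.ω (-1) w₁) = (-(n : ℂ)) • mode (n - 1) w₁

/-- `IsProduct A X x n Z W w F` says that `F`, a family of vectors of `Z` indexed by exponents,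
is the family of coefficients of a product
`Y₁(w₁, z₁) ⋯ Yₙ(wₙ, zₙ) x = ∑_e F(e) z₁^{e₁} ⋯ zₙ^{eₙ}`
with intertwining operators of types `Z choose W₁ M₁`, `M₁ choose W₂ M₂`, …,
`M_{n-1} choose Wₙ X`, the intermediate modules `Mᵢ` being discretely `ℝ`-graded
(`X` itself is always such a module here). -/
inductive IsProduct (A : VOA V) (X : ModData.{u, v} V) (x : X.carrier) :
    (n : ℕ) → (Z : ModData.{u, v} V) → (W : Fin n → ModData.{u, v} V) →
    (w : ∀ i, (W i).carrier) → (F : (Fin n → ℝ) → Z.carrier) → Prop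
  | nil (W : Fin 0 → ModData.{u, v} V) (w : ∀ i, (W i).carrier) :
      IsProduct A X x 0 X W w (fun _ => x)
  | cons {n : ℕ} {Z M : ModData.{u, v} V} (W : Fin (n + 1) → ModData.{u, v} V)
      (w : ∀ i, (W i).carrier) (F : (Fin n → ℝ) → M.carrier)
      (hM : IsDiscreteModule A M) (I : IntertwiningOperator A Z (W 0) M)
      (hF : IsProduct A X x n M (fun i => W i.succ) (fun i => w i.succ) F) :
      IsProduct A X x (n + 1) Z W w
        (fun e => I.mode (-(e 0) - 1) (w 0) (F (fun i => e i.succ)))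

end ModuleTheory

/-! ## Coefficients, their expansions, and differential equations for series -/

/-- The field `ℂ(z₁, …, z_p)`. -/
abbrev RatFun (p : ℕ) : Type := FractionRing (MvPolynomial (Fin p) ℂ)

/-- The coordinate `z_i`. -/
noncomputable def zvar {p : ℕ} (i : Fin p) : RatFun p :=
  algebraMap (MvPolynomial (Fin p) ℂ) (RatFun p) (MvPolynomial.X i)

/-- The ring `ℂ[z_i^{±1}, (z_i - z_j)⁻¹]`. -/
noncomputable def coeffRing (p : ℕ) : Subalgebra ℂ (RatFun p) :=
  Algebra.adjoin ℂ ({f | ∃ i, f = zvar i} ∪ {f | ∃ i, f = (zvar i)⁻¹} ∪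
    {f | ∃ i j, i ≠ j ∧ f = (zvar i - zvar j)⁻¹})

/-- Exponents `e` of monomials `z₁^{e₁} ⋯ z_p^{e_p}`, ordered lexicographically with the exponent
of `z_p` compared first, then that of `z_{p-1}`, and so on. -/
abbrev Expo (p : ℕ) : Type := Lex ((Fin p)ᵒᵈ → ℝ)

/-- The exponent with components `e i`. -/
def expo {p : ℕ} (e : Fin p → ℝ) : Expo p := toLex (fun i => e (OrderDual.ofDual i))

/-- The component of an exponent at `z_i`. -/
def Expo.at {p : ℕ} (e : Expo p) (i : Fin p) : ℝ := ofLex e (OrderDual.toDual i)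

/-- The field of formal series `∑ c_e z₁^{e₁} ⋯ z_p^{e_p}` with real exponents and with support
well-ordered in the above order. The order makes `z₁ ≫ z₂ ≫ ⋯ ≫ z_p`, so that inverses are
expanded as in the region `|z₁| > ⋯ > |z_p| > 0`:
for `i < j`, the inverse of `z_i - z_j` is `∑_{k ≥ 0} z_j^k z_i^{-k-1}`. -/
abbrev RSeries (p : ℕ) : Type := HahnSeries (Expo p) ℂ

/-- The expansion of a polynomial. -/
noncomputable def polyExpand (p : ℕ) : MvPolynomial (Fin p) ℂ →+* RSeries p :=
  (MvPolynomial.aeval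
    (fun i : Fin p => (HahnSeries.single (expo (Pi.single i 1)) (1 : ℂ) : RSeries p))).toRingHom

theorem single_expo_pow {p : ℕ} (e : Fin p → ℝ) (n : ℕ) :
    (HahnSeries.single (expo e) (1 : ℂ) : RSeries p) ^ n =
      HahnSeries.single (expo (fun i => n * e i)) 1 := by
  rw [HahnSeries.single_pow, one_pow]
  refine congrArg (fun x => HahnSeries.single x (1 : ℂ)) ?_
  apply ofLex.injective
  funext i
  change n • e (OrderDual.ofDual i) = n * e (OrderDual.ofDual i)
  simp

theorem prod_single_expo {p : ℕ} (S : Finset (Fin p)) (f : Fin p → Fin p → ℝ) :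
    ∏ i ∈ S, (HahnSeries.single (expo (f i)) (1 : ℂ) : RSeries p) =
      HahnSeries.single (expo (fun j => ∑ i ∈ S, f i j)) 1 := by
  classical
  induction S using Finset.induction_on with
  | empty => simp only [Finset.prod_empty, Finset.sum_empty]; rfl
  | insert i S hi ih =>
    rw [Finset.prod_insert hi, ih, HahnSeries.single_mul_single, one_mul]
    refine congrArg (fun x => HahnSeries.single x (1 : ℂ)) ?_
    apply ofLex.injective
    funext j
    change f i (OrderDual.ofDual j) + ∑ i ∈ S, f i (OrderDual.ofDual j) =
      ∑ i ∈ insert i S, f i (OrderDual.ofDual j)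
    rw [Finset.sum_insert hi]

theorem polyExpand_monomial {p : ℕ} (d : Fin p →₀ ℕ) (t : ℂ) :
    polyExpand p (MvPolynomial.monomial d t) =
      HahnSeries.single (expo (fun i => (d i : ℝ))) t := by
  change MvPolynomial.aeval _ _ = _
  rw [MvPolynomial.aeval_monomial, Finsupp.prod_fintype _ _ (by simp)]
  simp only [single_expo_pow, prod_single_expo]
  have h : (fun j => ∑ i : Fin p, (d i : ℝ) * (Pi.single i (1 : ℝ) : Fin p → ℝ) j) =
      fun j => (d j : ℝ) := by
    funext j
    simp [Pi.single_apply]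
  rw [h, ← Algebra.smul_def]
  ext e
  simp [HahnSeries.coeff_single]

theorem polyExpand_coeff {p : ℕ} (P : MvPolynomial (Fin p) ℂ) (d : Fin p →₀ ℕ) :
    (polyExpand p P).coeff (expo (fun i => (d i : ℝ))) = P.coeff d := by
  induction P using MvPolynomial.induction_on' with
  | monomial d' t =>
    rw [polyExpand_monomial, MvPolynomial.coeff_monomial]
    by_cases h : d' = d
    · subst h
      simp
    · rw [if_neg h, HahnSeries.coeff_single_of_ne]
      intro h'
      apply h
      ext i
      have this : (d i : ℝ) = d' i := congrFun (toLex.injective h') (OrderDual.toDual i)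
      exact_mod_cast this.symm
  | add P Q hP hQ => rw [map_add, HahnSeries.coeff_add, hP, hQ, MvPolynomial.coeff_add]

theorem polyExpand_injective (p : ℕ) : Function.Injective (polyExpand p) := by
  intro P Q h
  ext d
  rw [← polyExpand_coeff, h, polyExpand_coeff]

/-- The expansion of a rational function in the region `|z₁| > ⋯ > |z_p| > 0`. -/
noncomputable def expand (p : ℕ) : RatFun p →+* RSeries p :=
  IsFractionRing.lift (polyExpand_injective p)

/-- `z_l ∂/∂z_l` on formal series. -/
noncomputable def eulerOp {p : ℕ} (l : Fin p) (φ : RSeries p) : RSeries p where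
  coeff e := ((Expo.at e l : ℝ) : ℂ) * φ.coeff e
  isPWO_support' := φ.isPWO_support.mono (by
    intro e he h0
    apply he
    simp only [h0, mul_zero])

/-- `∂/∂z_l` on formal series. -/
noncomputable def partialD {p : ℕ} (l : Fin p) (φ : RSeries p) : RSeries p :=
  HahnSeries.single (expo (Pi.single l (-1))) (1 : ℂ) * eulerOp l φ

/-- The formal series `φ` satisfies the expansions in the region `|z₁| > ⋯ > |z_p| > 0` of the
equations `∂^{m_l} φ / ∂z_l^{m_l} + ∑_{k=1}^{m_l} a_{k,l} ∂^{m_l - k} φ / ∂z_l^{m_l - k} = 0`,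
`l = 1, …, p`, where `a l k` is `a_{k,l}`. -/
def SatisfiesSystem {p : ℕ} (m : Fin p → ℕ) (a : Fin p → ℕ → RatFun p) (φ : RSeries p) : Prop :=
  ∀ l : Fin p, (partialD l)^[m l] φ +
    ∑ k ∈ Finset.Icc 1 (m l), expand p (a l k) * (partialD l)^[m l - k] φ = 0

/-! ## Regular singular points -/

/-- The possible singular points `z_i = 0`, `z_i = ∞`, `z_i = z_j`. -/
inductive SingularPoint (p : ℕ) : Type
  | zero (i : Fin p)
  | infinity (i : Fin p)
  | diag (i j : Fin p) (h : i ≠ j)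

/-- The rational function `f` has no pole along the divisor `z_i = 0`, `z_i = ∞`, or
`z_i = z_j`: it is a quotient of polynomials whose denominator does not vanish identically on the
divisor; for `z_i = ∞`, its degree in `z_i` is at most zero. -/
def NoPole {p : ℕ} : SingularPoint p → RatFun p → Prop
  | .zero i, f => ∃ P Q : MvPolynomial (Fin p) ℂ, ¬ MvPolynomial.X i ∣ Q ∧
      f = algebraMap _ (RatFun p) P / algebraMap _ (RatFun p) Q
  | .infinity i, f => ∃ P Q : MvPolynomial (Fin p) ℂ, Q ≠ 0 ∧
      MvPolynomial.degreeOf i P ≤ MvPolynomial.degreeOf i Q ∧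
      f = algebraMap _ (RatFun p) P / algebraMap _ (RatFun p) Q
  | .diag i j _, f => ∃ P Q : MvPolynomial (Fin p) ℂ,
      ¬ (MvPolynomial.X i - MvPolynomial.X j) ∣ Q ∧
      f = algebraMap _ (RatFun p) P / algebraMap _ (RatFun p) Q

/-- The factor `g` such that `g ∂/∂z_l` is, up to sign, `t` times a derivation that is regular
along the divisor and nonvanishing there, where `t = z_i`, `t = 1/z_i` or `t = z_i - z_j` is the
equation of the divisor and where `t` and all the `z`'s other than `z_i` serve as coordinates. At
`z_i = ∞` one has `∂/∂z_i = -t² ∂/∂t`, so that `g = z_i` for `l = i`, and `g = t = 1/z_i` for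
`l ≠ i`. -/
noncomputable def fuchsFactor {p : ℕ} : SingularPoint p → Fin p → RatFun p
  | .zero i, _ => zvar i
  | .infinity i, l => if l = i then zvar i else (zvar i)⁻¹
  | .diag i j _, _ => zvar i - zvar j

/-- The singular point `s` of the system is regular (Fuchs): in each of the equations, written in
terms of the derivations `t ∂`, the coefficients have no pole at the singular point; that is, the
coefficient `a_{k,l}` has a pole of order at most `k` along `z_i = 0` or `z_i = z_j`, and
likewise at `z_i = ∞` in the coordinate `t = 1/z_i`. -/
def IsRegularAt {p : ℕ} (s : SingularPoint p) (m : Fin p → ℕ) (a : Fin p → ℕ → RatFun p) : Prop :=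
  ∀ l : Fin p, ∀ k ∈ Finset.Icc 1 (m l), NoPole s (fuchsFactor s l ^ k * a l k)

/-! Regard the formal series as a multilinear function Φ of all the vectors w₀, …, w_{p+1}. The
Jacobi identity gives Ward identities: a mode a₋₁ with a ∈ V₊ acting in one slot can be traded for
modes of V acting in the other slots, with rational coefficients, and the new total weight is
smaller by at least one. In a C₁-cofinite module every homogeneous vector of large weight is a
combination of vectors a₋₁u. Hence every value of Φ is a rational combination of values on
homogeneous vectors of bounded total weight, and finitely many of these suffice because the modules
are discrete. By the L(-1)-derivative property all ∂_l^k Φ(w) are values of Φ, so they lie in one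
finitely generated module over a Noetherian ring; the ascending chain condition produces a monic
equation (`exists_monic_relation`).

Regularity comes from keeping track of powers of the equation t of the divisor. The ring is an
algebra S of functions without pole there, and `PoleControl.filt` is the S-span of the t^q Φ(w) for
which a weighted sum of the weights is at most q + ρ; ρ is a real shift because the weights are
real. Along z_i = 0 and z_i = z_j every slot counts with factor 1. Along z_i = ∞ only w₀ counts,
with factor 2. The axioms of `PoleControl` say that each coefficient in the Ward identities lies in
S once multiplied by the power of t that the change of weights leaves free. So the reduction by
C₁-cofiniteness does not increase ρ (`PoleControl.mode_mem_filt`, `PoleControl.filt_le_of_bounds`),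
and its target is finitely generated over S (`PoleControl.fg_filt`). With g = `fuchsFactor s l`, all
g^k ∂_l^k Φ(w) lie in one such module (`exists_fuchsFactor_pow_smul_mem_filt`); at infinity with l =
i this also uses Euler homogeneity. A monic relation over S among them, divided by g^n, is an
equation with a regular singularity.

The coefficients must not depend on the intertwining operators or the intermediate modules. The
argument uses only the Ward identities, so it is run once on the product of all correlation
functions (`universalCorrelator`), and each component satisfies the resulting relation. -/

open Filter

/-! ### Intertwining operators and the coefficients of their products. -/

section intertwining

theorem ModData.mem_wt_iff {V : Type u} {W : ModData.{u, v} V} {ω : V} {r : ℝ} {w : W.carrier} :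
    w ∈ W.wt ω r ↔ W.Y ω 1 w = (r : ℂ) • w := by
  rw [ModData.wt, Module.End.mem_eigenspace_iff]
  simp [ModData.L]

variable {V : Type u} [AddCommGroup V] [Module ℂ V]

theorem choose_zero_of_ne {j : ℕ} (hj : j ≠ 0) : Ring.choose (0 : ℤ) j = 0 := by
  have := Ring.choose_natCast (R := ℤ) 0 j
  simpa [Nat.choose_eq_zero_of_lt (Nat.pos_of_ne_zero hj)] using this

theorem choose_neg_one (j : ℕ) : Ring.choose (-1 : ℤ) j = (-1) ^ j := by
  rw [Ring.choose_neg, add_comm, add_sub_cancel_right, Ring.choose_natCast, Nat.choose_self]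
  simp [Int.negOnePow, Units.smul_def]

/-- The commutator formula for an intertwining operator. -/
theorem IntertwiningOperator.commutator {A : VOA V} {W₃ W₁ W₂ : ModData.{u, v} V}
    (I : IntertwiningOperator A W₃ W₁ W₂) (a : V) (N : ℤ) (n : ℝ) (v : W₁.carrier)
    (w : W₂.carrier) (M : ℕ)
    (hM : ∀ m : ℕ, M ≤ m → Ring.choose N m = 0 ∨ W₁.Y a m v = 0) :
    W₃.Y a N (I.mode n v w) = I.mode n v (W₂.Y a N w) +
      ∑ j ∈ Finset.range M, ((Ring.choose N j : ℤ) : ℂ) •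
        I.mode ((N : ℝ) + n - j) (W₁.Y a j v) w := by
  -- For `l = 0` the right side of the Jacobi identity keeps only its term `j = 0`.
  have key := I.jacobi a 0 N n v w
  rw [finsum_eq_sum_of_support_subset (s := Finset.range M), finsum_eq_single _ 0] at key
  · simp only [zero_add] at key
    rw [key]
    simp
  · intro j hj
    simp [choose_zero_of_ne hj]
  · intro j hj
    by_contra hj'
    apply hj
    simp only [Finset.coe_range, Set.mem_Iio, not_lt] at hj'
    rcases hM j hj' with h | h <;> simp [h]

/-- The formula for `(a₋₁v)ₙ`. -/
theorem IntertwiningOperator.assoc {A : VOA V} {W₃ W₁ W₂ : ModData.{u, v} V}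
    (I : IntertwiningOperator A W₃ W₁ W₂) (a : V) (n : ℝ) (v : W₁.carrier)
    (w : W₂.carrier) (J : ℕ) (h₁ : ∀ j : ℕ, J ≤ j → I.mode (n + j) v w = 0)
    (h₂ : ∀ j : ℕ, J ≤ j → W₂.Y a j w = 0) :
    I.mode n (W₁.Y a (-1) v) w = ∑ j ∈ Finset.range J,
      (W₃.Y a (-1 - j) (I.mode (n + j) v w) + I.mode (n - 1 - j) v (W₂.Y a j w)) := by
  -- For `m = 0` the left side keeps only `j = 0`; on the right the sign and the binomial of `-1`
  -- cancel.
  have key := I.jacobi a (-1) 0 n v w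
  rw [finsum_eq_single _ 0, finsum_eq_sum_of_support_subset (s := Finset.range J)] at key
  · simp at key
    rw [key]
    refine Finset.sum_congr rfl fun j _ => ?_
    rw [choose_neg_one]
    have : ((-1 : ℂ) ^ j * (((-1) ^ j : ℤ) : ℂ)) = 1 := by
      push_cast
      rw [← mul_pow]
      simp
    rw [this, ← sub_eq_add_neg]
    simp only [one_smul]
  · intro j hj
    by_contra hj'
    apply hj
    simp only [Finset.coe_range, Set.mem_Iio, not_lt] at hj'
    simp [h₁ j hj', h₂ j hj']
  · intro j hj
    simp [choose_zero_of_ne hj]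

theorem choose_one_of_two_le {j : ℕ} (hj : 2 ≤ j) : Ring.choose (1 : ℤ) j = 0 := by
  have := Ring.choose_natCast (R := ℤ) 1 j
  simpa [Nat.choose_eq_zero_of_lt (show 1 < j by omega)] using this

/-- The commutator with L(0) = ω₁ has two terms, from ω₀ = L(-1) and ω₁ = L(0) acting on `v`; the
derivative property evaluates the first. -/
theorem IntertwiningOperator.mode_mem_wt {A : VOA V} {W₃ W₁ W₂ : ModData.{u, v} V}
    (I : IntertwiningOperator A W₃ W₁ W₂) {r s : ℝ} {v : W₁.carrier} {w : W₂.carrier}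
    (hv : v ∈ W₁.wt A.ω r) (hw : w ∈ W₂.wt A.ω s) (n : ℝ) :
    I.mode n v w ∈ W₃.wt A.ω (r + s - n - 1) := by
  rw [ModData.mem_wt_iff] at hv hw ⊢
  rw [I.commutator A.ω 1 n v w 2 fun m hm => Or.inl (choose_one_of_two_le hm)]
  have hd : W₁.Y A.ω 0 v = W₁.L A.ω (-1) v := by simp [ModData.L]
  simp [Finset.sum_range_succ, hd, hv, hw, I.derivative]
  module

/-- Eigenvectors for distinct weights are linearly independent and lie in a finite-dimensional
space. -/
theorem IsDiscreteModule.finite_wt {A : VOA V} {W : ModData.{u, v} V} (hW : IsDiscreteModule A W)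
    (r : ℝ) : {s : ℝ | s ≤ r ∧ W.wt A.ω s ≠ ⊥}.Finite := by
  have := hW.discrete r
  set U : Submodule ℂ W.carrier := ⨆ s : ℝ, ⨆ _ : s ≤ r, W.wt A.ω s
  set S := {s : ℝ | s ≤ r ∧ W.wt A.ω s ≠ ⊥}
  have hex : ∀ s : S, ∃ w ∈ W.wt A.ω s, w ≠ 0 := fun s => (Submodule.ne_bot_iff _).1 s.2.2
  choose x hx hx0 using hex
  have hli : LinearIndependent ℂ x :=
    Module.End.eigenvectors_linearIndependent' (W.L A.ω 0) (fun s : S => ((s : ℝ) : ℂ))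
      (fun s t h => Subtype.ext (Complex.ofReal_injective h)) x fun s => ⟨hx s, hx0 s⟩
  have hU : ∀ s : S, x s ∈ U := fun s =>
    (le_iSup₂_of_le (f := fun (s : ℝ) (_ : s ≤ r) => W.wt A.ω s) s.1 s.2.1 le_rfl) (hx s)
  have hli' : LinearIndependent ℂ (fun s : S => (⟨x s, hU s⟩ : U)) :=
    LinearIndependent.of_comp U.subtype hli
  have := hli'.finite
  exact Set.toFinite S

/-- A sequence of weights with no weakly increasing pair would be injective and stay below its first
term, against `finite_wt`. This is what makes products of intertwining operators Hahn series. -/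
theorem IsDiscreteModule.isPWO_weights {A : VOA V} {W : ModData.{u, v} V}
    (hW : IsDiscreteModule A W) : {s : ℝ | W.wt A.ω s ≠ ⊥}.IsPWO := by
  intro f
  by_contra! hf
  have hinj : Function.Injective f := by
    intro m n hmn
    by_contra hne
    rcases lt_or_gt_of_ne hne with h | h
    · exact hf m n h (by rw [hmn]; exact le_refl (f n).1)
    · exact hf n m h (by rw [hmn]; exact le_refl (f n).1)
  refine Set.infinite_of_injective_forall_mem (f := fun n => (f (n + 1) : ℝ)) ?_ ?_
    (hW.finite_wt (f 0))
  · intro m n h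
    simpa using hinj (Subtype.ext h)
  · intro n
    exact ⟨le_of_not_ge (hf 0 (n + 1) (by omega)), (f (n + 1)).2⟩

/-- `G` is a family of coefficients of products of fixed intertwining operators, as a function of
the vectors: `Y₁(w₁, z₁) ⋯ Yₙ(wₙ, zₙ) x = ∑_e G x w e z₁^{e₁} ⋯ zₙ^{eₙ}`. -/
structure ProductFamily (A : VOA V) (X : ModData.{u, v} V) (n : ℕ) (Z : ModData.{u, v} V)
    (W : Fin n → ModData.{u, v} V)
    (G : X.carrier → (∀ i, (W i).carrier) → (Fin n → ℝ) → Z.carrier) : Prop where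
  add_base : ∀ x y w e, G (x + y) w e = G x w e + G y w e
  smul_base : ∀ (t : ℂ) x w e, G (t • x) w e = t • G x w e
  add_slot : ∀ x w e i u v, G x (Function.update w i (u + v)) e =
    G x (Function.update w i u) e + G x (Function.update w i v) e
  smul_slot : ∀ x w e i (t : ℂ) u, G x (Function.update w i (t • u)) e =
    t • G x (Function.update w i u) e
  commutator : ∀ (a : V) x w e (N : ℤ) (M : ℕ), (∀ i, ∀ m : ℕ, M ≤ m → (W i).Y a m (w i) = 0) →
    Z.Y a N (G x w e) = G (X.Y a N x) w e + ∑ k, ∑ m ∈ Finset.range M,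
      ((Ring.choose N m : ℤ) : ℂ) •
        G x (Function.update w k ((W k).Y a m (w k))) (e + Pi.single k ((m : ℝ) - N))
  -- The two branches are coefficients of one rational kernel in z_k - z_l, expanded according to
  -- which variable dominates. The sums over `j` are infinite series that are finite at each
  -- exponent, hence the identity for all large `J`.
  assoc : ∀ (a : V) x w e l (M : ℕ), (∀ i, ∀ m : ℕ, M ≤ m → (W i).Y a m (w i) = 0) →
    ∀ᶠ J : ℕ in atTop, G x (Function.update w l ((W l).Y a (-1) (w l))) e =
      ∑ j ∈ Finset.range J, Z.Y a (-1 - j) (G x w (e + Pi.single l (-(j : ℝ)))) +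
      ∑ j ∈ Finset.range J, G (X.Y a j x) w (e + Pi.single l (1 + (j : ℝ))) +
      ∑ k, ∑ m ∈ Finset.range M, ∑ j ∈ Finset.range J,
        if k < l then (-(Ring.choose (-1 - (j : ℤ)) m : ℤ) : ℂ) •
          G x (Function.update w k ((W k).Y a m (w k)))
            (e + Pi.single l (-(j : ℝ)) + Pi.single k (1 + (j : ℝ) + m))
        else if l < k then ((Ring.choose (j : ℤ) m : ℤ) : ℂ) •
          G x (Function.update w k ((W k).Y a m (w k)))
            (e + Pi.single l (1 + (j : ℝ)) + Pi.single k ((m : ℝ) - j))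
        else 0
  derivative : ∀ x w e l, G x (Function.update w l ((W l).L A.ω (-1) (w l))) e =
    ((e l + 1 : ℝ) : ℂ) • G x w (e + Pi.single l 1)
  weight : ∀ x w e (s : ℝ) (r : Fin n → ℝ), x ∈ X.wt A.ω s → (∀ i, w i ∈ (W i).wt A.ω (r i)) →
    G x w e ∈ Z.wt A.ω (s + ∑ k, (r k + e k))
  -- The tail sum at `l` is the weight of the partial product that starts with the operator `l`. For
  -- positive `l` this vector lives in an intermediate discrete module; the value at 0 is fixed only
  -- after pairing with w₀.
  support : ∀ x w (s : ℝ) (r : Fin n → ℝ), x ∈ X.wt A.ω s → (∀ i, w i ∈ (W i).wt A.ω (r i)) →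
    ∃ B : Fin n → Set ℝ, (∀ l, (B l).IsPWO) ∧ ∀ e, G x w e ≠ 0 → ∀ l, 0 < l.val →
      s + ∑ k, (if l ≤ k then r k + e k else 0) ∈ B l

theorem update_succ_comp_succ {n : ℕ} {α : Fin (n + 1) → Type*} (w : ∀ i, α i) (l : Fin n)
    (y : α l.succ) : (fun i : Fin n => Function.update w l.succ y i.succ) =
      Function.update (fun i : Fin n => w i.succ) l y := by
  funext i
  by_cases h : i = l
  · subst h
    simp
  · rw [Function.update_of_ne h, Function.update_of_ne (by simpa using h)]

theorem update_zero_comp_succ {n : ℕ} {α : Fin (n + 1) → Type*} (w : ∀ i, α i) (y : α 0) :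
    (fun i : Fin n => Function.update w 0 y i.succ) = fun i : Fin n => w i.succ := by
  funext i
  rw [Function.update_of_ne (Fin.succ_ne_zero i)]

theorem add_single_zero_comp_succ {n : ℕ} (e : Fin (n + 1) → ℝ) (y : ℝ) :
    (fun i : Fin n => (e + (Pi.single 0 y : Fin (n + 1) → ℝ)) i.succ) = fun i : Fin n => e i.succ := by
  funext i
  simp

theorem add_single_succ_comp_succ {n : ℕ} (e : Fin (n + 1) → ℝ) (l : Fin n) (y : ℝ) :
    (fun i : Fin n => (e + (Pi.single l.succ y : Fin (n + 1) → ℝ)) i.succ) =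
      (fun i : Fin n => e i.succ) + Pi.single l y := by
  funext i
  simp [Pi.single_apply]

theorem add_single_succ_zero {n : ℕ} (e : Fin (n + 1) → ℝ) (l : Fin n) (y : ℝ) :
    (e + (Pi.single l.succ y : Fin (n + 1) → ℝ)) 0 = e 0 := by
  simp

theorem ProductFamily.nil (A : VOA V) (X : ModData.{u, v} V) (W : Fin 0 → ModData.{u, v} V) :
    ProductFamily A X 0 X W (fun x _ _ => x) where
  add_base _ _ _ _ := rfl
  smul_base _ _ _ _ := rfl
  add_slot _ _ _ i := i.elim0
  smul_slot _ _ _ i := i.elim0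
  commutator := by simp
  assoc _ _ _ _ i := i.elim0
  derivative _ _ _ i := i.elim0
  weight := by
    intro x w e s r hx _
    simpa using hx
  support _ _ _ _ _ _ := ⟨fun i => i.elim0, fun i => i.elim0, fun _ _ i => i.elim0⟩

/-- The coefficients of a product after multiplying it on the left by `I`. -/
def consCoeff {A : VOA V} {X Z M : ModData.{u, v} V} {n : ℕ} {W : Fin (n + 1) → ModData.{u, v} V}
    (I : IntertwiningOperator A Z (W 0) M)
    (G : X.carrier → (∀ i : Fin n, (W i.succ).carrier) → (Fin n → ℝ) → M.carrier)
    (x : X.carrier) (w : ∀ i, (W i).carrier) (e : Fin (n + 1) → ℝ) : Z.carrier :=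
  I.mode (-(e 0) - 1) (w 0) (G x (fun i => w i.succ) (fun i => e i.succ))

section cons

variable {A : VOA V} {X Z M : ModData.{u, v} V} {n : ℕ} {W : Fin (n + 1) → ModData.{u, v} V}
  (I : IntertwiningOperator A Z (W 0) M)
  (G : X.carrier → (∀ i : Fin n, (W i.succ).carrier) → (Fin n → ℝ) → M.carrier)

theorem consCoeff_update_zero (x : X.carrier) (w : ∀ i, (W i).carrier) (e : Fin (n + 1) → ℝ)
    (y : (W 0).carrier) : consCoeff I G x (Function.update w 0 y) e =
      I.mode (-(e 0) - 1) y (G x (fun i => w i.succ) (fun i => e i.succ)) := by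
  rw [consCoeff, update_zero_comp_succ, Function.update_self]

theorem consCoeff_update_succ (x : X.carrier) (w : ∀ i, (W i).carrier) (e : Fin (n + 1) → ℝ)
    (l : Fin n) (y : (W l.succ).carrier) : consCoeff I G x (Function.update w l.succ y) e =
      I.mode (-(e 0) - 1) (w 0)
        (G x (Function.update (fun i => w i.succ) l y) (fun i => e i.succ)) := by
  rw [consCoeff, update_succ_comp_succ, Function.update_of_ne (Fin.succ_ne_zero l).symm]

theorem consCoeff_commutator (hG : ProductFamily A X n M (fun i => W i.succ) G) (a : V)
    (x : X.carrier) (w : ∀ i, (W i).carrier) (e : Fin (n + 1) → ℝ) (N : ℤ) (B : ℕ)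
    (hB : ∀ i, ∀ m : ℕ, B ≤ m → (W i).Y a m (w i) = 0) :
    Z.Y a N (consCoeff I G x w e) = consCoeff I G (X.Y a N x) w e +
      ∑ k, ∑ m ∈ Finset.range B, ((Ring.choose N m : ℤ) : ℂ) •
        consCoeff I G x (Function.update w k ((W k).Y a m (w k)))
          (e + Pi.single k ((m : ℝ) - N)) := by
  rw [consCoeff, I.commutator a N _ _ _ B fun m hm => Or.inr (hB 0 m hm),
    hG.commutator a x _ _ N B fun i m hm => hB i.succ m hm, Fin.sum_univ_succ]
  simp only [consCoeff_update_zero, consCoeff_update_succ, add_single_zero_comp_succ,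
    add_single_succ_comp_succ, add_single_succ_zero, map_add, map_sum, map_smul]
  rw [consCoeff, add_assoc, add_comm (∑ k : Fin n, _)]
  congr 2
  refine Finset.sum_congr rfl fun m _ => ?_
  congr 4
  simp
  ring

/-- After the formula for `(a₋₁v)ₙ`, the nonnegative modes standing to the right of `I` are commuted
through the remaining operators, which gives the branch `l < k`. -/
theorem consCoeff_assoc_zero (hM : IsDiscreteModule A M)
    (hG : ProductFamily A X n M (fun i => W i.succ) G) (a : V)
    (x : X.carrier) (w : ∀ i, (W i).carrier) (e : Fin (n + 1) → ℝ) (B : ℕ)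
    (hB : ∀ i, ∀ m : ℕ, B ≤ m → (W i).Y a m (w i) = 0) :
    ∀ᶠ J : ℕ in atTop, consCoeff I G x (Function.update w 0 ((W 0).Y a (-1) (w 0))) e =
      ∑ j ∈ Finset.range J, Z.Y a (-1 - j) (consCoeff I G x w (e + Pi.single 0 (-(j : ℝ)))) +
      ∑ j ∈ Finset.range J, consCoeff I G (X.Y a j x) w (e + Pi.single 0 (1 + (j : ℝ))) +
      ∑ k : Fin n, ∑ m ∈ Finset.range B, ∑ j ∈ Finset.range J,
        ((Ring.choose (j : ℤ) m : ℤ) : ℂ) •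
          consCoeff I G x (Function.update w k.succ ((W k.succ).Y a m (w k.succ)))
            (e + Pi.single 0 (1 + (j : ℝ)) + Pi.single k.succ ((m : ℝ) - j)) := by
  obtain ⟨N₁, hN₁⟩ := I.truncation (w 0) (G x (fun i => w i.succ) (fun i => e i.succ))
  obtain ⟨N₂, hN₂⟩ := hM.isModule.truncation a (G x (fun i => w i.succ) (fun i => e i.succ))
  filter_upwards [tendsto_natCast_atTop_atTop.eventually_ge_atTop (N₁ + e 0 + 1),
    tendsto_natCast_atTop_atTop.eventually_ge_atTop N₂] with J h₁ h₂
  rw [consCoeff_update_zero, I.assoc a _ _ _ J]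
  · rw [Finset.sum_add_distrib, add_assoc]
    congr 1
    · refine Finset.sum_congr rfl fun j _ => ?_
      rw [consCoeff, add_single_zero_comp_succ]
      congr 4
      simp
      ring
    · simp_rw [hG.commutator a x (fun i => w i.succ) _ _ B fun i m hm => hB i.succ m hm]
      simp only [map_add, map_sum, map_smul, Finset.sum_add_distrib, consCoeff_update_succ,
        add_single_zero_comp_succ, add_single_succ_comp_succ, add_single_succ_zero]
      congr 1
      · refine Finset.sum_congr rfl fun j _ => ?_
        rw [consCoeff, add_single_zero_comp_succ]
        congr 3
        simp
        ring
      · rw [Finset.sum_comm]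
        refine Finset.sum_congr rfl fun k _ => ?_
        rw [Finset.sum_comm]
        refine Finset.sum_congr rfl fun m _ => Finset.sum_congr rfl fun j _ => ?_
        congr 4
        · simp
          ring
  · intro j hj
    have : (J : ℝ) ≤ j := by exact_mod_cast hj
    exact hN₁ _ (by linarith)
  · intro j hj
    exact hN₂ _ (h₂.trans (by exact_mod_cast hj))

/-- The negative modes of `a` produced inside by `G` must be pulled out to the left through `I`; the
commutators are the terms with `k = 0`, whence their minus sign. -/
theorem consCoeff_assoc_succ (hG : ProductFamily A X n M (fun i => W i.succ) G) (a : V)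
    (x : X.carrier) (w : ∀ i, (W i).carrier) (e : Fin (n + 1) → ℝ) (l : Fin n) (B : ℕ)
    (hB : ∀ i, ∀ m : ℕ, B ≤ m → (W i).Y a m (w i) = 0) :
    ∀ᶠ J : ℕ in atTop,
      consCoeff I G x (Function.update w l.succ ((W l.succ).Y a (-1) (w l.succ))) e =
      ∑ j ∈ Finset.range J, Z.Y a (-1 - j)
        (consCoeff I G x w (e + Pi.single l.succ (-(j : ℝ)))) +
      ∑ j ∈ Finset.range J, consCoeff I G (X.Y a j x) w (e + Pi.single l.succ (1 + (j : ℝ))) +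
      (∑ m ∈ Finset.range B, ∑ j ∈ Finset.range J,
        (-(Ring.choose (-1 - (j : ℤ)) m : ℤ) : ℂ) •
          consCoeff I G x (Function.update w 0 ((W 0).Y a m (w 0)))
            (e + Pi.single l.succ (-(j : ℝ)) + Pi.single 0 (1 + (j : ℝ) + m)) +
      ∑ k : Fin n, ∑ m ∈ Finset.range B, ∑ j ∈ Finset.range J,
        if k < l then (-(Ring.choose (-1 - (j : ℤ)) m : ℤ) : ℂ) •
          consCoeff I G x (Function.update w k.succ ((W k.succ).Y a m (w k.succ)))
            (e + Pi.single l.succ (-(j : ℝ)) + Pi.single k.succ (1 + (j : ℝ) + m))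
        else if l < k then ((Ring.choose (j : ℤ) m : ℤ) : ℂ) •
          consCoeff I G x (Function.update w k.succ ((W k.succ).Y a m (w k.succ)))
            (e + Pi.single l.succ (1 + (j : ℝ)) + Pi.single k.succ ((m : ℝ) - j))
        else 0) := by
  filter_upwards [hG.assoc a x (fun i => w i.succ) (fun i => e i.succ) l B
    fun i m hm => hB i.succ m hm] with J hJ
  rw [consCoeff_update_succ, hJ]
  simp only [map_add, map_sum, apply_ite (I.mode (-(e 0) - 1) (w 0)), map_smul, map_zero,
    consCoeff_update_succ, consCoeff_update_zero, add_single_zero_comp_succ,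
    add_single_succ_comp_succ, add_single_succ_zero]
  have key : ∀ j : ℕ, Z.Y a (-1 - j) (consCoeff I G x w (e + Pi.single l.succ (-(j : ℝ)))) =
      I.mode (-(e 0) - 1) (w 0) (M.Y a (-1 - j) (G x (fun i => w i.succ)
        ((fun i : Fin n => e i.succ) + Pi.single l (-(j : ℝ))))) +
      ∑ m ∈ Finset.range B, ((Ring.choose (-1 - (j : ℤ)) m : ℤ) : ℂ) •
        I.mode (-((e + Pi.single l.succ (-(j : ℝ)) + Pi.single 0 (1 + (j : ℝ) + m) : Fin (n + 1) → ℝ) 0) - 1)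
          ((W 0).Y a m (w 0)) (G x (fun i => w i.succ)
            ((fun i : Fin n => e i.succ) + Pi.single l (-(j : ℝ)))) := by
    intro j
    rw [consCoeff, I.commutator a _ _ _ _ B fun m hm => Or.inr (hB 0 m hm),
      add_single_succ_comp_succ, add_single_succ_zero]
    congr 1
    refine Finset.sum_congr rfl fun m _ => ?_
    congr 4
    simp
    ring
  simp only [key, Finset.sum_add_distrib]
  rw [Finset.sum_comm (s := Finset.range J) (t := Finset.range B)]
  simp only [neg_smul, Finset.sum_neg_distrib, consCoeff, add_single_succ_comp_succ,
    add_single_succ_zero]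
  abel

theorem ProductFamily.cons (hM : IsDiscreteModule A M)
    (hG : ProductFamily A X n M (fun i => W i.succ) G) :
    ProductFamily A X (n + 1) Z W (consCoeff I G) where
  add_base x y w e := by simp [consCoeff, hG.add_base]
  smul_base t x w e := by simp [consCoeff, hG.smul_base]
  add_slot x w e i u v := by
    refine Fin.cases (fun u v => ?_) (fun i u v => ?_) i u v
    · simp only [consCoeff_update_zero, map_add, LinearMap.add_apply]
    · simp only [consCoeff_update_succ, hG.add_slot, map_add]
  smul_slot x w e i t u := by
    refine Fin.cases (fun u => ?_) (fun i u => ?_) i u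
    · simp only [consCoeff_update_zero, map_smul, LinearMap.smul_apply]
    · simp only [consCoeff_update_succ, hG.smul_slot, map_smul]
  commutator a x w e N B hB := consCoeff_commutator I G hG a x w e N B hB
  assoc a x w e l B hB := by
    refine Fin.cases ?_ (fun l => ?_) l
    · filter_upwards [consCoeff_assoc_zero I G hM hG a x w e B hB] with J hJ
      rw [hJ, Fin.sum_univ_succ]
      simp
    · filter_upwards [consCoeff_assoc_succ I G hG a x w e l B hB] with J hJ
      rw [hJ, Fin.sum_univ_succ]
      simp
  derivative x w e l := by
    refine Fin.cases ?_ (fun l => ?_) l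
    · rw [consCoeff_update_zero, I.derivative, consCoeff, add_single_zero_comp_succ]
      rw [LinearMap.smul_apply]
      congr 1
      · push_cast
        ring
      · congr 3
        simp
        ring
    · rw [consCoeff_update_succ, hG.derivative, consCoeff, add_single_succ_comp_succ,
        add_single_succ_zero, map_smul]
  weight x w e s r hx hw := by
    have := I.mode_mem_wt (hw 0) (hG.weight x (fun i => w i.succ) (fun i => e i.succ) s
      (fun i => r i.succ) hx fun i => hw i.succ) (-(e 0) - 1)
    rw [Fin.sum_univ_succ]
    have hs : s + (r 0 + e 0 + ∑ k : Fin n, (r k.succ + e k.succ)) =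
        r 0 + (s + ∑ k : Fin n, (r k.succ + e k.succ)) - (-(e 0) - 1) - 1 := by ring
    rw [hs]
    exact this
  support x w s r hx hw := by
    obtain ⟨B, hB, hB'⟩ := hG.support x (fun i => w i.succ) s (fun i => r i.succ) hx
      fun i => hw i.succ
    -- Slot 0 carries no condition, so any set serves there. In slot 1 the tail sum is a weight of
    -- `M`; in later slots the bound is inherited from `G`.
    refine ⟨Fin.cons ∅ fun l => {t | M.wt A.ω t ≠ ⊥} ∪ B l, fun l => ?_, fun e he l hl => ?_⟩
    · refine Fin.cases ?_ (fun l => ?_) l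
      · exact Set.isPWO_empty
      · exact hM.isPWO_weights.union (hB l)
    · have hne : G x (fun i => w i.succ) (fun i => e i.succ) ≠ 0 := by
        intro h
        apply he
        rw [consCoeff, h, map_zero]
      obtain ⟨l, rfl⟩ := Fin.exists_succ_eq.2 (Fin.pos_iff_ne_zero.1 hl)
      rw [Fin.cons_succ, Fin.sum_univ_succ]
      simp only [Fin.succ_le_succ_iff]
      rw [if_neg (by simp), zero_add]
      rcases Nat.eq_zero_or_pos l.val with h0 | h0
      · left
        have hw' := hG.weight x (fun i => w i.succ) (fun i => e i.succ) s
          (fun i => r i.succ) hx fun i => hw i.succ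
        have hle : ∀ k : Fin n, l ≤ k := fun k => by
          rw [Fin.le_def]
          omega
        simp only [hle, if_true]
        exact (Submodule.ne_bot_iff _).2 ⟨_, hw', hne⟩
      · exact Or.inr (hB' _ hne l h0)

end cons

/-- `IsProduct` records the coefficients for fixed vectors only, whereas the Ward identities alter
the vectors, so the dependence on them is recovered here by induction. -/
theorem IsProduct.exists_productFamily {A : VOA V} {X : ModData.{u, v} V} {x : X.carrier}
    {n : ℕ} {Z : ModData.{u, v} V} {W : Fin n → ModData.{u, v} V} {w : ∀ i, (W i).carrier}
    {F : (Fin n → ℝ) → Z.carrier} (h : IsProduct A X x n Z W w F) :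
    ∃ G : X.carrier → (∀ i, (W i).carrier) → (Fin n → ℝ) → Z.carrier,
      ProductFamily A X n Z W G ∧ ∀ e, G x w e = F e := by
  induction h with
  | nil W w => exact ⟨fun x _ _ => x, ProductFamily.nil A X W, fun _ => rfl⟩
  | cons W w F hM I _ ih =>
    obtain ⟨G, hG, hF⟩ := ih
    exact ⟨consCoeff I G, hG.cons I G hM, fun e => by rw [consCoeff, hF]⟩

end intertwining

/-! ### Expansions of rational functions acting on formal series. -/

/-- Rational functions act on formal series through their expansions. -/
noncomputable instance ratFunModule (p : ℕ) : Module (RatFun p) (RSeries p) :=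
  Module.compHom _ (expand p)

theorem ratFun_smul_def {p : ℕ} (f : RatFun p) (φ : RSeries p) : f • φ = expand p f * φ := rfl

theorem expand_algebraMap {p : ℕ} (P : MvPolynomial (Fin p) ℂ) :
    expand p (algebraMap _ (RatFun p) P) = polyExpand p P :=
  IsFractionRing.lift_algebraMap (polyExpand_injective p) P

instance (p : ℕ) : IsScalarTower ℂ (RatFun p) (RSeries p) where
  smul_assoc t f φ := by
    rw [ratFun_smul_def, ratFun_smul_def, Algebra.smul_def, map_mul,
      IsScalarTower.algebraMap_apply ℂ (MvPolynomial (Fin p) ℂ) (RatFun p), expand_algebraMap]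
    have : polyExpand p (algebraMap ℂ (MvPolynomial (Fin p) ℂ) t) =
        algebraMap ℂ (RSeries p) t := by
      change MvPolynomial.aeval _ _ = _
      rw [AlgHom.commutes]
    rw [this, mul_assoc]
    exact (Algebra.smul_def t _).symm

theorem expand_zvar {p : ℕ} (i : Fin p) :
    expand p (zvar i) = HahnSeries.single (expo (Pi.single i 1)) 1 := by
  rw [zvar, expand_algebraMap]
  change MvPolynomial.aeval _ _ = _
  rw [MvPolynomial.aeval_X]

theorem expo_add {p : ℕ} (e f : Fin p → ℝ) : expo (e + f) = expo e + expo f := rfl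

theorem expo_zero {p : ℕ} : expo (0 : Fin p → ℝ) = 0 := rfl

theorem expo_surjective {p : ℕ} (e : Expo p) : ∃ f, expo f = e :=
  ⟨fun i => Expo.at e i, rfl⟩

theorem ext_expo {p : ℕ} {φ ψ : RSeries p} (h : ∀ e, φ.coeff (expo e) = ψ.coeff (expo e)) :
    φ = ψ := by
  ext e
  obtain ⟨f, rfl⟩ := expo_surjective e
  exact h f

theorem single_expo_mul {p : ℕ} (e f : Fin p → ℝ) :
    (HahnSeries.single (expo e) (1 : ℂ) * HahnSeries.single (expo f) 1 : RSeries p) =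
      HahnSeries.single (expo (e + f)) 1 := by
  rw [HahnSeries.single_mul_single, one_mul, expo_add]

theorem single_expo_inv {p : ℕ} (e : Fin p → ℝ) :
    (HahnSeries.single (expo e) (1 : ℂ) : RSeries p)⁻¹ = HahnSeries.single (expo (-e)) 1 := by
  refine inv_eq_of_mul_eq_one_right ?_
  rw [single_expo_mul, add_neg_cancel, expo_zero]
  rfl

theorem single_expo_zpow {p : ℕ} (l : Fin p) (q : ℤ) :
    (HahnSeries.single (expo (Pi.single l 1)) (1 : ℂ) : RSeries p) ^ q =
      HahnSeries.single (expo (Pi.single l (q : ℝ))) 1 := by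
  have h : ∀ k : ℕ, (HahnSeries.single (expo (Pi.single l 1)) (1 : ℂ) : RSeries p) ^ k =
      HahnSeries.single (expo (Pi.single l (k : ℝ))) 1 := by
    intro k
    rw [single_expo_pow]
    congr 3
    funext i
    by_cases hi : i = l
    · subst hi
      simp
    · simp [hi]
  cases q with
  | ofNat k => simpa using h k
  | negSucc k =>
    rw [zpow_negSucc, h, single_expo_inv, ← Pi.single_neg]
    simp

theorem coeff_single_expo_mul {p : ℕ} (f : Fin p → ℝ) (φ : RSeries p) (e : Fin p → ℝ) :
    (HahnSeries.single (expo f) (1 : ℂ) * φ).coeff (expo e) = φ.coeff (expo (e - f)) := by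
  conv_lhs => rw [← sub_add_cancel e f, expo_add]
  rw [HahnSeries.coeff_single_mul_add, one_mul]

theorem coeff_zvar_zpow_smul {p : ℕ} (l : Fin p) (q : ℤ) (φ : RSeries p) (e : Fin p → ℝ) :
    (zvar l ^ q • φ).coeff (expo e) = φ.coeff (expo (e + Pi.single l (-(q : ℝ)))) := by
  rw [ratFun_smul_def, map_zpow₀, expand_zvar, single_expo_zpow, coeff_single_expo_mul,
    sub_eq_add_neg, ← Pi.single_neg]

/-- The exponent of z_l is compared before that of z_k, so z_l/z_k is infinitesimal and may be
substituted into power series. -/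
theorem expo_single_add_single_pos {p : ℕ} {k l : Fin p} (h : k < l) :
    (0 : Expo p) < expo (Pi.single l 1 + Pi.single k (-1)) := by
  refine ⟨OrderDual.toDual l, fun j hj => ?_, ?_⟩
  · have hj' : l < OrderDual.ofDual j := hj
    change (0 : ℝ) = (Pi.single l 1 + Pi.single k (-1) : Fin p → ℝ) (OrderDual.ofDual j)
    simp [hj'.ne', (h.trans hj').ne']
  · change (0 : ℝ) < (Pi.single l 1 + Pi.single k (-1) : Fin p → ℝ) l
    simp [h.ne']

/-- With x = z_l/z_k one has (z_k - z_l)^{-m-1} = z_k^{-m-1}(1 - x)^{-m-1}, and the last factor is a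
binomial series in x. -/
theorem expand_sub_inv_pow {p : ℕ} {k l : Fin p} (h : k < l) (m : ℕ) :
    expand p ((zvar k - zvar l)⁻¹ ^ (m + 1)) =
      HahnSeries.single (expo (Pi.single k (-((m : ℝ) + 1)))) 1 *
        PowerSeries.heval (HahnSeries.single (expo (Pi.single l 1 + Pi.single k (-1))) (1 : ℂ))
          (PowerSeries.mk fun n => (((m + n).choose m : ℕ) : ℂ)) := by
  set x : RSeries p := HahnSeries.single (expo (Pi.single l 1 + Pi.single k (-1))) (1 : ℂ)
  have hx : 0 < x.orderTop := by
    rw [HahnSeries.orderTop_single one_ne_zero]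
    exact WithTop.coe_lt_coe.2 (expo_single_add_single_pos h)
  have h1 : PowerSeries.heval x (PowerSeries.mk fun n => (((m + n).choose m : ℕ) : ℂ)) *
      (1 - x) ^ (m + 1) = 1 := by
    have := congrArg (PowerSeries.heval x) (PowerSeries.mk_add_choose_mul_one_sub_pow_eq_one ℂ m)
    rwa [map_mul, map_pow, map_sub, map_one, PowerSeries.heval_X x hx] at this
  have h2 : expand p (zvar k - zvar l) =
      HahnSeries.single (expo (Pi.single k 1)) 1 * (1 - x) := by
    rw [map_sub, expand_zvar, expand_zvar, mul_sub, mul_one, single_expo_mul]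
    congr 4
    rw [add_comm (Pi.single l 1), ← add_assoc, ← Pi.single_add]
    simp
  rw [map_pow, map_inv₀, inv_pow]
  refine inv_eq_of_mul_eq_one_right ?_
  have h3 : (HahnSeries.single (expo (Pi.single k 1)) (1 : ℂ) : RSeries p) ^ (m + 1) *
      HahnSeries.single (expo (Pi.single k (-((m : ℝ) + 1)))) 1 = 1 := by
    rw [← zpow_natCast, single_expo_zpow, single_expo_mul, ← Pi.single_add]
    simp [expo_zero]
  rw [h2, mul_pow]
  linear_combination (1 : RSeries p) * h3 + (HahnSeries.single (expo (Pi.single k 1)) (1 : ℂ)) ^ (m + 1) *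
      HahnSeries.single (expo (Pi.single k (-((m : ℝ) + 1)))) 1 * h1

/-- The expansion of `(z_k - z_l)^{-m-1}`, `k < l`, acting on a series, coefficient by
coefficient. -/
theorem coeff_sub_inv_pow_smul {p : ℕ} {k l : Fin p} (h : k < l) (m : ℕ) (φ : RSeries p)
    (e : Fin p → ℝ) : ∀ᶠ J : ℕ in atTop,
    ((zvar k - zvar l)⁻¹ ^ (m + 1) • φ).coeff (expo e) = ∑ j ∈ Finset.range J,
      (((m + j).choose m : ℕ) : ℂ) *
        φ.coeff (expo (e + Pi.single l (-(j : ℝ)) + Pi.single k (1 + (j : ℝ) + m))) := by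
  set x : RSeries p := HahnSeries.single (expo (Pi.single l 1 + Pi.single k (-1))) (1 : ℂ) with hxdef
  have hx : 0 < x.orderTop := by
    rw [HahnSeries.orderTop_single one_ne_zero]
    exact WithTop.coe_lt_coe.2 (expo_single_add_single_pos h)
  set f : PowerSeries ℂ := PowerSeries.mk fun n => (((m + n).choose m : ℕ) : ℂ)
  set y : RSeries p := HahnSeries.single (expo (Pi.single k (-((m : ℝ) + 1)))) 1 with hy
  set s := (y * φ) • HahnSeries.SummableFamily.powerSeriesFamily x f
  have hs : (zvar k - zvar l)⁻¹ ^ (m + 1) • φ = s.hsum := by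
    rw [HahnSeries.SummableFamily.hsum_smul, ratFun_smul_def, expand_sub_inv_pow h,
      PowerSeries.heval_apply]
    ring
  have hj : ∀ j : ℕ, (s j).coeff (expo e) = (((m + j).choose m : ℕ) : ℂ) *
      φ.coeff (expo (e + Pi.single l (-(j : ℝ)) + Pi.single k (1 + (j : ℝ) + m))) := by
    intro j
    have h1 : s j = (y * φ) * ((((m + j).choose m : ℕ) : ℂ) • x ^ j) := by
      rw [← HahnSeries.of_symm_smul_of_eq_mul, HahnSeries.SummableFamily.smul_apply,
        HahnSeries.SummableFamily.powerSeriesFamily_of_orderTop_pos hx, PowerSeries.coeff_mk]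
    have h2 : s j = (((m + j).choose m : ℕ) : ℂ) • (HahnSeries.single (expo
        (Pi.single k (-((m : ℝ) + 1)) + fun i => j * (Pi.single l 1 + Pi.single k (-1) : Fin p → ℝ) i))
          (1 : ℂ) * φ) := by
      rw [h1, hxdef, single_expo_pow, ← single_expo_mul]
      refine (Algebra.mul_smul_comm _ _ _).trans ?_
      congr 1
      ring
    rw [h2, HahnSeries.coeff_smul, coeff_single_expo_mul, smul_eq_mul]
    congr 4
    funext i
    by_cases hi : i = l
    · subst hi
      simp [h.ne', sub_eq_add_neg]
    · by_cases hi' : i = k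
      · subst hi'
        simp [hi]
        ring
      · simp [hi, hi']
  have hfin := s.finite_co_support (expo e)
  filter_upwards [eventually_ge_atTop (hfin.toFinset.sup id + 1)] with J hJ
  rw [hs, HahnSeries.SummableFamily.coeff_hsum, finsum_eq_sum_of_support_subset (s := Finset.range J)]
  · exact Finset.sum_congr rfl fun j _ => hj j
  · intro j hjs
    have : j ≤ hfin.toFinset.sup id := Finset.le_sup (f := id) (hfin.mem_toFinset.2 hjs)
    simp only [Finset.coe_range, Set.mem_Iio]
    omega

theorem coeff_partialD {p : ℕ} (l : Fin p) (φ : RSeries p) (e : Fin p → ℝ) :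
    (partialD l φ).coeff (expo e) =
      ((e l + 1 : ℝ) : ℂ) * φ.coeff (expo (e + Pi.single l 1)) := by
  rw [partialD, coeff_single_expo_mul, Pi.single_neg, sub_neg_eq_add]
  change (((e + (Pi.single l 1 : Fin p → ℝ)) l : ℝ) : ℂ) * _ = _
  simp

/-- At the largest index where the exponents differ, the two tail sums differ exactly by that
component. -/
theorem expo_le_expo_of_tail_sums {p : ℕ} (s : ℝ) (r e f : Fin p → ℝ)
    (h : ∀ l, s + ∑ k, (if l ≤ k then r k + e k else 0) ≤
      s + ∑ k, (if l ≤ k then r k + f k else 0)) : expo e ≤ expo f := by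
  by_contra hlt
  rw [not_le] at hlt
  obtain ⟨i, hi, hlt⟩ := hlt
  refine absurd (h (OrderDual.ofDual i)) (not_le.2 ?_)
  refine add_lt_add_right (Finset.sum_lt_sum (fun k _ => ?_)
    ⟨OrderDual.ofDual i, Finset.mem_univ _, ?_⟩) s
  · by_cases hk : OrderDual.ofDual i ≤ k
    · rw [if_pos hk, if_pos hk]
      rcases hk.eq_or_lt with rfl | hk
      · exact add_le_add_right (le_of_lt hlt) _
      · exact add_le_add_right (le_of_eq (hi (OrderDual.toDual k) hk)) _
    · rw [if_neg hk, if_neg hk]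
  · rw [if_pos le_rfl, if_pos le_rfl]
    exact add_lt_add_right hlt _

/-- A product of partially well-ordered sets is partially well-ordered (Dickson), and comparison of
tail sums implies lexicographic comparison of exponents. -/
theorem isPWO_of_tail_sums {p : ℕ} (s : ℝ) (r : Fin p → ℝ) (B : Fin p → Set ℝ)
    (hB : ∀ l, (B l).IsPWO) :
    {e : Expo p | ∀ l, s + ∑ k, (if l ≤ k then r k + Expo.at e k else 0) ∈ B l}.IsPWO := by
  intro f
  have := Set.IsPWO.pi hB
  obtain ⟨m, n, hmn, hle⟩ := this fun n =>
    ⟨fun l => s + ∑ k, (if l ≤ k then r k + Expo.at (f n).1 k else 0), fun l _ => (f n).2 l⟩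
  exact ⟨m, n, hmn, expo_le_expo_of_tail_sums s r _ _ hle⟩

theorem choose_neg_one_sub (j m : ℕ) :
    Ring.choose (-1 - (j : ℤ)) m = (-1) ^ m * (((m + j).choose m : ℕ) : ℤ) := by
  have h : (-1 - (j : ℤ)) = -((j : ℤ) + 1) := by ring
  have h' : (j : ℤ) + 1 + m - 1 = ((m + j : ℕ) : ℤ) := by
    push_cast
    ring
  rw [h, Ring.choose_neg, h', Ring.choose_natCast]
  simp [Int.negOnePow, Units.smul_def]

/-- This resums the two branches of `ProductFamily.assoc` into the action of a single rational
function, whichever of z_k and z_l dominates. -/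
theorem coeff_kernel_smul {p : ℕ} (k l : Fin p) (m : ℕ) (φ : RSeries p) (e : Fin p → ℝ) :
    ∀ᶠ J : ℕ in atTop,
    -((((-1) ^ m * (zvar k - zvar l)⁻¹ ^ (m + 1) : RatFun p) • φ).coeff (expo e)) =
      ∑ j ∈ Finset.range J,
        if k < l then (-(Ring.choose (-1 - (j : ℤ)) m : ℤ) : ℂ) *
          φ.coeff (expo (e + Pi.single l (-(j : ℝ)) + Pi.single k (1 + (j : ℝ) + m)))
        else if l < k then ((Ring.choose (j : ℤ) m : ℤ) : ℂ) *
          φ.coeff (expo (e + Pi.single l (1 + (j : ℝ)) + Pi.single k ((m : ℝ) - j)))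
        else 0 := by
  rcases lt_trichotomy k l with h | rfl | h
  · filter_upwards [coeff_sub_inv_pow_smul h m φ e] with J hJ
    have hsm : (((-1) ^ m * (zvar k - zvar l)⁻¹ ^ (m + 1) : RatFun p) • φ) =
        ((-1 : ℂ) ^ m) • ((zvar k - zvar l)⁻¹ ^ (m + 1) : RatFun p) • φ := by
      rw [← smul_assoc, Algebra.smul_def]
      simp
    rw [hsm, HahnSeries.coeff_smul, hJ, smul_eq_mul, Finset.mul_sum, ← Finset.sum_neg_distrib]
    refine Finset.sum_congr rfl fun j _ => ?_
    rw [if_pos h, choose_neg_one_sub]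
    push_cast
    ring
  -- On the diagonal the convention `0⁻¹ = 0` removes the kernel, in agreement with the third
  -- branch, so sums may run over all `k`.
  · have h0 : ((-1) ^ m * (zvar k - zvar k)⁻¹ ^ (m + 1) : RatFun p) = 0 := by
      rw [sub_self, inv_zero, zero_pow (Nat.succ_ne_zero m), mul_zero]
    refine Eventually.of_forall fun J => ?_
    have h1 : ((0 : RatFun p) • φ) = 0 := by
      rw [ratFun_smul_def, map_zero, zero_mul]
    rw [h0, h1]
    simp
  · have hsm : (-1) ^ m * (zvar k - zvar l)⁻¹ ^ (m + 1) =
        -((zvar l - zvar k)⁻¹ ^ (m + 1) : RatFun p) := by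
      have hinv : (zvar l - zvar k : RatFun p)⁻¹ = -(zvar k - zvar l)⁻¹ := by
        rw [← neg_sub (zvar k) (zvar l)]
        exact inv_neg
      rw [hinv, neg_pow _ (m + 1), pow_succ (-1 : RatFun p)]
      ring
    have hJ := coeff_sub_inv_pow_smul h m φ e
    obtain ⟨J₀, hJ₀⟩ := eventually_atTop.1 hJ
    -- The binomials C(j, m) vanish for j < m, so the sum effectively starts at `m`; shifting it by
    -- `m` matches the binomial series.
    filter_upwards [eventually_ge_atTop (m + J₀)] with J hJJ
    obtain ⟨i, rfl⟩ := Nat.exists_eq_add_of_le (le_of_add_le_left hJJ)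
    rw [hsm, neg_smul, HahnSeries.coeff_neg, neg_neg, hJ₀ i (by omega), Finset.sum_range_add]
    rw [Finset.sum_eq_zero (s := Finset.range m), zero_add]
    · refine Finset.sum_congr rfl fun j _ => ?_
      rw [if_neg h.le.not_gt, if_pos h, Ring.choose_natCast]
      push_cast
      have he : e + Pi.single k (-(j : ℝ)) + Pi.single l (1 + (j : ℝ) + m) =
          e + Pi.single l (1 + ((m : ℝ) + j)) + Pi.single k ((m : ℝ) - (m + j)) := by
        rw [add_right_comm]
        congr 3 <;> ring
      rw [he]
    · intro j hj
      rw [if_neg h.le.not_gt, if_pos h, Ring.choose_natCast,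
        Nat.choose_eq_zero_of_lt (Finset.mem_range.1 hj)]
      simp

/-- Induction on a tuple of vectors lying in the spans of given sets. -/
theorem multilinear_span_induction {ι : Type*} [Fintype ι] [DecidableEq ι] {M : ι → Type*}
    [∀ i, AddCommGroup (M i)] [∀ i, Module ℂ (M i)] (S : ∀ i, Set (M i))
    {Q : (∀ i, M i) → Prop}
    (add : ∀ w i x y, Q (Function.update w i x) → Q (Function.update w i y) →
      Q (Function.update w i (x + y)))
    (smul : ∀ w i (t : ℂ) x, Q (Function.update w i x) → Q (Function.update w i (t • x)))
    (zero : ∀ w i, Q (Function.update w i 0)) (base : ∀ w, (∀ i, w i ∈ S i) → Q w)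
    (w : ∀ i, M i) (hw : ∀ i, w i ∈ Submodule.span ℂ (S i)) : Q w := by
  suffices H : ∀ s : Finset ι, ∀ w : ∀ i, M i, (∀ i ∈ s, w i ∈ Submodule.span ℂ (S i)) →
      (∀ i, i ∉ s → w i ∈ S i) → Q w from
    H Finset.univ w (fun i _ => hw i) fun i hi => absurd (Finset.mem_univ i) hi
  intro s
  induction s using Finset.induction_on with
  | empty => exact fun w _ h => base w fun i => h i (Finset.notMem_empty i)
  | insert i s hi ih =>
    intro w h₁ h₂
    suffices H : ∀ x ∈ Submodule.span ℂ (S i), Q (Function.update w i x) by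
      have := H (w i) (h₁ i (Finset.mem_insert_self i s))
      rwa [Function.update_eq_self] at this
    intro x hx
    induction hx using Submodule.span_induction with
    | mem x hx =>
      refine ih _ (fun j hj => ?_) fun j hj => ?_
      · rw [Function.update_of_ne (fun h : j = i => hi (h ▸ hj))]
        exact h₁ j (Finset.mem_insert_of_mem hj)
      · by_cases hji : j = i
        · subst hji
          rwa [Function.update_self]
        · rw [Function.update_of_ne hji]
          exact h₂ j (by simp [hji, hj])
    | zero => exact zero w i
    | add x y _ _ hx hy => exact add w i x y hx hy
    | smul t x _ hx => exact smul w i t x hx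

/-! ### Homogeneous vectors and adjoint modes. -/

section

variable {V : Type u} [AddCommGroup V] [Module ℂ V]

theorem IsVOAModule.span_homogeneous {A : VOA V} {W : ModData.{u, v} V} (hW : IsVOAModule A W)
    (w : W.carrier) : w ∈ Submodule.span ℂ {x | ∃ r, x ∈ W.wt A.ω r} := by
  have h : (⨆ r, W.wt A.ω r) ≤ Submodule.span ℂ {x | ∃ r, x ∈ W.wt A.ω r} :=
    iSup_le fun r x hx => Submodule.subset_span ⟨r, hx⟩
  rw [hW.grading.submodule_iSup_eq_top] at h
  exact h trivial

theorem VOA.component_of_mem (A : VOA V) {h : ℤ} {a : V} (ha : a ∈ A.gr h) (k : ℤ) :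
    A.component k a = if k = h then a else 0 := by
  have : (LinearEquiv.ofBijective (DirectSum.coeLinearMap A.gr) A.grading).symm a =
      DirectSum.lof ℂ ℤ (fun i => A.gr i) h ⟨a, ha⟩ := by
    rw [LinearEquiv.symm_apply_eq]
    exact (DirectSum.coeLinearMap_lof (A := A.gr) h ⟨a, ha⟩).symm
  rw [VOA.component, this]
  split_ifs with hk
  · subst hk
    simp [DirectSum.lof_apply]
  · rw [DirectSum.lof_eq_of, DirectSum.of_eq_of_ne _ _ _ hk]
    rfl

theorem VOA.exists_L1_pow_eq_zero (A : VOA V) {h : ℤ} {a : V} (ha : a ∈ A.gr h) :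
    ∃ K : ℕ, ∀ k, K ≤ k → ((A.Y A.ω 2) ^ k) a = 0 := by
  obtain ⟨N, hN⟩ := A.bounded_below
  refine ⟨(h - N + 1).toNat, fun k hk => ?_⟩
  have := L1_pow_mem_gr A ha k
  rw [VOA.gr, hN _ (by omega)] at this
  exact (Submodule.mem_bot ℂ).1 this

theorem adjointMode_of_mem (A : VOA V) {W : ModData.{u, v} V} (hW : IsVOAModule A W) {h : ℤ}
    {a : V} (ha : a ∈ A.gr h) {K : ℕ} (hK : ∀ k, K ≤ k → ((A.Y A.ω 2) ^ k) a = 0) (n : ℤ) :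
    adjointMode A W a n = ∑ k ∈ Finset.range K, ((-1 : ℂ) ^ h / (k.factorial : ℂ)) •
      W.Y (((A.Y A.ω 2) ^ k) a) (2 * h - k - n - 2) := by
  have h0 : ∀ m, W.Y 0 m = 0 := fun m => by
    simpa using hW.map_smul 0 0 m
  rw [adjointMode, finsum_eq_single _ h]
  · rw [finsum_eq_sum_of_support_subset (s := Finset.range K)]
    · simp [A.component_of_mem ha]
    · intro k hk
      by_contra hk'
      apply hk
      simp only [Finset.coe_range, Set.mem_Iio, not_lt] at hk'
      simp [A.component_of_mem ha, hK k hk', h0]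
  · intro k hk
    simp [A.component_of_mem ha, hk, h0]

theorem adjointMode_mem_wt (A : VOA V) {W : ModData.{u, v} V} (hW : IsVOAModule A W) {h : ℤ}
    {a : V} (ha : a ∈ A.gr h) {r : ℝ} {w : W.carrier} (hw : w ∈ W.wt A.ω r) (n : ℤ) :
    adjointMode A W a n w ∈ W.wt A.ω (r - h + n + 1) := by
  obtain ⟨K, hK⟩ := A.exists_L1_pow_eq_zero ha
  rw [adjointMode_of_mem A hW ha hK, LinearMap.sum_apply]
  refine Submodule.sum_mem _ fun k _ => Submodule.smul_mem _ _ ?_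
  have := mode_mem_wt A W hW.map_smul hW.jacobi hW.derivative (L1_pow_mem_gr A ha k) hw
    (2 * h - k - n - 2)
  convert this using 2
  push_cast
  ring

/-- Apply [L(0), L(-2)] = 2L(-2) to the vacuum, using ω = L(-2)1. -/
theorem VOA.ω_mem_gr (A : VOA V) : A.ω ∈ A.gr 2 := by
  have h := LinearMap.congr_fun (A.virasoro 0 (-2)) A.one
  simp [A.creation, A.creation_one] at h
  exact Module.End.mem_eigenspace_iff.2 (by simpa using h)

theorem VOA.L1_ω (A : VOA V) : A.Y A.ω 2 A.ω = 0 := by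
  have h := LinearMap.congr_fun (A.virasoro 1 (-2)) A.one
  simp [A.creation, A.creation_one] at h
  exact h

/-- As ω has weight 2 and L(1)ω = 0, only the term `k = 0` remains, with sign +1: L(0) is
self-adjoint. -/
theorem adjointMode_ω (A : VOA V) {W : ModData.{u, v} V} (hW : IsVOAModule A W) :
    adjointMode A W A.ω 1 = W.Y A.ω 1 := by
  rw [adjointMode_of_mem A hW A.ω_mem_gr (K := 1)]
  · simp
  · intro k hk
    obtain ⟨k, rfl⟩ := Nat.exists_eq_add_of_le' hk
    rw [pow_succ, Module.End.mul_apply, A.L1_ω, map_zero]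

end

/-! ### Correlation functions and their Ward identities. -/

section correlators

/-- The slots of the vectors `w₁, …, w_p` among `w₀, …, w_{p+1}`. -/
abbrev midSlot {p : ℕ} (i : Fin p) : Fin (p + 2) := i.succ.castSucc

theorem midSlot_injective {p : ℕ} : Function.Injective (midSlot (p := p)) := fun _ _ h =>
  Fin.succ_injective _ (Fin.castSucc_injective _ h)

theorem midSlot_ne_zero {p : ℕ} (i : Fin p) : midSlot i ≠ 0 := fun h =>
  Fin.succ_ne_zero i (Fin.castSucc_injective _ h)

theorem midSlot_ne_last {p : ℕ} (i : Fin p) : midSlot i ≠ Fin.last (p + 1) :=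
  Fin.castSucc_ne_last _

theorem slot_cases {p : ℕ} {P : Fin (p + 2) → Prop} (zero : P 0) (last : P (Fin.last (p + 1)))
    (mid : ∀ i : Fin p, P (midSlot i)) (i : Fin (p + 2)) : P i := by
  refine Fin.lastCases last (fun i => ?_) i
  exact Fin.cases zero mid i

section update

variable {p : ℕ} {α : Fin (p + 2) → Type*} (w : ∀ i, α i)

theorem update_midSlot_comp (l : Fin p) (y : α (midSlot l)) :
    (fun i : Fin p => Function.update w (midSlot l) y (midSlot i)) =
      Function.update (fun i : Fin p => w (midSlot i)) l y := by
  funext i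
  by_cases h : i = l
  · subst h
    simp
  · rw [Function.update_of_ne h, Function.update_of_ne (fun h' => h (midSlot_injective h'))]

theorem update_zero_comp_midSlot (y : α 0) :
    (fun i : Fin p => Function.update w 0 y (midSlot i)) = fun i : Fin p => w (midSlot i) := by
  funext i
  rw [Function.update_of_ne (midSlot_ne_zero i)]

theorem update_last_comp_midSlot (y : α (Fin.last (p + 1))) :
    (fun i : Fin p => Function.update w (Fin.last (p + 1)) y (midSlot i)) =
      fun i : Fin p => w (midSlot i) := by
  funext i
  rw [Function.update_of_ne (midSlot_ne_last i)]

end update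

variable {V : Type u} [AddCommGroup V] [Module ℂ V]

/-- The relations among the values of a correlation function that come from moving the modes of
an element of `V` from one slot to the others. -/
structure WardIdentities (A : VOA V) {p : ℕ} (W : Fin (p + 2) → ModData.{u, v} V) {E : Type*}
    [AddCommGroup E] [Module (RatFun p) E] (c : (∀ i, (W i).carrier) → E) : Prop where
  mid : ∀ (a : V) (w : ∀ i, (W i).carrier) (l : Fin p) (M : ℕ),
    (∀ i, i ≠ 0 → ∀ m : ℕ, M ≤ m → (W i).Y a m (w i) = 0) →
    (∀ m : ℕ, M ≤ m → adjointMode A (W 0) a (-1 - m) (w 0) = 0) →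
    c (Function.update w (midSlot l) ((W (midSlot l)).Y a (-1) (w (midSlot l)))) =
      ∑ m ∈ Finset.range M,
        zvar l ^ (m : ℤ) • c (Function.update w 0 (adjointMode A (W 0) a (-1 - m) (w 0))) +
      ∑ m ∈ Finset.range M, zvar l ^ (-1 - (m : ℤ)) • c (Function.update w (Fin.last (p + 1))
        ((W (Fin.last (p + 1))).Y a m (w (Fin.last (p + 1))))) -
      ∑ k : Fin p, ∑ m ∈ Finset.range M, ((-1) ^ m * (zvar k - zvar l)⁻¹ ^ (m + 1)) •
        c (Function.update w (midSlot k) ((W (midSlot k)).Y a m (w (midSlot k))))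
  zero : ∀ (a : V) (w : ∀ i, (W i).carrier) (N : ℤ) (M : ℕ),
    (∀ i, i ≠ 0 → ∀ m : ℕ, M ≤ m → (W i).Y a m (w i) = 0) →
    c (Function.update w 0 (adjointMode A (W 0) a N (w 0))) =
      c (Function.update w (Fin.last (p + 1))
        ((W (Fin.last (p + 1))).Y a N (w (Fin.last (p + 1))))) +
      ∑ k : Fin p, ∑ m ∈ Finset.range M, (((Ring.choose N m : ℤ) : ℂ) • zvar k ^ (N - (m : ℤ))) •
        c (Function.update w (midSlot k) ((W (midSlot k)).Y a m (w (midSlot k))))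

/-- A correlation function: a multilinear map with values in formal series that satisfies the
Ward identities and the `L(-1)`-derivative property. -/
structure IsCorrelator (A : VOA V) {p : ℕ} (W : Fin (p + 2) → ModData.{u, v} V)
    (Φ : MultilinearMap ℂ (fun i => (W i).carrier) (RSeries p)) : Prop where
  ward : WardIdentities A W Φ
  derivative : ∀ (w : ∀ i, (W i).carrier) (l : Fin p),
    Φ (Function.update w (midSlot l) ((W (midSlot l)).L A.ω (-1) (w (midSlot l)))) =
      partialD l (Φ w)

section pairing

variable {A : VOA V} {p : ℕ} {W : Fin (p + 2) → ModData.{u, v} V} (h₀ : IsVOAModule A (W 0))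
  (G : (W (Fin.last (p + 1))).carrier → (∀ i : Fin p, (W (midSlot i)).carrier) → (Fin p → ℝ) →
    (contragredient A (W 0) h₀).carrier)

/-- The coefficients of a product of intertwining operators, paired with a vector of `W₀`. -/
def pairedCoeff (w : ∀ i, (W i).carrier) (e : Fin p → ℝ) : ℂ :=
  (G (w (Fin.last (p + 1))) (fun i => w (midSlot i)) e).1 (w 0)

theorem pairedCoeff_update_zero (w : ∀ i, (W i).carrier) (e : Fin p → ℝ) (y : (W 0).carrier) :
    pairedCoeff h₀ G (Function.update w 0 y) e =
      (G (w (Fin.last (p + 1))) (fun i => w (midSlot i)) e).1 y := by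
  rw [pairedCoeff, update_zero_comp_midSlot, Function.update_self,
    Function.update_of_ne (Fin.last_pos).ne']

theorem pairedCoeff_update_last (w : ∀ i, (W i).carrier) (e : Fin p → ℝ)
    (y : (W (Fin.last (p + 1))).carrier) :
    pairedCoeff h₀ G (Function.update w (Fin.last (p + 1)) y) e =
      (G y (fun i => w (midSlot i)) e).1 (w 0) := by
  rw [pairedCoeff, update_last_comp_midSlot, Function.update_self,
    Function.update_of_ne (Fin.last_pos).ne]

theorem pairedCoeff_update_midSlot (w : ∀ i, (W i).carrier) (e : Fin p → ℝ) (l : Fin p)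
    (y : (W (midSlot l)).carrier) :
    pairedCoeff h₀ G (Function.update w (midSlot l) y) e =
      (G (w (Fin.last (p + 1))) (Function.update (fun i => w (midSlot i)) l y) e).1 (w 0) := by
  rw [pairedCoeff, update_midSlot_comp, Function.update_of_ne (midSlot_ne_last l).symm,
    Function.update_of_ne (midSlot_ne_zero l).symm]

/-- Evaluation of functionals at a vector of `W₀`. -/
noncomputable def evalDual (y : (W 0).carrier) : (contragredient A (W 0) h₀).carrier →ₗ[ℂ] ℂ :=
  LinearMap.applyₗ y ∘ₗ (gradedDual A (W 0)).subtype

variable (hG : ProductFamily A (W (Fin.last (p + 1))) p (contragredient A (W 0) h₀)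
  (fun i => W (midSlot i)) G)

include hG

theorem pairedCoeff_update_add (w : ∀ i, (W i).carrier) (e : Fin p → ℝ) (i : Fin (p + 2))
    (x y : (W i).carrier) : pairedCoeff h₀ G (Function.update w i (x + y)) e =
      pairedCoeff h₀ G (Function.update w i x) e + pairedCoeff h₀ G (Function.update w i y) e := by
  refine slot_cases (P := fun i => ∀ x y : (W i).carrier,
    pairedCoeff h₀ G (Function.update w i (x + y)) e = pairedCoeff h₀ G (Function.update w i x) e +
      pairedCoeff h₀ G (Function.update w i y) e) ?_ ?_ ?_ i x y
  · intro x y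
    simp only [pairedCoeff_update_zero, map_add]
  · intro x y
    simp only [pairedCoeff_update_last, hG.add_base]
    rfl
  · intro i x y
    simp only [pairedCoeff_update_midSlot, hG.add_slot]
    rfl

theorem pairedCoeff_update_smul (w : ∀ i, (W i).carrier) (e : Fin p → ℝ) (i : Fin (p + 2))
    (t : ℂ) (x : (W i).carrier) : pairedCoeff h₀ G (Function.update w i (t • x)) e =
      t * pairedCoeff h₀ G (Function.update w i x) e := by
  refine slot_cases (P := fun i => ∀ x : (W i).carrier,
    pairedCoeff h₀ G (Function.update w i (t • x)) e =
      t * pairedCoeff h₀ G (Function.update w i x) e) ?_ ?_ ?_ i x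
  · intro x
    simp only [pairedCoeff_update_zero, map_smul, smul_eq_mul]
  · intro x
    simp only [pairedCoeff_update_last, hG.smul_base]
    rfl
  · intro i x
    simp only [pairedCoeff_update_midSlot, hG.smul_slot]
    rfl

theorem pairedCoeff_update_zero_vector (w : ∀ i, (W i).carrier) (e : Fin p → ℝ)
    (i : Fin (p + 2)) : pairedCoeff h₀ G (Function.update w i 0) e = 0 := by
  have := pairedCoeff_update_smul h₀ G hG w e i 0 0
  rwa [zero_smul, zero_mul] at this

theorem isPWO_support_pairedCoeff_of_homogeneous (w : ∀ i, (W i).carrier) (r : Fin (p + 2) → ℝ)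
    (hw : ∀ i, w i ∈ (W i).wt A.ω (r i)) :
    {e : Expo p | pairedCoeff h₀ G w (Expo.at e) ≠ 0}.IsPWO := by
  obtain ⟨B, hB, hB'⟩ := hG.support (w (Fin.last (p + 1))) (fun i => w (midSlot i))
    (r (Fin.last (p + 1))) (fun i => r (midSlot i)) (hw _) fun i => hw _
  refine (isPWO_of_tail_sums (r (Fin.last (p + 1))) (fun i => r (midSlot i))
    (fun l => {r 0} ∪ B l) fun l => (Set.isPWO_singleton _).union (hB l)).mono fun e he l => ?_
  have hne : G (w (Fin.last (p + 1))) (fun i => w (midSlot i)) (Expo.at e) ≠ 0 := by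
    intro h
    apply he
    rw [pairedCoeff, h]
    rfl
  rcases Nat.eq_zero_or_pos l.val with h0 | h0
  · left
    -- Self-adjointness of L(0) forces a functional that is nonzero on `w 0` and homogeneous to have
    -- the weight `r 0`; this supplies the missing tail sum at index 0.
    have hwt := hG.weight (w (Fin.last (p + 1))) (fun i => w (midSlot i)) (Expo.at e)
      (r (Fin.last (p + 1))) (fun i => r (midSlot i)) (hw _) fun i => hw _
    rw [ModData.mem_wt_iff] at hwt
    have hwt' := LinearMap.congr_fun (congrArg Subtype.val hwt) (w 0)
    change (G _ _ _).1 (adjointMode A (W 0) A.ω 1 (w 0)) = _ * (G _ _ _).1 (w 0) at hwt'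
    rw [adjointMode_ω A h₀, ModData.mem_wt_iff.1 (hw 0), map_smul, smul_eq_mul] at hwt'
    have hr := mul_right_cancel₀ he hwt'
    have hle : ∀ k : Fin p, l ≤ k := fun k => by
      rw [Fin.le_def]
      omega
    simp only [hle, if_true, Set.mem_singleton_iff]
    exact_mod_cast hr.symm
  · exact Or.inr (hB' _ hne l h0)

theorem isPWO_support_pairedCoeff (hW : ∀ i, IsVOAModule A (W i)) (w : ∀ i, (W i).carrier) :
    {e : Expo p | pairedCoeff h₀ G w (Expo.at e) ≠ 0}.IsPWO := by
  refine multilinear_span_induction (M := fun i => (W i).carrier)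
    (fun i => {x | ∃ r, x ∈ (W i).wt A.ω r}) (Q := fun w =>
      {e : Expo p | pairedCoeff h₀ G w (Expo.at e) ≠ 0}.IsPWO) ?_ ?_ ?_ ?_ w
    fun i => (hW i).span_homogeneous (w i)
  · intro w i x y hx hy
    refine (hx.union hy).mono fun e he => ?_
    rw [Set.mem_ofPred_eq, pairedCoeff_update_add h₀ G hG] at he
    by_contra h
    simp only [Set.mem_union, Set.mem_ofPred_eq, not_or, not_not] at h
    exact he (by rw [h.1, h.2, add_zero])
  · intro w i t x hx
    refine hx.mono fun e he => ?_
    rw [Set.mem_ofPred_eq, pairedCoeff_update_smul h₀ G hG] at he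
    exact right_ne_zero_of_mul he
  · intro w i
    simp [pairedCoeff_update_zero_vector h₀ G hG]
  · intro w hw
    choose r hr using hw
    exact isPWO_support_pairedCoeff_of_homogeneous h₀ G hG w r hr

/-- The formal series `⟨w₀, Y₁(w₁, z₁) ⋯ Y_p(w_p, z_p) w_{p+1}⟩`, as a multilinear map. -/
noncomputable def correlator (hW : ∀ i, IsVOAModule A (W i)) :
    MultilinearMap ℂ (fun i => (W i).carrier) (RSeries p) :=
  MultilinearMap.mk' (fun w => { coeff := fun e => pairedCoeff h₀ G w (Expo.at e)
                                 isPWO_support' := isPWO_support_pairedCoeff h₀ G hG hW w })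
    (fun w i x y => by
      ext e
      exact pairedCoeff_update_add h₀ G hG w _ i x y)
    (fun w i t x => by
      ext e
      exact pairedCoeff_update_smul h₀ G hG w _ i t x)

theorem coeff_correlator (hW : ∀ i, IsVOAModule A (W i)) (w : ∀ i, (W i).carrier)
    (e : Fin p → ℝ) : (correlator h₀ G hG hW w).coeff (expo e) = pairedCoeff h₀ G w e := rfl

theorem correlator_ward_zero (hW : ∀ i, IsVOAModule A (W i)) (a : V) (w : ∀ i, (W i).carrier)
    (N : ℤ) (M : ℕ) (hM : ∀ i, i ≠ 0 → ∀ m : ℕ, M ≤ m → (W i).Y a m (w i) = 0) :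
    correlator h₀ G hG hW (Function.update w 0 (adjointMode A (W 0) a N (w 0))) =
      correlator h₀ G hG hW (Function.update w (Fin.last (p + 1))
        ((W (Fin.last (p + 1))).Y a N (w (Fin.last (p + 1))))) +
      ∑ k : Fin p, ∑ m ∈ Finset.range M, (((Ring.choose N m : ℤ) : ℂ) • zvar k ^ (N - (m : ℤ))) •
        correlator h₀ G hG hW
          (Function.update w (midSlot k) ((W (midSlot k)).Y a m (w (midSlot k)))) := by
  refine ext_expo fun e => ?_
  have key := congrArg (evalDual h₀ (w 0)) (hG.commutator a (w (Fin.last (p + 1)))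
    (fun i => w (midSlot i)) e N M fun i m hm => hM _ (midSlot_ne_zero i) m hm)
  simp only [map_add, map_sum, map_smul] at key
  simp only [HahnSeries.coeff_add, HahnSeries.coeff_sum, smul_assoc, HahnSeries.coeff_smul,
    coeff_zvar_zpow_smul, coeff_correlator, pairedCoeff_update_zero, pairedCoeff_update_last,
    pairedCoeff_update_midSlot]
  refine key.trans ?_
  congr 1
  refine Finset.sum_congr rfl fun k _ => Finset.sum_congr rfl fun m _ => ?_
  have hq : (m : ℝ) - N = -(((N - m : ℤ)) : ℝ) := by
    push_cast
    ring
  rw [hq]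
  rfl

theorem correlator_ward_mid (hW : ∀ i, IsVOAModule A (W i)) (a : V) (w : ∀ i, (W i).carrier)
    (l : Fin p) (M : ℕ) (hM : ∀ i, i ≠ 0 → ∀ m : ℕ, M ≤ m → (W i).Y a m (w i) = 0)
    (hM' : ∀ m : ℕ, M ≤ m → adjointMode A (W 0) a (-1 - m) (w 0) = 0) :
    correlator h₀ G hG hW
        (Function.update w (midSlot l) ((W (midSlot l)).Y a (-1) (w (midSlot l)))) =
      ∑ m ∈ Finset.range M, zvar l ^ (m : ℤ) • correlator h₀ G hG hW
        (Function.update w 0 (adjointMode A (W 0) a (-1 - m) (w 0))) +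
      ∑ m ∈ Finset.range M, zvar l ^ (-1 - (m : ℤ)) • correlator h₀ G hG hW
        (Function.update w (Fin.last (p + 1))
          ((W (Fin.last (p + 1))).Y a m (w (Fin.last (p + 1))))) -
      ∑ k : Fin p, ∑ m ∈ Finset.range M, ((-1) ^ m * (zvar k - zvar l)⁻¹ ^ (m + 1)) •
        correlator h₀ G hG hW
          (Function.update w (midSlot k) ((W (midSlot k)).Y a m (w (midSlot k)))) := by
  refine ext_expo fun e => ?_
  have hker : ∀ᶠ J : ℕ in atTop, ∀ k : Fin p, ∀ m : Fin M, _ := eventually_all.2 fun k =>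
    eventually_all.2 fun m : Fin M => coeff_kernel_smul k l m (correlator h₀ G hG hW
      (Function.update w (midSlot k) ((W (midSlot k)).Y a (m : ℕ) (w (midSlot k))))) e
  -- One cutoff `J` serves at once for the coefficient identity, for the truncated sums over `M`,
  -- and for all the kernel expansions at the exponent `e`.
  obtain ⟨J, hJ, hJM, hJk⟩ := ((hG.assoc a (w (Fin.last (p + 1))) (fun i => w (midSlot i)) e l M
    fun i m hm => hM _ (midSlot_ne_zero i) m hm).and
      ((eventually_ge_atTop M).and hker)).exists
  have hsub : Finset.range M ⊆ Finset.range J := Finset.range_subset_range.2 hJM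
  have key := congrArg (evalDual h₀ (w 0)) hJ
  simp only [map_add, map_sum, apply_ite (evalDual h₀ (w 0)), map_smul, map_zero] at key
  rw [HahnSeries.coeff_sub, HahnSeries.coeff_add, coeff_correlator, pairedCoeff_update_midSlot]
  refine key.trans ?_
  rw [sub_eq_add_neg]
  congr 1
  · congr 1
    · rw [HahnSeries.coeff_sum, Finset.sum_subset hsub]
      · refine Finset.sum_congr rfl fun j _ => ?_
        rw [coeff_zvar_zpow_smul, coeff_correlator, pairedCoeff_update_zero]
        simp only [Int.cast_natCast]
        rfl
      · intro j _ hj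
        rw [hM' j (by simpa using hj), coeff_zvar_zpow_smul, coeff_correlator,
          pairedCoeff_update_zero_vector h₀ G hG]
    · rw [HahnSeries.coeff_sum, Finset.sum_subset hsub]
      · refine Finset.sum_congr rfl fun j _ => ?_
        rw [coeff_zvar_zpow_smul, coeff_correlator, pairedCoeff_update_last]
        have hq : 1 + (j : ℝ) = -(((-1 - j : ℤ)) : ℝ) := by
          push_cast
          ring
        rw [hq]
        rfl
      · intro j _ hj
        rw [hM _ Fin.last_pos.ne' j (by simpa using hj), coeff_zvar_zpow_smul, coeff_correlator,
          pairedCoeff_update_zero_vector h₀ G hG]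
  · rw [HahnSeries.coeff_sum, ← Finset.sum_neg_distrib]
    refine Finset.sum_congr rfl fun k _ => ?_
    rw [HahnSeries.coeff_sum, ← Finset.sum_neg_distrib]
    refine Finset.sum_congr rfl fun m hm => ?_
    refine Eq.trans ?_ (hJk k ⟨m, Finset.mem_range.1 hm⟩).symm
    refine Finset.sum_congr rfl fun j _ => ?_
    simp only [coeff_correlator, pairedCoeff_update_midSlot]
    rfl

theorem correlator_derivative (hW : ∀ i, IsVOAModule A (W i)) (w : ∀ i, (W i).carrier)
    (l : Fin p) : correlator h₀ G hG hW
      (Function.update w (midSlot l) ((W (midSlot l)).L A.ω (-1) (w (midSlot l)))) =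
        partialD l (correlator h₀ G hG hW w) := by
  refine ext_expo fun e => ?_
  rw [coeff_partialD, coeff_correlator, coeff_correlator, pairedCoeff_update_midSlot,
    hG.derivative]
  rfl

theorem isCorrelator_correlator (hW : ∀ i, IsVOAModule A (W i)) :
    IsCorrelator A W (correlator h₀ G hG hW) where
  ward := ⟨correlator_ward_mid h₀ G hG hW, correlator_ward_zero h₀ G hG hW⟩
  derivative := correlator_derivative h₀ G hG hW

end pairing

/-- From here on the intermediate modules and operators are forgotten; only the correlator
properties are used. -/
theorem IsProduct.exists_correlator {A : VOA V} {p : ℕ} {W : Fin (p + 2) → ModData.{u, v} V}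
    (hW : ∀ i, IsVOAModule A (W i)) (w : ∀ i, (W i).carrier)
    {F : (Fin p → ℝ) → (contragredient A (W 0) (hW 0)).carrier}
    (hF : IsProduct A (W (Fin.last (p + 1))) (w (Fin.last (p + 1))) p
      (contragredient A (W 0) (hW 0)) (fun i => W (midSlot i)) (fun i => w (midSlot i)) F) :
    ∃ Φ : MultilinearMap ℂ (fun i => (W i).carrier) (RSeries p), IsCorrelator A W Φ ∧
      ∀ e : Fin p → ℝ, (Φ w).coeff (expo e) = (F e).1 (w 0) := by
  obtain ⟨G, hG, hGF⟩ := hF.exists_productFamily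
  exact ⟨_, isCorrelator_correlator (hW 0) G hG hW, fun e => by
    rw [coeff_correlator, pairedCoeff, hGF]⟩

end correlators

/-! ### Filtration by weight with controlled poles. -/

/-- Data that control the poles along a divisor with equation `t`: a subalgebra `S` of regular
coefficients, and exponents `c₀` (for `w₀`) and `c` (for the other vectors) by which the weights
are compared with the order of vanishing. -/
structure PoleControl (p : ℕ) where
  t : RatFun p
  S : Subalgebra ℂ (RatFun p)
  c : ℕ
  c₀ : ℕ
  t_ne_zero : t ≠ 0
  noetherian : IsNoetherianRing S
  c_le : c ≤ c₀
  t_mem : t ∈ S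
  inv_mem : ∀ l, t ^ c * (zvar l)⁻¹ ∈ S
  sub_inv_mem : ∀ k l, t ^ c * (zvar k - zvar l)⁻¹ ∈ S
  zvar_mul_mem : ∀ l, zvar l * t ^ c₀ ∈ S
  sq_mul_mem : ∀ l, zvar l ^ 2 * t ^ (c₀ - c) ∈ S

section bounds

variable {V : Type u} [AddCommGroup V] [Module ℂ V] {A : VOA V} {p : ℕ}
  {W : Fin (p + 2) → ModData.{u, v} V} (hW : ∀ i, IsVOAModule A (W i))

include hW

theorem exists_truncation_bound (a : V) (w : ∀ i, (W i).carrier) :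
    ∃ M : ℕ, ∀ i, ∀ m : ℕ, M ≤ m → (W i).Y a m (w i) = 0 := by
  choose N hN using fun i => (hW i).truncation a (w i)
  refine ⟨Finset.univ.sup fun i => (N i).toNat, fun i m hm => hN i m ?_⟩
  have : (N i).toNat ≤ m := (Finset.le_sup (f := fun i => (N i).toNat) (Finset.mem_univ i)).trans hm
  omega

theorem exists_adjoint_bound {h : ℤ} {a : V} (ha : a ∈ A.gr h) {w : (W 0).carrier} {r : ℝ}
    (hw : w ∈ (W 0).wt A.ω r) :
    ∃ M : ℕ, ∀ m : ℕ, M ≤ m → adjointMode A (W 0) a (-1 - m) w = 0 := by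
  obtain ⟨N, hN⟩ := (hW 0).bounded_below
  obtain ⟨M, hM⟩ := exists_nat_gt (r - h - N)
  refine ⟨M, fun m hm => ?_⟩
  have := adjointMode_mem_wt A (hW 0) ha hw (-1 - m)
  have hm' : (M : ℝ) ≤ m := by exact_mod_cast hm
  rw [hN _ (by push_cast; linarith)] at this
  exact (Submodule.mem_bot ℂ).1 this

end bounds

namespace PoleControl

variable {p : ℕ} (R : PoleControl p)

/-- The exponent attached to a slot. -/
def slotExp (i : Fin (p + 2)) : ℕ := if i = 0 then R.c₀ else R.c

theorem slotExp_zero : R.slotExp 0 = R.c₀ := if_pos rfl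

theorem slotExp_last : R.slotExp (Fin.last (p + 1)) = R.c := if_neg Fin.last_pos.ne'

theorem slotExp_midSlot (i : Fin p) : R.slotExp (midSlot i) = R.c := if_neg (midSlot_ne_zero i)

/-- The weighted sum of the weights of the vectors. -/
def order (r : Fin (p + 2) → ℝ) : ℝ := ∑ i, (R.slotExp i : ℝ) * r i

theorem _root_.sum_update {n : ℕ} (r : Fin n → ℝ) (k : Fin n) (s : ℝ) :
    ∑ i, Function.update r k s i = ∑ i, r i + (s - r k) := by
  rw [Finset.sum_update_of_mem (Finset.mem_univ k),
    ← Finset.sum_sdiff (Finset.subset_univ ({k} : Finset (Fin n))) (f := r)]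
  simp
  ring

theorem order_update (r : Fin (p + 2) → ℝ) (k : Fin (p + 2)) (s : ℝ) :
    R.order (Function.update r k s) = R.order r + R.slotExp k * (s - r k) := by
  have h : ∀ i, (R.slotExp i : ℝ) * Function.update r k s i =
      Function.update (fun i => (R.slotExp i : ℝ) * r i) k (R.slotExp k * s) i := by
    intro i
    by_cases hi : i = k
    · subst hi
      simp
    · simp [hi]
  rw [order, Finset.sum_congr rfl fun i _ => h i, sum_update, order]
  ring

theorem zpow_mem {q : ℤ} (hq : 0 ≤ q) : R.t ^ q ∈ R.S := by
  lift q to ℕ using hq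
  rw [zpow_natCast]
  exact pow_mem R.t_mem q

section filtration

variable {V : Type u} [AddCommGroup V] [Module ℂ V] {A : VOA V}
  {W : Fin (p + 2) → ModData.{u, v} V} {E : Type*} [AddCommGroup E] [Module ℂ E]
  [Module (RatFun p) E]

/-- Homogeneous vectors of given weights in all slots. -/
def _root_.IsHomogeneous (A : VOA V) (w : ∀ i, (W i).carrier) (r : Fin (p + 2) → ℝ) : Prop :=
  ∀ i, w i ∈ (W i).wt A.ω (r i)

theorem _root_.IsHomogeneous.update {w : ∀ i, (W i).carrier} {r : Fin (p + 2) → ℝ}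
    (h : IsHomogeneous A w r) {k : Fin (p + 2)} {y : (W k).carrier} {s : ℝ}
    (hy : y ∈ (W k).wt A.ω s) :
    IsHomogeneous A (Function.update w k y) (Function.update r k s) := by
  intro i
  by_cases hi : i = k
  · subst hi
    simpa using hy
  · rw [Function.update_of_ne hi, Function.update_of_ne hi]
    exact h i

variable (A) (c : MultilinearMap ℂ (fun i => (W i).carrier) E)

/-- The span of the normalized values on homogeneous vectors of total weight at most `D`. -/
noncomputable def filt (ρ D : ℝ) : Submodule R.S E :=
  Submodule.span R.S {x | ∃ (w : ∀ i, (W i).carrier) (r : Fin (p + 2) → ℝ) (q : ℤ),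
    IsHomogeneous A w r ∧ ∑ i, r i ≤ D ∧ R.order r ≤ q + ρ ∧ x = R.t ^ q • c w}

/-- Write κ = (κ t^{-d}) t^d: the first factor is a coefficient in S, and t^d accounts for the order
of `w`. -/
theorem smul_mem_filt {ρ D : ℝ} {w : ∀ i, (W i).carrier} {r : Fin (p + 2) → ℝ}
    (hw : IsHomogeneous A w r) (hD : ∑ i, r i ≤ D) {κ : RatFun p} (d : ℤ)
    (hκ : κ * R.t ^ (-d) ∈ R.S) (hd : R.order r ≤ d + ρ) : κ • c w ∈ R.filt A c ρ D := by
  have h : κ • c w = (⟨κ * R.t ^ (-d), hκ⟩ : R.S) • R.t ^ d • c w := by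
    change _ = (κ * R.t ^ (-d)) • R.t ^ d • c w
    rw [smul_smul, mul_assoc, ← zpow_add₀ R.t_ne_zero, neg_add_cancel, zpow_zero, mul_one]
  rw [h]
  exact Submodule.smul_mem _ _ (Submodule.subset_span ⟨w, r, d, hw, hD, hd, rfl⟩)

theorem smul_update_mem_filt {ρ D : ℝ} {w : ∀ i, (W i).carrier} {r : Fin (p + 2) → ℝ}
    (hw : IsHomogeneous A w r) (k : Fin (p + 2)) {y : (W k).carrier} {s : ℝ}
    (hy : y ∈ (W k).wt A.ω s) (hD : ∑ i, r i + (s - r k) ≤ D) {κ : RatFun p} (d : ℤ)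
    (hκ : κ * R.t ^ (-d) ∈ R.S) (hd : R.order r + R.slotExp k * (s - r k) ≤ d + ρ) :
    κ • c (Function.update w k y) ∈ R.filt A c ρ D :=
  R.smul_mem_filt A c (hw.update hy) (by rwa [sum_update]) d hκ (by rwa [order_update])

theorem filt_mono {ρ ρ' D D' : ℝ} (hρ : ρ ≤ ρ') (hD : D ≤ D') :
    R.filt A c ρ D ≤ R.filt A c ρ' D' := by
  refine Submodule.span_mono ?_
  rintro x ⟨w, r, q, hw, h₁, h₂, rfl⟩
  exact ⟨w, r, q, hw, h₁.trans hD, h₂.trans (by linarith), rfl⟩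

theorem zpow_smul_mem_filt {ρ D : ℝ} {x : E} (hx : x ∈ R.filt A c ρ D) (N : ℤ) :
    R.t ^ N • x ∈ R.filt A c (ρ - N) D := by
  induction hx using Submodule.span_induction with
  | mem x hx =>
    obtain ⟨w, r, q, hw, h₁, h₂, rfl⟩ := hx
    refine Submodule.subset_span ⟨w, r, N + q, hw, h₁, ?_, ?_⟩
    · push_cast
      linarith
    · rw [smul_smul, ← zpow_add₀ R.t_ne_zero]
  | zero => rw [smul_zero]; exact zero_mem _
  | add x y _ _ hx hy => rw [smul_add]; exact add_mem hx hy
  | smul a x _ hx =>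
    rw [smul_comm]
    exact Submodule.smul_mem _ a hx

theorem complex_smul_mem_filt [IsScalarTower ℂ (RatFun p) E] {ρ D : ℝ} {x : E} (t : ℂ) (hx : x ∈ R.filt A c ρ D) :
    t • x ∈ R.filt A c ρ D :=
  Submodule.smul_of_tower_mem _ t hx

end filtration

section relations

variable {V : Type u} [AddCommGroup V] [Module ℂ V] {A : VOA V}
  {W : Fin (p + 2) → ModData.{u, v} V} {E : Type*} [AddCommGroup E] [Module ℂ E]
  [Module (RatFun p) E]
  (c : MultilinearMap ℂ (fun i => (W i).carrier) E) (hW : ∀ i, IsVOAModule A (W i))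

variable (hc : WardIdentities A W c)

include hW hc

/-- Every term of the Ward identity has total weight at most Σ r + h - 1, one less than the left
side. The integer passed as `d` is the change of order minus c·h; it is never positive, and the
spare power of t that it leaves absorbs the pole or the growth of the coefficient. -/
theorem mode_mid_mem_filt {h : ℕ} {a : V} (ha : a ∈ A.gr h) (hh : 0 < h)
    {w : ∀ i, (W i).carrier} {r : Fin (p + 2) → ℝ} (hw : IsHomogeneous A w r) (l : Fin p) :
    c (Function.update w (midSlot l) ((W (midSlot l)).Y a (-1) (w (midSlot l)))) ∈
      R.filt A c (R.order r + R.c * h) (∑ i, r i + h - 1) := by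
  obtain ⟨M₁, hM₁⟩ := exists_truncation_bound hW a w
  obtain ⟨M₂, hM₂⟩ := exists_adjoint_bound hW ha (hw 0)
  have hh' : (1 : ℝ) ≤ h := by exact_mod_cast hh
  have hmode : ∀ i (n : ℤ), (W i).Y a n (w i) ∈ (W i).wt A.ω (r i + (h : ℤ) - n - 1) := fun i (n : ℤ) =>
    mode_mem_wt A (W i) (hW i).map_smul (hW i).jacobi (hW i).derivative ha (hw i) n
  rw [hc.mid a w l (max M₁ M₂) (fun i _ m hm => hM₁ i m ((le_max_left _ _).trans hm))
    fun m hm => hM₂ m ((le_max_right _ _).trans hm)]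
  refine sub_mem (add_mem ?_ ?_) ?_
  · refine sum_mem fun m _ => ?_
    refine R.smul_update_mem_filt A c hw 0 (adjointMode_mem_wt A (hW 0) ha (hw 0) (-1 - m)) ?_
      (-(R.c₀ * (h + m) + R.c * h : ℕ)) ?_ ?_
    · push_cast
      linarith
    · have : zvar l ^ (m : ℤ) * R.t ^ (-(-((R.c₀ * (h + m) + R.c * h : ℕ) : ℤ))) =
          (zvar l * R.t ^ R.c₀) ^ m * R.t ^ (R.c₀ * h + R.c * h) := by
        rw [neg_neg, zpow_natCast, zpow_natCast]
        ring
      rw [this]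
      exact mul_mem (pow_mem (R.zvar_mul_mem l) m) (pow_mem R.t_mem _)
    · rw [slotExp_zero]
      push_cast
      exact le_of_eq (by ring)
  · refine sum_mem fun m _ => ?_
    refine R.smul_update_mem_filt A c hw _ (hmode _ m) ?_ (-(R.c * (m + 1) : ℕ)) ?_ ?_
    · push_cast
      linarith
    · have : zvar l ^ (-1 - (m : ℤ)) * R.t ^ (-(-((R.c * (m + 1) : ℕ) : ℤ))) =
          (R.t ^ R.c * (zvar l)⁻¹) ^ (m + 1) := by
        have e : (-1 - (m : ℤ)) = -((m + 1 : ℕ) : ℤ) := by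
          push_cast
          ring
        rw [e, neg_neg, zpow_neg, zpow_natCast, zpow_natCast, mul_pow, inv_pow, ← pow_mul, mul_comm]
      rw [this]
      exact pow_mem (R.inv_mem l) _
    · rw [slotExp_last]
      push_cast
      exact le_of_eq (by ring)
  · refine sum_mem fun k _ => sum_mem fun m _ => ?_
    refine R.smul_update_mem_filt A c hw _ (hmode _ m) ?_ (-(R.c * (m + 1) : ℕ)) ?_ ?_
    · push_cast
      linarith
    · have : (-1) ^ m * (zvar k - zvar l)⁻¹ ^ (m + 1) * R.t ^ (-(-((R.c * (m + 1) : ℕ) : ℤ))) =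
          (-1) ^ m * (R.t ^ R.c * (zvar k - zvar l)⁻¹) ^ (m + 1) := by
        rw [neg_neg, zpow_natCast, mul_pow (R.t ^ R.c), ← pow_mul]
        ring
      rw [this]
      exact mul_mem (pow_mem (neg_mem (one_mem _)) m) (pow_mem (R.sub_inv_mem k l) _)
    · rw [slotExp_midSlot]
      push_cast
      exact le_of_eq (by ring)

/-- The Ward identity for w₀ with `N = -1` is solved for the term in the last slot. -/
theorem mode_last_mem_filt [IsScalarTower ℂ (RatFun p) E] {h : ℕ} {a : V} (ha : a ∈ A.gr h) (hh : 0 < h)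
    {w : ∀ i, (W i).carrier} {r : Fin (p + 2) → ℝ} (hw : IsHomogeneous A w r) :
    c (Function.update w (Fin.last (p + 1))
      ((W (Fin.last (p + 1))).Y a (-1) (w (Fin.last (p + 1))))) ∈
      R.filt A c (R.order r + R.c * h) (∑ i, r i + h - 1) := by
  obtain ⟨M, hM⟩ := exists_truncation_bound hW a w
  have hh' : (1 : ℝ) ≤ h := by exact_mod_cast hh
  have hmode : ∀ i (n : ℤ), (W i).Y a n (w i) ∈ (W i).wt A.ω (r i + (h : ℤ) - n - 1) := fun i (n : ℤ) =>
    mode_mem_wt A (W i) (hW i).map_smul (hW i).jacobi (hW i).derivative ha (hw i) n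
  rw [← sub_eq_of_eq_add (hc.zero a w (-1) M fun i _ => hM i)]
  refine sub_mem ?_ ?_
  · rw [← one_smul (RatFun p) (c _)]
    refine R.smul_update_mem_filt A c hw 0 (adjointMode_mem_wt A (hW 0) ha (hw 0) (-1)) ?_
      (-(R.c₀ * h + R.c * h : ℕ)) ?_ ?_
    · push_cast
      linarith
    · rw [one_mul, neg_neg, zpow_natCast]
      exact pow_mem R.t_mem _
    · rw [slotExp_zero]
      push_cast
      exact le_of_eq (by ring)
  · refine sum_mem fun k _ => sum_mem fun m _ => ?_
    rw [smul_assoc]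
    refine R.complex_smul_mem_filt A c _ ?_
    refine R.smul_update_mem_filt A c hw _ (hmode _ m) ?_ (-(R.c * (m + 1) : ℕ)) ?_ ?_
    · push_cast
      linarith
    · have : zvar k ^ (-1 - (m : ℤ)) * R.t ^ (-(-((R.c * (m + 1) : ℕ) : ℤ))) =
          (R.t ^ R.c * (zvar k)⁻¹) ^ (m + 1) := by
        have e : (-1 - (m : ℤ)) = -((m + 1 : ℕ) : ℤ) := by
          push_cast
          ring
        rw [e, neg_neg, zpow_neg, zpow_natCast, zpow_natCast, mul_pow, inv_pow, ← pow_mul, mul_comm]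
      rw [this]
      exact pow_mem (R.inv_mem k) _
    · rw [slotExp_midSlot]
      push_cast
      exact le_of_eq (by ring)

end relations

end PoleControl

/-! ### Moving modes out of the slot of w₀. -/

namespace PoleControl

variable {p : ℕ} (R : PoleControl p) {V : Type u} [AddCommGroup V] [Module ℂ V] {A : VOA V}
  {W : Fin (p + 2) → ModData.{u, v} V} {E : Type*} [AddCommGroup E] [Module ℂ E]
  [Module (RatFun p) E] [IsScalarTower ℂ (RatFun p) E]
  (c : MultilinearMap ℂ (fun i => (W i).carrier) E) (hW : ∀ i, IsVOAModule A (W i))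
  (hc : WardIdentities A W c)

include hW hc

/-- Here `d` is the amount by which b_n raises weights; b_{2h-n-2} lowers them by `d`, and its
adjoint is, up to sign, the leading term for b_n. Moving it to the slot k yields z_k^{2d-i} with i =
m - n ≥ 1, which is why squares of z_k enter `sq_mul_mem`. -/
theorem adjointMode_mem_filt {h : ℤ} {b : V} (hb : b ∈ A.gr h) {n : ℤ} (hn : n ≤ -1) {d : ℕ}
    (hd : 0 < d) (hdn : h - n - 1 = d) {w : ∀ i, (W i).carrier} {r : Fin (p + 2) → ℝ}
    (hw : IsHomogeneous A w r) :
    c (Function.update w 0 (adjointMode A (W 0) b (2 * h - n - 2) (w 0))) ∈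
      R.filt A c (R.order r + R.c₀ * d) (∑ i, r i + d - 1) := by
  obtain ⟨M, hM⟩ := exists_truncation_bound hW b w
  have hd' : (1 : ℝ) ≤ d := by exact_mod_cast hd
  have hn' : (n : ℝ) ≤ -1 := by exact_mod_cast hn
  have hdn' : (h : ℝ) = d + n + 1 := by
    have : h = d + n + 1 := by omega
    rw [this]
    push_cast
    ring
  have hmode : ∀ i (n : ℤ), (W i).Y b n (w i) ∈ (W i).wt A.ω (r i + h - n - 1) :=
    fun i (n : ℤ) =>
      mode_mem_wt A (W i) (hW i).map_smul (hW i).jacobi (hW i).derivative hb (hw i) n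
  rw [hc.zero b w _ M fun i _ => hM i]
  refine add_mem ?_ ?_
  · rw [← one_smul (RatFun p) (c _)]
    refine R.smul_update_mem_filt A c hw _ (hmode _ _) ?_ (-(R.c₀ * d + R.c * d : ℕ)) ?_ ?_
    · push_cast
      linarith
    · rw [one_mul, neg_neg, zpow_natCast]
      exact pow_mem R.t_mem _
    · rw [slotExp_last]
      push_cast
      rw [hdn']
      exact le_of_eq (by ring)
  · refine sum_mem fun k _ => sum_mem fun m _ => ?_
    rw [smul_assoc]
    refine R.complex_smul_mem_filt A c _ ?_
    obtain ⟨i, hi⟩ := Int.eq_ofNat_of_zero_le (show 0 ≤ (m : ℤ) - n by omega)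
    obtain ⟨e, he⟩ := Nat.exists_eq_add_of_le R.c_le
    refine R.smul_update_mem_filt A c hw _ (hmode _ m) ?_ (-(e * d + R.c * i : ℕ)) ?_ ?_
    · push_cast
      linarith [(Nat.cast_nonneg m : (0 : ℝ) ≤ m)]
    · have h1 : 2 * h - n - 2 - (m : ℤ) = ((2 * d : ℕ) : ℤ) - (i : ℤ) := by
        push_cast
        omega
      have hee : R.c₀ - R.c = e := by omega
      have : zvar k ^ (2 * h - n - 2 - (m : ℤ)) * R.t ^ (-(-((e * d + R.c * i : ℕ) : ℤ))) =
          (zvar k ^ 2 * R.t ^ (R.c₀ - R.c)) ^ d * (R.t ^ R.c * (zvar k)⁻¹) ^ i := by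
        have hz : zvar k ≠ (0 : RatFun p) := by
          rw [zvar, Ne, FaithfulSMul.algebraMap_eq_zero_iff]
          exact MvPolynomial.X_ne_zero k
        rw [h1, neg_neg, zpow_sub₀ hz, zpow_natCast, zpow_natCast, zpow_natCast, hee, mul_pow,
          mul_pow, inv_pow, ← pow_mul, ← pow_mul, ← pow_mul, pow_add, div_eq_mul_inv]
        ring
      rw [this]
      exact mul_mem (pow_mem (R.sq_mul_mem k) d) (pow_mem (R.inv_mem k) i)
    · rw [slotExp_midSlot, he]
      have hi' : (i : ℝ) = m - n := by
        have := congrArg (Int.cast (R := ℝ)) hi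
        push_cast at this
        exact this.symm
      push_cast
      rw [hdn', hi']
      exact le_of_eq (by ring)

/-- The formula for adjoint modes is inverted: b_n equals, up to sign, an adjoint mode minus modes
of L(1)^k b with k ≥ 1. These have smaller conformal weight, so the recursion stops because V is
bounded below. -/
theorem mode_zero_mem_filt_of_neg {n : ℤ} (hn : n ≤ -1) {d : ℕ} (hd : 0 < d) {h : ℤ}
    (hdn : h - n - 1 = d) {b : V} (hb : b ∈ A.gr h) {w : ∀ i, (W i).carrier}
    {r : Fin (p + 2) → ℝ} (hw : IsHomogeneous A w r) :
    c (Function.update w 0 ((W 0).Y b n (w 0))) ∈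
      R.filt A c (R.order r + R.c₀ * d) (∑ i, r i + d - 1) := by
  obtain ⟨N, hN⟩ := A.bounded_below
  -- `K` measures the height of `h` above the lowest weight. In the recursion `h` and `n` drop by
  -- the same amount, so `d` does not change.
  obtain ⟨K, hK⟩ : ∃ K : ℕ, h < N + K := ⟨(h - N + 1).toNat, by omega⟩
  induction K generalizing h n b with
  | zero =>
    have hb0 : b = 0 := by
      rw [VOA.gr, hN _ (by simpa using hK)] at hb
      exact (Submodule.mem_bot ℂ).1 hb
    have h0 : (W 0).Y b n = 0 := by
      rw [hb0]
      simpa using (hW 0).map_smul 0 0 n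
    rw [h0, LinearMap.zero_apply, MultilinearMap.map_update_zero]
    exact zero_mem _
  | succ K ih =>
    obtain ⟨B, hB⟩ := A.exists_L1_pow_eq_zero hb
    have hadj := R.adjointMode_mem_filt c hW hc hb hn hd hdn hw
    rw [adjointMode_of_mem A (hW 0) hb (K := B + 1) fun k hk => hB k (by omega),
      Finset.sum_range_succ', LinearMap.add_apply, LinearMap.sum_apply,
      MultilinearMap.map_update_add, MultilinearMap.map_update_sum] at hadj
    have hrest : ∑ k ∈ Finset.range B, c (Function.update w 0
        ((((-1 : ℂ) ^ h / ((k + 1).factorial : ℂ)) • (W 0).Y (((A.Y A.ω 2) ^ (k + 1)) b)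
          (2 * h - ((k + 1 : ℕ) : ℤ) - (2 * h - n - 2) - 2)) (w 0))) ∈
        R.filt A c (R.order r + R.c₀ * d) (∑ i, r i + d - 1) := by
      refine sum_mem fun k _ => ?_
      rw [LinearMap.smul_apply, MultilinearMap.map_update_smul]
      refine R.complex_smul_mem_filt A c _ ?_
      have e : 2 * h - ((k + 1 : ℕ) : ℤ) - (2 * h - n - 2) - 2 = n - (k + 1) := by
        push_cast
        ring
      rw [e]
      refine ih (by omega) ?_ (L1_pow_mem_gr A hb (k + 1)) ?_
      · push_cast
        omega
      · push_cast at hK ⊢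
        omega
    have hfirst := sub_mem hadj hrest
    rw [add_sub_cancel_left] at hfirst
    have e : 2 * h - ((0 : ℕ) : ℤ) - (2 * h - n - 2) - 2 = n := by
      push_cast
      ring
    rw [e, LinearMap.smul_apply, MultilinearMap.map_update_smul] at hfirst
    have := R.complex_smul_mem_filt A c ((-1 : ℂ) ^ h / ((Nat.factorial 0 : ℕ) : ℂ))⁻¹ hfirst
    rw [smul_smul, inv_mul_cancel₀ (div_ne_zero (zpow_ne_zero h (by norm_num)) (by simp)),
      one_smul] at this
    simpa using this

theorem mode_mem_filt {h : ℤ} {a : V} (ha : a ∈ A.gr h) (hh : 0 < h)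
    {w : ∀ i, (W i).carrier} {r : Fin (p + 2) → ℝ} (hw : IsHomogeneous A w r)
    (l : Fin (p + 2)) : c (Function.update w l ((W l).Y a (-1) (w l))) ∈
      R.filt A c (R.order r + R.slotExp l * h) (∑ i, r i + h - 1) := by
  lift h to ℕ using hh.le
  have hh' : 0 < h := by exact_mod_cast hh
  refine slot_cases (P := fun l => c (Function.update w l ((W l).Y a (-1) (w l))) ∈
      R.filt A c (R.order r + R.slotExp l * (h : ℤ)) (∑ i, r i + (h : ℤ) - 1)) ?_ ?_ ?_ l
  · rw [slotExp_zero, Int.cast_natCast]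
    exact R.mode_zero_mem_filt_of_neg c hW hc le_rfl hh' (by omega) ha hw
  · rw [slotExp_last, Int.cast_natCast]
    exact R.mode_last_mem_filt c hW hc ha hh' hw
  · intro l
    rw [slotExp_midSlot, Int.cast_natCast]
    exact R.mode_mid_mem_filt c hW hc ha hh' hw l

end PoleControl

/-! ### Weight projections and C₁-cofiniteness. -/

section weights

variable {V : Type u} [AddCommGroup V] [Module ℂ V] {A : VOA V} {W : ModData.{u, v} V}

/-- The projection onto the vectors of weight `r`. -/
noncomputable def IsVOAModule.proj (hW : IsVOAModule A W) (r : ℝ) :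
    W.carrier →ₗ[ℂ] W.carrier :=
  (W.wt A.ω r).subtype ∘ₗ DirectSum.component ℂ ℝ (fun r => W.wt A.ω r) r ∘ₗ
    (LinearEquiv.ofBijective (DirectSum.coeLinearMap (fun r : ℝ => W.wt A.ω r))
      hW.grading).symm.toLinearMap

theorem IsVOAModule.proj_of_mem (hW : IsVOAModule A W) {s : ℝ} {w : W.carrier}
    (hw : w ∈ W.wt A.ω s) (r : ℝ) : hW.proj r w = if s = r then w else 0 := by
  have : (LinearEquiv.ofBijective (DirectSum.coeLinearMap (fun r : ℝ => W.wt A.ω r))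
      hW.grading).symm w = DirectSum.lof ℂ ℝ (fun i => W.wt A.ω i) s ⟨w, hw⟩ := by
    rw [LinearEquiv.symm_apply_eq]
    exact (DirectSum.coeLinearMap_lof (A := fun r : ℝ => W.wt A.ω r) s ⟨w, hw⟩).symm
  simp only [IsVOAModule.proj, LinearMap.comp_apply, LinearEquiv.coe_coe, this]
  split_ifs with h
  · subst h
    rw [DirectSum.component.lof_self]
    rfl
  · rw [DirectSum.component.of, dif_neg h]
    rfl

theorem IsVOAModule.exists_proj_bound (hW : IsVOAModule A W) (w : W.carrier) :
    ∃ B : ℝ, ∀ r, B < r → hW.proj r w = 0 := by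
  have hw := hW.span_homogeneous w
  induction hw using Submodule.span_induction with
  | mem x hx =>
    obtain ⟨s, hs⟩ := hx
    refine ⟨s, fun r hr => ?_⟩
    rw [hW.proj_of_mem hs, if_neg hr.ne]
  | zero => exact ⟨0, fun r _ => map_zero _⟩
  | add x y _ _ hx hy =>
    obtain ⟨B₁, h₁⟩ := hx
    obtain ⟨B₂, h₂⟩ := hy
    refine ⟨max B₁ B₂, fun r hr => ?_⟩
    rw [_root_.map_add, h₁ r ((le_max_left _ _).trans_lt hr), h₂ r ((le_max_right _ _).trans_lt hr),
      add_zero]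
  | smul t x _ hx =>
    obtain ⟨B, h⟩ := hx
    exact ⟨B, fun r hr => by rw [_root_.map_smul, h r hr, smul_zero]⟩

/-- The homogeneous elements of weight `r` of the form `a₋₁ w` with homogeneous `a ∈ V₊` and
homogeneous `w`. -/
def homogeneousC1 (A : VOA V) (W : ModData.{u, v} V) (r : ℝ) : Set W.carrier :=
  {x | ∃ (h : ℤ) (a : V) (w : W.carrier), 0 < h ∧ a ∈ A.gr h ∧ w ∈ W.wt A.ω (r - h) ∧
    x = W.Y a (-1) w}

theorem IsVOAModule.homogeneousC1_subset_wt (hW : IsVOAModule A W) (r : ℝ) :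
    homogeneousC1 A W r ⊆ W.wt A.ω r := by
  rintro x ⟨h, a, w, -, ha, hw, rfl⟩
  have := mode_mem_wt A W hW.map_smul hW.jacobi hW.derivative ha hw (-1)
  have hr : r - (h : ℝ) + h - ((-1 : ℤ) : ℝ) - 1 = r := by
    push_cast
    ring
  rwa [hr] at this

/-- C₁ is a graded subspace: it is spanned by a₋₁w with both entries homogeneous, and these are
homogeneous. -/
theorem IsVOAModule.proj_mem_of_mem_C1 (hW : IsVOAModule A W) {x : W.carrier} (hx : x ∈ C1 A W)
    (r : ℝ) : hW.proj r x ∈ Submodule.span ℂ (homogeneousC1 A W r) := by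
  have hbase : ∀ a ∈ A.plus, ∀ w : W.carrier,
      hW.proj r (W.Y a (-1) w) ∈ Submodule.span ℂ (homogeneousC1 A W r) := by
    intro a ha w
    have hlin : ∀ w, hW.proj r (W.Y 0 (-1) w) ∈ Submodule.span ℂ (homogeneousC1 A W r) := by
      intro w
      have : W.Y 0 (-1) = 0 := by simpa using hW.map_smul 0 0 (-1)
      rw [this, LinearMap.zero_apply, map_zero]
      exact zero_mem _
    refine Submodule.iSup_induction _ (motive := fun a => hW.proj r (W.Y a (-1) w) ∈
      Submodule.span ℂ (homogeneousC1 A W r)) ha (fun h a ha => ?_) (hlin w) fun a b ha hb => ?_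
    · by_cases hh : 0 < h
      · rw [iSup_pos hh] at ha
        induction hW.span_homogeneous w using Submodule.span_induction with
        | mem w hw =>
          obtain ⟨s, hs⟩ := hw
          have hm : W.Y a (-1) w ∈ homogeneousC1 A W (s + h) :=
            ⟨h, a, w, hh, ha, by rwa [add_sub_cancel_right], rfl⟩
          rw [hW.proj_of_mem (hW.homogeneousC1_subset_wt _ hm)]
          split_ifs with hr
          · subst hr
            exact Submodule.subset_span hm
          · exact zero_mem _
        | zero => rw [map_zero, map_zero]; exact zero_mem _
        | add x y _ _ hx hy => rw [_root_.map_add, _root_.map_add]; exact add_mem hx hy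
        | smul t x _ hx => rw [_root_.map_smul, _root_.map_smul]; exact Submodule.smul_mem _ t hx
      · rw [iSup_neg hh, Submodule.mem_bot] at ha
        rw [ha]
        exact hlin w
    · rw [hW.map_add, LinearMap.add_apply, _root_.map_add]
      exact add_mem ha hb
  induction hx using Submodule.span_induction with
  | mem x hx =>
    obtain ⟨a, ha, w, rfl⟩ := hx
    exact hbase a ha w
  | zero => rw [map_zero]; exact zero_mem _
  | add x y _ _ hx hy => rw [_root_.map_add]; exact add_mem hx hy
  | smul t x _ hx => rw [_root_.map_smul]; exact Submodule.smul_mem _ t hx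

/-- In a `C₁`-cofinite module the homogeneous vectors of large weight lie in `C₁`. -/
theorem IsC1Cofinite.exists_weight_bound (hW : IsVOAModule A W) (hC : IsC1Cofinite A W) :
    ∃ B : ℝ, ∀ r, B < r → ∀ x ∈ W.wt A.ω r, x ∈ Submodule.span ℂ (homogeneousC1 A W r) := by
  obtain ⟨s, hs⟩ := (show Module.Finite ℂ (W.carrier ⧸ C1 A W) from hC).fg_top
  choose lift hlift using (C1 A W).mkQ_surjective
  choose B hB using fun w => hW.exists_proj_bound w
  -- Finitely many lifts span W modulo C₁; above `D` all their components vanish, so only C₁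
  -- contributes there.
  obtain ⟨D, hD⟩ := (s.image fun y => B (lift y)).bddAbove
  refine ⟨D, fun r hr x hx => ?_⟩
  have htop : C1 A W ⊔ Submodule.span ℂ (lift '' (s : Set (W.carrier ⧸ C1 A W))) = ⊤ := by
    rw [← Submodule.map_mkQ_eq_top, Submodule.map_span, ← hs]
    congr 1
    rw [Set.image_image]
    simp [hlift]
  have hle : C1 A W ⊔ Submodule.span ℂ (lift '' (s : Set (W.carrier ⧸ C1 A W))) ≤
      (Submodule.span ℂ (homogeneousC1 A W r)).comap (hW.proj r) := by
    refine sup_le (fun y hy => hW.proj_mem_of_mem_C1 hy r) (Submodule.span_le.2 ?_)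
    rintro _ ⟨y, hy, rfl⟩
    rw [SetLike.mem_coe, Submodule.mem_comap, hB _ _ ((hD (Finset.mem_coe.2
      (Finset.mem_image_of_mem _ hy))).trans_lt hr)]
    exact zero_mem _
  rw [htop] at hle
  have := hle (Submodule.mem_top (x := x))
  rwa [Submodule.mem_comap, hW.proj_of_mem hx, if_pos rfl] at this

end weights

/-! ### Reduction to bounded total weight and finite generation. -/

namespace PoleControl

variable {p : ℕ} (R : PoleControl p) {V : Type u} [AddCommGroup V] [Module ℂ V] {A : VOA V}
  {W : Fin (p + 2) → ModData.{u, v} V} {E : Type*} [AddCommGroup E] [Module ℂ E]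
  [Module (RatFun p) E] [IsScalarTower ℂ (RatFun p) E]
  (c : MultilinearMap ℂ (fun i => (W i).carrier) E)

/-- If the total weight exceeds Σ B, some slot exceeds its bound, and its vector is a combination of
a₋₁y. Moving a₋₁ away lowers the total weight by one without increasing ρ, since the order gained by
a₋₁ is exactly what `mode_mem_filt` allows. -/
theorem filt_le_of_bounds (hW : ∀ i, IsVOAModule A (W i)) (hc : WardIdentities A W c)
    {B : Fin (p + 2) → ℝ} (hB : ∀ i r, B i < r → ∀ x ∈ (W i).wt A.ω r,
      x ∈ Submodule.span ℂ (homogeneousC1 A (W i) r)) (ρ D : ℝ) :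
    R.filt A c ρ D ≤ R.filt A c ρ (∑ i, B i) := by
  have key : ∀ n : ℕ, ∀ ρ : ℝ, R.filt A c ρ (∑ i, B i + n) ≤ R.filt A c ρ (∑ i, B i) := by
    intro n
    induction n with
    | zero => intro ρ; simp
    | succ n ih =>
      intro ρ
      refine le_trans ?_ (ih ρ)
      refine Submodule.span_le.2 ?_
      rintro _ ⟨w, r, q, hw, h₁, h₂, rfl⟩
      by_cases hr : ∑ i, r i ≤ ∑ i, B i
      · refine Submodule.subset_span ⟨w, r, q, hw, hr.trans ?_, h₂, rfl⟩
        linarith [(Nat.cast_nonneg n : (0 : ℝ) ≤ n)]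
      obtain ⟨l, -, hl⟩ := Finset.exists_lt_of_sum_lt (not_le.1 hr)
      rw [← Function.update_eq_self l w]
      suffices H : ∀ x ∈ Submodule.span ℂ (homogeneousC1 A (W l) (r l)),
          R.t ^ q • c (Function.update w l x) ∈ R.filt A c ρ (∑ i, B i + n) from
        H _ (hB l _ hl _ (hw l))
      intro x hx
      induction hx using Submodule.span_induction with
      | mem x hx =>
        obtain ⟨h, a, y, hh, ha, hy, rfl⟩ := hx
        have := R.zpow_smul_mem_filt A c
          (R.mode_mem_filt c hW hc ha hh (hw.update hy) l) q
        rw [Function.update_self, Function.update_idem, order_update, sum_update] at this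
        refine R.filt_mono A c ?_ ?_ this
        · linarith
        · push_cast at h₁
          linarith
      | zero => rw [MultilinearMap.map_update_zero, smul_zero]; exact zero_mem _
      | add x y _ _ hx hy => rw [MultilinearMap.map_update_add, smul_add]; exact add_mem hx hy
      | smul t x _ hx =>
        rw [MultilinearMap.map_update_smul, smul_comm]
        exact R.complex_smul_mem_filt A c t hx
  obtain ⟨n, hn⟩ := exists_nat_ge (D - ∑ i, B i)
  exact (R.filt_mono A c le_rfl (by linarith)).trans (key n ρ)

/-- Weights are bounded below in each slot, so only finitely many weight tuples have total at most
`D`, each with finite-dimensional weight spaces. For each tuple the least admissible power of t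
suffices, as t ∈ S. -/
theorem fg_filt (hW : ∀ i, IsDiscreteModule A (W i)) (ρ D : ℝ) : (R.filt A c ρ D).FG := by
  choose N hN using fun i => (hW i).isModule.bounded_below
  set T : Fin (p + 2) → Set ℝ := fun i =>
    {s : ℝ | s ≤ D - ∑ j, N j + N i ∧ (W i).wt A.ω s ≠ ⊥}
  have hT : ∀ i, (T i).Finite := fun i => (hW i).finite_wt _
  have hfd : ∀ i s, ∃ g : Finset (W i).carrier,
      Submodule.span ℂ (g : Set (W i).carrier) = (W i).wt A.ω s := fun i s =>
    (Submodule.fg_iff_finiteDimensional _).2 ((hW i).isModule.finiteDimensional s)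
  choose g hg using hfd
  have hfin : (⋃ r ∈ Set.univ.pi T, (fun w => R.t ^ ⌈R.order r - ρ⌉ • c w) ''
      (if ∑ i, r i ≤ D then Set.univ.pi fun i => (g i (r i) : Set (W i).carrier) else ∅)).Finite := by
    refine (Set.Finite.pi hT).biUnion fun r _ => Set.Finite.image _ ?_
    split_ifs
    · exact Set.Finite.pi fun i => (g i (r i)).finite_toSet
    · exact Set.finite_empty
  refine ⟨hfin.toFinset, le_antisymm (Submodule.span_le.2 ?_) (Submodule.span_le.2 ?_)⟩
  · intro x hx
    rw [Set.Finite.coe_toFinset, Set.mem_iUnion₂] at hx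
    obtain ⟨r, -, w, hw, rfl⟩ := hx
    split_ifs at hw with hr
    · refine Submodule.subset_span ⟨w, r, _, fun i => ?_, hr, ?_, rfl⟩
      · rw [← hg]
        exact Submodule.subset_span (hw i trivial)
      · linarith [Int.le_ceil (R.order r - ρ)]
    · exact hw.elim
  · rintro _ ⟨w, r, q, hw, h₁, h₂, rfl⟩
    by_cases hw0 : ∃ i, w i = 0
    · obtain ⟨i, hi⟩ := hw0
      rw [c.map_coord_zero i hi, smul_zero]
      exact zero_mem _
    push Not at hw0
    have hne : ∀ i, (W i).wt A.ω (r i) ≠ ⊥ := fun i =>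
      (Submodule.ne_bot_iff _).2 ⟨_, hw i, hw0 i⟩
    have hNr : ∀ i, N i ≤ r i := fun i => not_lt.1 fun h => hne i (hN i _ h)
    have hrT : r ∈ Set.univ.pi T := by
      refine fun i _ => ⟨?_, hne i⟩
      have : r i - N i ≤ ∑ j, (r j - N j) :=
        Finset.single_le_sum (f := fun j => r j - N j) (fun j _ => sub_nonneg.2 (hNr j))
          (Finset.mem_univ i)
      rw [Finset.sum_sub_distrib] at this
      linarith
    have hq : 0 ≤ q - ⌈R.order r - ρ⌉ := sub_nonneg.2 (Int.ceil_le.2 (by linarith))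
    have hsplit : R.t ^ q • c w = (⟨_, R.zpow_mem hq⟩ : R.S) • R.t ^ ⌈R.order r - ρ⌉ • c w := by
      change _ = R.t ^ (q - ⌈R.order r - ρ⌉) • R.t ^ ⌈R.order r - ρ⌉ • c w
      rw [smul_smul, ← zpow_add₀ R.t_ne_zero, sub_add_cancel]
    rw [hsplit]
    refine Submodule.smul_mem _ _ ?_
    refine multilinear_span_induction (M := fun i => (W i).carrier)
      (fun i => (g i (r i) : Set (W i).carrier)) (Q := fun w => R.t ^ ⌈R.order r - ρ⌉ • c w ∈
        Submodule.span R.S (hfin.toFinset : Set E)) ?_ ?_ ?_ ?_ w fun i => by rw [hg]; exact hw i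
    · intro w i x y hx hy
      rw [MultilinearMap.map_update_add, smul_add]
      exact add_mem hx hy
    · intro w i t x hx
      rw [MultilinearMap.map_update_smul, smul_comm]
      exact Submodule.smul_of_tower_mem _ t hx
    · intro w i
      rw [MultilinearMap.map_update_zero, smul_zero]
      exact zero_mem _
    · intro w hw
      refine Submodule.subset_span ?_
      rw [Set.Finite.coe_toFinset, Set.mem_iUnion₂]
      refine ⟨r, hrT, w, ?_, rfl⟩
      rw [if_pos h₁]
      exact fun i _ => hw i

end PoleControl

/-- A sequence in a finitely generated module over a Noetherian ring satisfies a monic linear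
relation. -/
theorem exists_monic_relation {S E : Type*} [CommRing S] [IsNoetherianRing S] [AddCommGroup E]
    [Module S E] {N : Submodule S E} (hN : N.FG) (y : ℕ → E) (hy : ∀ k, y k ∈ N) :
    ∃ n : ℕ, 0 < n ∧ ∃ b : ℕ → S, y n = ∑ i ∈ Finset.range n, b i • y i := by
  have hNN : IsNoetherian S N := isNoetherian_of_fg_of_noetherian N hN
  let f : ℕ →o Submodule S N :=
    { toFun := fun n => Submodule.span S (Set.range fun i : Fin n => (⟨y i, hy i⟩ : N))
      monotone' := by
        intro m n hmn
        refine Submodule.span_mono ?_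
        rintro _ ⟨i, rfl⟩
        exact ⟨Fin.castLE hmn i, rfl⟩ }
  obtain ⟨n, hn⟩ := monotone_stabilizes_iff_noetherian.2 hNN f
  -- The chain is stationary from `n`; taking `n + 1` makes the order of the relation positive.
  refine ⟨n + 1, Nat.succ_pos n, ?_⟩
  have hmem : (⟨y (n + 1), hy (n + 1)⟩ : N) ∈ f (n + 1) := by
    rw [← hn (n + 1) (by omega), hn (n + 2) (by omega)]
    exact Submodule.subset_span ⟨Fin.last (n + 1), rfl⟩
  obtain ⟨b, hb⟩ := (Submodule.mem_span_range_iff_exists_fun S).1 hmem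
  refine ⟨fun i => if h : i < n + 1 then b ⟨i, h⟩ else 0, ?_⟩
  have := congrArg N.subtype hb
  rw [map_sum] at this
  rw [Finset.sum_range]
  refine this.symm.trans (Finset.sum_congr rfl fun i _ => ?_)
  simp only [dif_pos i.2]
  rfl

/-! ### Derivatives of correlators and Euler homogeneity. -/

section derivatives

variable {V : Type u} [AddCommGroup V] [Module ℂ V] {A : VOA V}

theorem IsVOAModule.L_neg_one_pow_mem_wt {W : ModData.{u, v} V} (hW : IsVOAModule A W) {r : ℝ}
    {w : W.carrier} (hw : w ∈ W.wt A.ω r) (k : ℕ) :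
    ((W.L A.ω (-1)) ^ k) w ∈ W.wt A.ω (r + k) := by
  induction k with
  | zero => simpa using hw
  | succ k ih =>
    have := mode_mem_wt A W hW.map_smul hW.jacobi hW.derivative A.ω_mem_gr ih 0
    have hr : r + (k : ℝ) + ((2 : ℤ) : ℝ) - ((0 : ℤ) : ℝ) - 1 = r + (k + 1 : ℕ) := by
      push_cast
      ring
    rw [hr] at this
    rw [pow_succ', Module.End.mul_apply]
    simpa [ModData.L] using this

/-- Replacing the vector in the slot `l` by its image under `L(-1)^k`. -/
def applyDerivative (A : VOA V) {p : ℕ} {W : Fin (p + 2) → ModData.{u, v} V}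
    (w : ∀ i, (W i).carrier) (l : Fin (p + 2)) (k : ℕ) : ∀ i, (W i).carrier :=
  Function.update w l (((W l).L A.ω (-1) ^ k) (w l))

variable {p : ℕ} {W : Fin (p + 2) → ModData.{u, v} V}

theorem applyDerivative_zero (w : ∀ i, (W i).carrier) (l : Fin (p + 2)) :
    applyDerivative A w l 0 = w := by
  rw [applyDerivative, pow_zero, Module.End.one_apply, Function.update_eq_self]

theorem applyDerivative_succ (w : ∀ i, (W i).carrier) (l : Fin (p + 2)) (k : ℕ) :
    applyDerivative A w l (k + 1) = Function.update (applyDerivative A w l k) l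
      ((W l).L A.ω (-1) (applyDerivative A w l k l)) := by
  rw [applyDerivative, applyDerivative, Function.update_self, Function.update_idem, pow_succ',
    Module.End.mul_apply]

theorem IsHomogeneous.applyDerivative (hW : ∀ i, IsVOAModule A (W i)) {w : ∀ i, (W i).carrier}
    {r : Fin (p + 2) → ℝ} (hw : IsHomogeneous A w r) (l : Fin (p + 2)) (k : ℕ) :
    IsHomogeneous A (applyDerivative A w l k) (Function.update r l (r l + k)) :=
  hw.update ((hW l).L_neg_one_pow_mem_wt (hw l) k)

theorem exists_multilinear_applyDerivative {E : Type*} [AddCommGroup E] [Module ℂ E]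
    (c : MultilinearMap ℂ (fun i => (W i).carrier) E) (l : Fin (p + 2)) (k : ℕ) :
    ∃ c' : MultilinearMap ℂ (fun i => (W i).carrier) E, ∀ w, c' w = c (applyDerivative A w l k) := by
  refine ⟨c.compLinearMap (Function.update (fun _ => LinearMap.id) l ((W l).L A.ω (-1) ^ k)),
    fun w => ?_⟩
  rw [MultilinearMap.compLinearMap_apply]
  congr 1
  funext i
  by_cases hi : i = l
  · subst hi
    simp [applyDerivative]
  · simp [applyDerivative, hi]

theorem IsCorrelator.iterate_partialD {Φ : MultilinearMap ℂ (fun i => (W i).carrier) (RSeries p)}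
    (hΦ : IsCorrelator A W Φ) (w : ∀ i, (W i).carrier) (l : Fin p) (k : ℕ) :
    Φ (applyDerivative A w (midSlot l) k) = (partialD l)^[k] (Φ w) := by
  induction k with
  | zero => rw [applyDerivative_zero, Function.iterate_zero_apply]
  | succ k ih => rw [applyDerivative_succ, hΦ.derivative, ih, Function.iterate_succ_apply']

/-- Homogeneity of correlation functions, from the action of `L(0)`. -/
theorem WardIdentities.sum_zvar_smul_derivative {E : Type*} [AddCommGroup E] [Module ℂ E]
    [Module (RatFun p) E] [IsScalarTower ℂ (RatFun p) E]
    {c : MultilinearMap ℂ (fun i => (W i).carrier) E} (hc : WardIdentities A W c)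
    (hW : ∀ i, IsVOAModule A (W i)) {w : ∀ i, (W i).carrier} {r : Fin (p + 2) → ℝ}
    (hw : IsHomogeneous A w r) : ∃ κ : ℂ, ∑ k : Fin p,
      (zvar k : RatFun p) • c (applyDerivative A w (midSlot k) 1) = κ • c w := by
  obtain ⟨M, hM⟩ := exists_truncation_bound hW A.ω w
  -- Only C(1, 0) and C(1, 1) are nonzero; adding 2 to `M` ensures that both terms, L(-1) and L(0),
  -- are in the range.
  have key := hc.zero A.ω w 1 (M + 2) fun i _ m hm => hM i m (by omega)
  have hL : ∀ i, c (Function.update w i ((W i).Y A.ω 1 (w i))) = (r i : ℂ) • c w := fun i => by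
    rw [ModData.mem_wt_iff.1 (hw i), MultilinearMap.map_update_smul, Function.update_eq_self]
  have hsum : ∀ k : Fin p, ∑ m ∈ Finset.range (M + 2),
      (((Ring.choose (1 : ℤ) m : ℤ) : ℂ) • (zvar k : RatFun p) ^ (1 - (m : ℤ))) •
        c (Function.update w (midSlot k) ((W (midSlot k)).Y A.ω m (w (midSlot k)))) =
      (zvar k : RatFun p) • c (applyDerivative A w (midSlot k) 1) +
        (r (midSlot k) : ℂ) • c w := by
    intro k
    rw [add_comm M 2, Finset.sum_range_add]
    rw [Finset.sum_eq_zero (s := Finset.range M), add_zero]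
    · rw [Finset.sum_range_succ, Finset.sum_range_one, ← hL]
      simp [applyDerivative, ModData.L]
    · intro m _
      rw [choose_one_of_two_le (by omega), Int.cast_zero, zero_smul]
      exact zero_smul (RatFun p) _
  rw [adjointMode_ω A (hW 0), hL, hL] at key
  simp only [hsum, Finset.sum_add_distrib, ← Finset.sum_smul] at key
  refine ⟨r 0 - r (Fin.last (p + 1)) - ∑ k : Fin p, (r (midSlot k) : ℂ), ?_⟩
  rw [sub_smul, sub_smul, key]
  abel

end derivatives

/-! ### Algebras of rational functions without pole along a divisor. -/

section nopole

variable {p : ℕ}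

theorem algebraMap_ratFun_ne_zero {Q : MvPolynomial (Fin p) ℂ} (hQ : Q ≠ 0) :
    algebraMap (MvPolynomial (Fin p) ℂ) (RatFun p) Q ≠ 0 := by
  rwa [Ne, FaithfulSMul.algebraMap_eq_zero_iff]

theorem zvar_ne_zero (i : Fin p) : (zvar i : RatFun p) ≠ 0 :=
  algebraMap_ratFun_ne_zero (MvPolynomial.X_ne_zero i)

theorem zvar_sub_zvar (k l : Fin p) : (zvar k - zvar l : RatFun p) =
    algebraMap (MvPolynomial (Fin p) ℂ) (RatFun p) (MvPolynomial.X k - MvPolynomial.X l) := by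
  rw [map_sub]
  rfl

theorem zvar_sub_zvar_ne_zero {k l : Fin p} (h : k ≠ l) : (zvar k - zvar l : RatFun p) ≠ 0 := by
  rw [zvar_sub_zvar]
  refine algebraMap_ratFun_ne_zero (sub_ne_zero.2 fun h' => h ?_)
  exact MvPolynomial.X_injective h'

/-- The substitution `z_i ↦ z_j`. -/
noncomputable def restrictDiag (i j : Fin p) : MvPolynomial (Fin p) ℂ →ₐ[ℂ] MvPolynomial (Fin p) ℂ :=
  MvPolynomial.aeval fun k => if k = i then MvPolynomial.X j else MvPolynomial.X k

/-- A polynomial is congruent to its restriction to the diagonal modulo X_i - X_j. Divisibility thus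
becomes vanishing under a ring homomorphism to a domain, which gives primality of X_i - X_j. -/
theorem X_sub_X_dvd_iff (i j : Fin p) (P : MvPolynomial (Fin p) ℂ) :
    (MvPolynomial.X i - MvPolynomial.X j) ∣ P ↔ restrictDiag i j P = 0 := by
  have h : (MvPolynomial.X i - MvPolynomial.X j) ∣ P - restrictDiag i j P := by
    induction P using MvPolynomial.induction_on with
    | C t => simp [restrictDiag]
    | add P Q hP hQ =>
      rw [map_add, add_sub_add_comm]
      exact dvd_add hP hQ
    | mul_X P k hP =>
      rw [map_mul]
      have : P * MvPolynomial.X k - restrictDiag i j P * restrictDiag i j (MvPolynomial.X k) =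
          (P - restrictDiag i j P) * MvPolynomial.X k +
            restrictDiag i j P * (MvPolynomial.X k - restrictDiag i j (MvPolynomial.X k)) := by ring
      rw [this]
      refine dvd_add (Dvd.dvd.mul_right hP _) (Dvd.dvd.mul_left ?_ _)
      by_cases hk : k = i
      · subst hk
        simp [restrictDiag]
      · simp [restrictDiag, hk]
  constructor
  · rintro ⟨Q, rfl⟩
    by_cases hij : j = i
    · simp [hij]
    · simp [restrictDiag, hij]
  · intro h0
    rwa [h0, sub_zero] at h

/-- The polynomials that may occur as denominators of functions regular along `z_i = 0` or along
`z_i = z_j`. -/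
def regularDenominators (q : MvPolynomial (Fin p) ℂ) (h1 : ¬ q ∣ 1)
    (hq : ∀ a b, q ∣ a * b → q ∣ a ∨ q ∣ b) : Submonoid (MvPolynomial (Fin p) ℂ) where
  carrier := {Q | ¬ q ∣ Q}
  one_mem' := h1
  mul_mem' := fun ha hb h => (hq _ _ h).elim ha hb

/-- The algebra of fractions with denominators in `D`. -/
def fractionAlgebra (D : Submonoid (MvPolynomial (Fin p) ℂ)) (h0 : (0 : MvPolynomial (Fin p) ℂ) ∉ D) :
    Subalgebra ℂ (RatFun p) where
  carrier := {f | ∃ P Q, Q ∈ D ∧ f = algebraMap (MvPolynomial (Fin p) ℂ) (RatFun p) P / algebraMap (MvPolynomial (Fin p) ℂ) (RatFun p) Q}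
  mul_mem' := by
    rintro _ _ ⟨P, Q, hQ, rfl⟩ ⟨P', Q', hQ', rfl⟩
    exact ⟨P * P', Q * Q', D.mul_mem hQ hQ', by rw [map_mul, map_mul, div_mul_div_comm]⟩
  add_mem' := by
    rintro _ _ ⟨P, Q, hQ, rfl⟩ ⟨P', Q', hQ', rfl⟩
    refine ⟨P * Q' + Q * P', Q * Q', D.mul_mem hQ hQ', ?_⟩
    rw [div_add_div _ _ (algebraMap_ratFun_ne_zero fun h => h0 (h ▸ hQ))
      (algebraMap_ratFun_ne_zero fun h => h0 (h ▸ hQ'))]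
    simp only [map_add, map_mul]
  algebraMap_mem' := fun t => ⟨MvPolynomial.C t, 1, D.one_mem, by
    rw [map_one, div_one, IsScalarTower.algebraMap_apply ℂ (MvPolynomial (Fin p) ℂ) (RatFun p)]
    rfl⟩

/-- The algebra of rational functions without pole along `z_i = ∞`. -/
def regularAtInfinity (i : Fin p) : Subalgebra ℂ (RatFun p) where
  carrier := {f | NoPole (.infinity i) f}
  mul_mem' := by
    rintro _ _ ⟨P, Q, hQ, hd, rfl⟩ ⟨P', Q', hQ', hd', rfl⟩
    refine ⟨P * P', Q * Q', mul_ne_zero hQ hQ', ?_, by rw [map_mul, map_mul, div_mul_div_comm]⟩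
    rw [MvPolynomial.degreeOf_mul_eq hQ hQ']
    exact (MvPolynomial.degreeOf_mul_le _ _ _).trans (add_le_add hd hd')
  add_mem' := by
    rintro _ _ ⟨P, Q, hQ, hd, rfl⟩ ⟨P', Q', hQ', hd', rfl⟩
    refine ⟨P * Q' + Q * P', Q * Q', mul_ne_zero hQ hQ', ?_, ?_⟩
    · rw [MvPolynomial.degreeOf_mul_eq hQ hQ']
      refine (MvPolynomial.degreeOf_add_le _ _ _).trans (max_le ?_ ?_)
      · exact (MvPolynomial.degreeOf_mul_le _ _ _).trans (add_le_add_left hd _)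
      · exact (MvPolynomial.degreeOf_mul_le _ _ _).trans (add_le_add_right hd' _)
    · rw [div_add_div _ _ (algebraMap_ratFun_ne_zero hQ) (algebraMap_ratFun_ne_zero hQ')]
      simp only [map_add, map_mul]
  algebraMap_mem' := fun t => ⟨MvPolynomial.C t, 1, one_ne_zero, by
    rw [MvPolynomial.degreeOf_C]; exact Nat.zero_le _, by
    rw [map_one, div_one, IsScalarTower.algebraMap_apply ℂ (MvPolynomial (Fin p) ℂ) (RatFun p)]
    rfl⟩

/-- The algebra of rational functions without pole along the divisor of a singular point. -/
theorem exists_subalgebra_noPole (s : SingularPoint p) :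
    ∃ S : Subalgebra ℂ (RatFun p), ∀ f, f ∈ S ↔ NoPole s f := by
  cases s with
  | zero i =>
    have hX := MvPolynomial.X_prime (R := ℂ) (i := i)
    exact ⟨fractionAlgebra (regularDenominators (MvPolynomial.X i)
      (fun h => hX.not_isUnit (isUnit_of_dvd_one h)) fun a b h => hX.dvd_or_dvd h)
      fun h => h (dvd_zero _), fun f => Iff.rfl⟩
  | infinity i => exact ⟨regularAtInfinity i, fun f => Iff.rfl⟩
  | diag i j hij =>
    refine ⟨fractionAlgebra (regularDenominators (MvPolynomial.X i - MvPolynomial.X j) ?_ ?_)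
      fun h => h (dvd_zero _), fun f => Iff.rfl⟩
    · rw [X_sub_X_dvd_iff, map_one]
      exact one_ne_zero
    · intro a b
      simp only [X_sub_X_dvd_iff, map_mul]
      exact mul_eq_zero.1

/-- A polynomial that does not vanish at some point of the divisor `q = 0` is not divisible
by `q`. -/
theorem not_dvd_of_eval {q Q : MvPolynomial (Fin p) ℂ} (x : Fin p → ℂ)
    (hq : MvPolynomial.eval x q = 0) (hQ : MvPolynomial.eval x Q ≠ 0) : ¬ q ∣ Q := by
  rintro ⟨P, rfl⟩
  exact hQ (by rw [map_mul, hq, zero_mul])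

theorem exists_point_zero (i : Fin p) : ∃ x : Fin p → ℂ, Function.Injective x ∧ x i = 0 := by
  refine ⟨fun k => (k.val : ℂ) - i.val, fun k l h => ?_, sub_self _⟩
  simpa [Fin.ext_iff] using h

/-- A point of the divisor lying on none of the other singular divisors; evaluation there shows that
the other denominators are admissible. -/
theorem exists_point_diag {i j : Fin p} (hij : i ≠ j) : ∃ x : Fin p → ℂ, (∀ k, x k ≠ 0) ∧
    x i = x j ∧ ∀ k l, x k = x l → k = l ∨ (k = i ∧ l = j) ∨ (k = j ∧ l = i) := by
  have hinj : ∀ k l : Fin p, ((k.val : ℂ) + 1 = l.val + 1) → k = l := fun k l h => by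
    simpa [Fin.ext_iff] using h
  refine ⟨fun k => if k = i then (j.val : ℂ) + 1 else k.val + 1, fun k => ?_, ?_, fun k l h => ?_⟩
  · dsimp only
    split_ifs <;> exact Nat.cast_add_one_ne_zero _
  · simp [hij.symm]
  · dsimp only at h
    split_ifs at h with h1 h2 h2
    · exact Or.inl (h1.trans h2.symm)
    · exact Or.inr (Or.inl ⟨h1, (hinj _ _ h).symm⟩)
    · exact Or.inr (Or.inr ⟨hinj _ _ h, h2⟩)
    · exact Or.inl (hinj _ _ h)

end nopole

/-! ### Pole control at the singular points. -/

section control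

variable {p : ℕ}

theorem zvar_mem_coeffRing (i : Fin p) : zvar i ∈ coeffRing p :=
  Algebra.subset_adjoin (Or.inl (Or.inl ⟨i, rfl⟩))

theorem zvar_inv_mem_coeffRing (i : Fin p) : (zvar i)⁻¹ ∈ coeffRing p :=
  Algebra.subset_adjoin (Or.inl (Or.inr ⟨i, rfl⟩))

theorem zvar_sub_inv_mem_coeffRing (i j : Fin p) : (zvar i - zvar j)⁻¹ ∈ coeffRing p := by
  by_cases h : i = j
  · rw [h, sub_self, inv_zero]
    exact zero_mem _
  · exact Algebra.subset_adjoin (Or.inr ⟨i, j, h, rfl⟩)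

theorem isNoetherianRing_adjoin_of_finite {s : Set (RatFun p)} (hs : s.Finite) :
    IsNoetherianRing (Algebra.adjoin ℂ s) :=
  isNoetherianRing_of_fg (Subalgebra.fg_def.2 ⟨s, hs, rfl⟩)

/-- Generators of the regular coefficients at `z_i = 0` and `z_i = z_j`, in terms of the equation
`t` of the divisor. -/
def finiteGenerators (t : RatFun p) : Set (RatFun p) :=
  Set.range zvar ∪ Set.range (fun l => t * (zvar l)⁻¹) ∪
    Set.range (fun kl : Fin p × Fin p => t * (zvar kl.1 - zvar kl.2)⁻¹)

/-- Generators of the regular coefficients at `z_i = ∞`. -/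
def infinityGenerators (i : Fin p) : Set (RatFun p) :=
  zvar '' {j | j ≠ i} ∪ Set.range (fun l : Fin p => (zvar l)⁻¹) ∪
    Set.range (fun kl : Fin p × Fin p => (zvar kl.1 - zvar kl.2)⁻¹)

/-- The control of poles along `z_i = 0` or `z_i = z_j`. -/
noncomputable def PoleControl.atFinite (t : RatFun p) (ht : t ≠ 0)
    (hmem : t ∈ Algebra.adjoin ℂ (finiteGenerators t)) : PoleControl p where
  t := t
  S := Algebra.adjoin ℂ (finiteGenerators t)
  c := 1
  c₀ := 1
  t_ne_zero := ht
  noetherian := isNoetherianRing_adjoin_of_finite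
    (((Set.finite_range _).union (Set.finite_range _)).union (Set.finite_range _))
  c_le := le_rfl
  t_mem := hmem
  inv_mem l := by
    rw [pow_one]
    exact Algebra.subset_adjoin (Or.inl (Or.inr ⟨l, rfl⟩))
  sub_inv_mem k l := by
    rw [pow_one]
    exact Algebra.subset_adjoin (Or.inr ⟨(k, l), rfl⟩)
  zvar_mul_mem l := by
    have hl : zvar l ∈ Algebra.adjoin ℂ (finiteGenerators t) :=
      Algebra.subset_adjoin (Or.inl (Or.inl ⟨l, rfl⟩))
    rw [pow_one]
    exact mul_mem hl hmem
  sq_mul_mem l := by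
    have hl : zvar l ∈ Algebra.adjoin ℂ (finiteGenerators t) :=
      Algebra.subset_adjoin (Or.inl (Or.inl ⟨l, rfl⟩))
    rw [Nat.sub_self, pow_zero, mul_one]
    exact pow_mem hl 2

/-- The control of poles along `z_i = ∞`. -/
noncomputable def PoleControl.atInfinity (i : Fin p) : PoleControl p where
  t := (zvar i)⁻¹
  S := Algebra.adjoin ℂ (infinityGenerators i)
  -- The inverses of z_l and z_k - z_l are regular at z_i = ∞, so the ordinary slots need no power
  -- of t. The value 2 for w₀ compensates the factors z_l² that come with adjoint modes.
  c := 0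
  c₀ := 2
  t_ne_zero := inv_ne_zero (zvar_ne_zero i)
  noetherian := isNoetherianRing_adjoin_of_finite
    ((((Set.toFinite _).image _).union (Set.finite_range _)).union (Set.finite_range _))
  c_le := Nat.zero_le _
  t_mem := Algebra.subset_adjoin (Or.inl (Or.inr ⟨i, rfl⟩))
  inv_mem l := by
    rw [pow_zero, one_mul]
    exact Algebra.subset_adjoin (Or.inl (Or.inr ⟨l, rfl⟩))
  sub_inv_mem k l := by
    rw [pow_zero, one_mul]
    exact Algebra.subset_adjoin (Or.inr ⟨(k, l), rfl⟩)
  zvar_mul_mem l := by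
    have ht : (zvar i : RatFun p)⁻¹ ∈ Algebra.adjoin ℂ (infinityGenerators i) :=
      Algebra.subset_adjoin (Or.inl (Or.inr ⟨i, rfl⟩))
    by_cases h : l = i
    · rw [h, pow_two, ← mul_assoc, mul_inv_cancel₀ (zvar_ne_zero i), one_mul]
      exact ht
    · have hl : zvar l ∈ Algebra.adjoin ℂ (infinityGenerators i) :=
        Algebra.subset_adjoin (Or.inl (Or.inl ⟨l, h, rfl⟩))
      exact mul_mem hl (pow_mem ht 2)
  sq_mul_mem l := by
    have ht : (zvar i : RatFun p)⁻¹ ∈ Algebra.adjoin ℂ (infinityGenerators i) :=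
      Algebra.subset_adjoin (Or.inl (Or.inr ⟨i, rfl⟩))
    rw [← mul_pow]
    by_cases h : l = i
    · rw [h, mul_inv_cancel₀ (zvar_ne_zero i), one_pow]
      exact one_mem _
    · have hl : zvar l ∈ Algebra.adjoin ℂ (infinityGenerators i) :=
        Algebra.subset_adjoin (Or.inl (Or.inl ⟨l, h, rfl⟩))
      exact pow_mem (mul_mem hl ht) 2

theorem finiteGenerators_subset_coeffRing {t : RatFun p} (ht : t ∈ coeffRing p) :
    Algebra.adjoin ℂ (finiteGenerators t) ≤ coeffRing p := by
  refine Algebra.adjoin_le ?_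
  rintro _ ((⟨l, rfl⟩ | ⟨l, rfl⟩) | ⟨kl, rfl⟩)
  · exact zvar_mem_coeffRing l
  · exact mul_mem ht (zvar_inv_mem_coeffRing l)
  · exact mul_mem ht (zvar_sub_inv_mem_coeffRing _ _)

theorem infinityGenerators_subset_coeffRing (i : Fin p) :
    Algebra.adjoin ℂ (infinityGenerators i) ≤ coeffRing p := by
  refine Algebra.adjoin_le ?_
  rintro _ ((⟨l, -, rfl⟩ | ⟨l, rfl⟩) | ⟨kl, rfl⟩)
  · exact zvar_mem_coeffRing l
  · exact zvar_inv_mem_coeffRing l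
  · exact zvar_sub_inv_mem_coeffRing _ _

/-- Each generator either has a denominator that is nonzero at a generic point of the divisor, or
its factor t cancels the pole. -/
theorem noPole_zero_of_mem {i : Fin p} {f : RatFun p}
    (hf : f ∈ Algebra.adjoin ℂ (finiteGenerators (zvar i))) : NoPole (.zero i) f := by
  obtain ⟨S, hS⟩ := exists_subalgebra_noPole (SingularPoint.zero i)
  obtain ⟨x, hx, hxi⟩ := exists_point_zero i
  have hX : MvPolynomial.eval x (MvPolynomial.X i) = 0 := by simpa using hxi
  have hz : ∀ l, zvar l ∈ S := fun l => (hS _).2 ⟨MvPolynomial.X l, 1,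
    not_dvd_of_eval x hX (by simp), by rw [map_one, div_one]; rfl⟩
  refine (hS f).1 (Algebra.adjoin_le ?_ hf)
  rintro _ ((⟨l, rfl⟩ | ⟨l, rfl⟩) | ⟨⟨k, l⟩, rfl⟩)
  · exact hz l
  · by_cases h : l = i
    · dsimp only
      rw [h, mul_inv_cancel₀ (zvar_ne_zero i)]
      exact one_mem _
    · refine mul_mem (hz i) ((hS _).2 ⟨1, MvPolynomial.X l, not_dvd_of_eval x hX ?_, ?_⟩)
      · rw [MvPolynomial.eval_X, ← hxi]
        exact fun h' => h (hx h')
      · rw [map_one, one_div]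
        rfl
  · by_cases h : k = l
    · dsimp only
      rw [h, sub_self, inv_zero, mul_zero]
      exact zero_mem _
    · refine mul_mem (hz i) ((hS _).2 ⟨1, MvPolynomial.X k - MvPolynomial.X l,
        not_dvd_of_eval x hX ?_, ?_⟩)
      · rw [map_sub, MvPolynomial.eval_X, MvPolynomial.eval_X]
        exact fun h' => h (hx (sub_eq_zero.1 h'))
      · rw [map_one, one_div, zvar_sub_zvar]

theorem noPole_diag_of_mem {i j : Fin p} (hij : i ≠ j) {f : RatFun p}
    (hf : f ∈ Algebra.adjoin ℂ (finiteGenerators (zvar i - zvar j))) :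
    NoPole (.diag i j hij) f := by
  obtain ⟨S, hS⟩ := exists_subalgebra_noPole (SingularPoint.diag i j hij)
  obtain ⟨x, hx0, hxij, hx⟩ := exists_point_diag hij
  have hX : MvPolynomial.eval x (MvPolynomial.X i - MvPolynomial.X j) = 0 := by simp [hxij]
  have hz : ∀ l, zvar l ∈ S := fun l => (hS _).2 ⟨MvPolynomial.X l, 1,
    not_dvd_of_eval x hX (by simp), by rw [map_one, div_one]; rfl⟩
  have hne := zvar_sub_zvar_ne_zero hij
  refine (hS f).1 (Algebra.adjoin_le ?_ hf)
  rintro _ ((⟨l, rfl⟩ | ⟨l, rfl⟩) | ⟨⟨k, l⟩, rfl⟩)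
  · exact hz l
  · refine mul_mem (sub_mem (hz i) (hz j))
      ((hS _).2 ⟨1, MvPolynomial.X l, not_dvd_of_eval x hX ?_, ?_⟩)
    · rw [MvPolynomial.eval_X]
      exact hx0 l
    · rw [map_one, one_div]
      rfl
  · dsimp only
    by_cases h : x k = x l
    · rcases hx k l h with rfl | ⟨rfl, rfl⟩ | ⟨rfl, rfl⟩
      · rw [sub_self, inv_zero, mul_zero]
        exact zero_mem _
      · rw [mul_inv_cancel₀ hne]
        exact one_mem _
      · rw [← neg_sub (zvar k), neg_mul, mul_inv_cancel₀ (zvar_sub_zvar_ne_zero hij.symm)]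
        exact neg_mem (one_mem _)
    · refine mul_mem (sub_mem (hz i) (hz j)) ((hS _).2 ⟨1, MvPolynomial.X k - MvPolynomial.X l,
        not_dvd_of_eval x hX ?_, ?_⟩)
      · rw [map_sub, MvPolynomial.eval_X, MvPolynomial.eval_X]
        exact fun h' => h (sub_eq_zero.1 h')
      · rw [map_one, one_div, zvar_sub_zvar]

theorem noPole_infinity_of_mem {i : Fin p} {f : RatFun p}
    (hf : f ∈ Algebra.adjoin ℂ (infinityGenerators i)) : NoPole (.infinity i) f := by
  refine (Algebra.adjoin_le (S := regularAtInfinity i) ?_ hf)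
  rintro _ ((⟨l, hl, rfl⟩ | ⟨l, rfl⟩) | ⟨⟨k, l⟩, rfl⟩)
  · refine ⟨MvPolynomial.X l, 1, one_ne_zero, ?_, by rw [map_one, div_one]; rfl⟩
    rw [MvPolynomial.degreeOf_X_of_ne (Ne.symm hl)]
    exact Nat.zero_le _
  · refine ⟨1, MvPolynomial.X l, MvPolynomial.X_ne_zero l, ?_, by rw [map_one, one_div]; rfl⟩
    rw [MvPolynomial.degreeOf_one]
    exact Nat.zero_le _
  · by_cases h : k = l
    · dsimp only
      rw [h, sub_self, inv_zero]
      exact zero_mem _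
    · refine ⟨1, MvPolynomial.X k - MvPolynomial.X l,
        sub_ne_zero.2 fun h' => h (MvPolynomial.X_injective h'), ?_, ?_⟩
      · rw [MvPolynomial.degreeOf_one]
        exact Nat.zero_le _
      · rw [map_one, one_div, ← zvar_sub_zvar]

end control

/-! ### Fuchsian relations and the system of differential equations. -/

section fuchs

variable {p : ℕ}

/-- The control of poles at a singular point. -/
noncomputable def poleControl : SingularPoint p → PoleControl p
  | .zero i => PoleControl.atFinite (zvar i) (zvar_ne_zero i)
      (Algebra.subset_adjoin (Or.inl (Or.inl ⟨i, rfl⟩)))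
  | .infinity i => PoleControl.atInfinity i
  | .diag i j h => PoleControl.atFinite (zvar i - zvar j) (zvar_sub_zvar_ne_zero h)
      (sub_mem (Algebra.subset_adjoin (s := finiteGenerators (zvar i - zvar j))
          (Or.inl (Or.inl ⟨i, rfl⟩)))
        (Algebra.subset_adjoin (s := finiteGenerators (zvar i - zvar j))
          (Or.inl (Or.inl ⟨j, rfl⟩))))

theorem poleControl_le_coeffRing (s : SingularPoint p) : (poleControl s).S ≤ coeffRing p := by
  cases s with
  | zero i => exact finiteGenerators_subset_coeffRing (zvar_mem_coeffRing i)
  | infinity i => exact infinityGenerators_subset_coeffRing i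
  | diag i j h =>
    exact finiteGenerators_subset_coeffRing (sub_mem (zvar_mem_coeffRing i) (zvar_mem_coeffRing j))

theorem noPole_of_mem_poleControl (s : SingularPoint p) {f : RatFun p}
    (hf : f ∈ (poleControl s).S) : NoPole s f := by
  cases s with
  | zero i => exact noPole_zero_of_mem hf
  | infinity i => exact noPole_infinity_of_mem hf
  | diag i j h => exact noPole_diag_of_mem h hf

theorem fuchsFactor_ne_zero (s : SingularPoint p) (l : Fin p) : fuchsFactor s l ≠ 0 := by
  cases s with
  | zero i => exact zvar_ne_zero i
  | infinity i =>
    rw [fuchsFactor]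
    split_ifs
    · exact zvar_ne_zero i
    · exact inv_ne_zero (zvar_ne_zero i)
  | diag i j h => exact zvar_sub_zvar_ne_zero h

theorem fuchsFactor_inv_mem_coeffRing (s : SingularPoint p) (l : Fin p) :
    (fuchsFactor s l)⁻¹ ∈ coeffRing p := by
  cases s with
  | zero i => exact zvar_inv_mem_coeffRing i
  | infinity i =>
    rw [fuchsFactor]
    split_ifs
    · exact zvar_inv_mem_coeffRing i
    · rw [inv_inv]
      exact zvar_mem_coeffRing i
  | diag i j h => exact zvar_sub_inv_mem_coeffRing i j

section regularity

variable {V : Type u} [AddCommGroup V] [Module ℂ V] {A : VOA V}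
  {W : Fin (p + 2) → ModData.{u, v} V} {E : Type*} [AddCommGroup E] [Module ℂ E]
  [Module (RatFun p) E] (c : MultilinearMap ℂ (fun i => (W i).carrier) E)
  (hW : ∀ i, IsVOAModule A (W i))

include hW

/-- L(-1)^k raises the order by c·k ≤ k, which t^k pays for. This covers every case except l = i at
z_i = ∞, where the Fuchs factor is 1/t. -/
theorem PoleControl.pow_smul_applyDerivative_mem_filt (R : PoleControl p) (hR : R.c ≤ 1)
    {w : ∀ i, (W i).carrier} {r : Fin (p + 2) → ℝ} (hw : IsHomogeneous A w r) (l : Fin p)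
    (k : ℕ) : R.t ^ k • c (applyDerivative A w (midSlot l) k) ∈
      R.filt A c (R.order r) (∑ i, r i + k) := by
  refine R.smul_mem_filt A c (hw.applyDerivative hW (midSlot l) k) ?_ k ?_ ?_
  · rw [sum_update]
    linarith
  · rw [← zpow_natCast, ← zpow_add₀ R.t_ne_zero, add_neg_cancel, zpow_zero]
    exact one_mem _
  · rw [order_update, slotExp_midSlot, add_sub_cancel_left, add_comm, Int.cast_natCast]
    have : (R.c : ℝ) ≤ 1 := by exact_mod_cast hR
    have hk : (0 : ℝ) ≤ k := Nat.cast_nonneg k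
    nlinarith

variable [IsScalarTower ℂ (RatFun p) E]

/-- Euler homogeneity rewrites z_i∂_i as a scalar minus the z_j∂_j with j ≠ i. There z_j ∈ S, and
∂_j does not change the order since c = 0; the growth of the total weight is absorbed by `hD`. -/
theorem PoleControl.zvar_pow_smul_applyDerivative_mem_filt (hc : WardIdentities A W c) (i : Fin p)
    {D : ℝ} (hD : ∀ ρ D', (PoleControl.atInfinity i).filt A c ρ D' ≤
      (PoleControl.atInfinity i).filt A c ρ D) (k : ℕ)
    {w : ∀ i, (W i).carrier} {r : Fin (p + 2) → ℝ} (hw : IsHomogeneous A w r) :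
    (zvar i : RatFun p) ^ k • c (applyDerivative A w (midSlot i) k) ∈
      (PoleControl.atInfinity i).filt A c ((PoleControl.atInfinity i).order r) D := by
  induction k generalizing w r with
  | zero =>
    refine hD _ (∑ i, r i) ?_
    rw [pow_zero, applyDerivative_zero]
    exact PoleControl.smul_mem_filt _ A c hw le_rfl 0 (by simp [one_mem]) (by simp)
  | succ k ih =>
    obtain ⟨κ, hκ⟩ := hc.sum_zvar_smul_derivative hW (hw.applyDerivative hW (midSlot i) k)
    rw [← Finset.add_sum_erase _ _ (Finset.mem_univ i)] at hκ
    have hsucc : applyDerivative A (applyDerivative A w (midSlot i) k) (midSlot i) 1 =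
        applyDerivative A w (midSlot i) (k + 1) := by
      rw [applyDerivative_succ (applyDerivative A w (midSlot i) k) (midSlot i) 0,
        applyDerivative_zero, ← applyDerivative_succ]
    rw [hsucc] at hκ
    rw [pow_succ, mul_smul, eq_sub_of_add_eq hκ, smul_sub, Finset.smul_sum]
    refine sub_mem ?_ (sum_mem fun j hj => ?_)
    · rw [smul_comm]
      exact PoleControl.complex_smul_mem_filt _ A c κ (ih hw)
    · have hji : j ≠ i := Finset.ne_of_mem_erase hj
      have hne : midSlot j ≠ midSlot i := fun h => hji (midSlot_injective h)
      have hcomm : applyDerivative A (applyDerivative A w (midSlot i) k) (midSlot j) 1 =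
          applyDerivative A (applyDerivative A w (midSlot j) 1) (midSlot i) k := by
        simp only [applyDerivative]
        rw [Function.update_of_ne hne, Function.update_of_ne hne.symm, Function.update_comm hne]
      have hz : zvar j ∈ (PoleControl.atInfinity i).S :=
        Algebra.subset_adjoin (Or.inl (Or.inl ⟨j, hji, rfl⟩))
      have hmem := ih (hw.applyDerivative hW (midSlot j) 1)
      have hc0 : (PoleControl.atInfinity i).c = 0 := rfl
      rw [PoleControl.order_update, PoleControl.slotExp_midSlot, hc0, Nat.cast_zero, zero_mul,
        add_zero] at hmem
      rw [hcomm, smul_comm]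
      exact Submodule.smul_mem _ (⟨zvar j, hz⟩ : (PoleControl.atInfinity i).S) hmem

theorem fuchsFactor_pow_smul_mem_filt (hc : WardIdentities A W c) (s : SingularPoint p)
    {D : ℝ} (hD : ∀ ρ D', (poleControl s).filt A c ρ D' ≤ (poleControl s).filt A c ρ D)
    {w : ∀ i, (W i).carrier} {r : Fin (p + 2) → ℝ} (hw : IsHomogeneous A w r) (l : Fin p)
    (k : ℕ) : fuchsFactor s l ^ k • c (applyDerivative A w (midSlot l) k) ∈
      (poleControl s).filt A c ((poleControl s).order r) D := by
  cases s with
  | zero i =>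
    exact hD _ _ (PoleControl.pow_smul_applyDerivative_mem_filt c hW (poleControl (.zero i)) le_rfl
      hw l k)
  | infinity i =>
    rw [fuchsFactor]
    split_ifs with h
    · subst h
      exact PoleControl.zvar_pow_smul_applyDerivative_mem_filt c hW hc l hD k hw
    · exact hD _ _ (PoleControl.pow_smul_applyDerivative_mem_filt c hW (poleControl (.infinity i))
        zero_le_one hw l k)
  | diag i j h =>
    exact hD _ _ (PoleControl.pow_smul_applyDerivative_mem_filt c hW (poleControl (.diag i j h))
      le_rfl hw l k)

/-- What matters is that ρ does not depend on `k`. For general vectors it is obtained from the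
finitely many homogeneous tuples by multilinearity. -/
theorem exists_fuchsFactor_pow_smul_mem_filt (hc : WardIdentities A W c) (s : SingularPoint p)
    {D : ℝ} (hD : ∀ ρ D', (poleControl s).filt A c ρ D' ≤ (poleControl s).filt A c ρ D)
    (w : ∀ i, (W i).carrier) (l : Fin p) :
    ∃ ρ : ℝ, ∀ k, fuchsFactor s l ^ k • c (applyDerivative A w (midSlot l) k) ∈
      (poleControl s).filt A c ρ D := by
  -- For fixed `k` the derivative is itself multilinear in `w`, so the span induction applies.
  choose c' hc' using exists_multilinear_applyDerivative (A := A) c (midSlot l)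
  simp only [← hc']
  refine multilinear_span_induction (M := fun i => (W i).carrier)
    (fun i => {x | ∃ r, x ∈ (W i).wt A.ω r}) (Q := fun w => ∃ ρ : ℝ, ∀ k,
      fuchsFactor s l ^ k • c' k w ∈ (poleControl s).filt A c ρ D) ?_ ?_ ?_ ?_ w
    fun i => (hW i).span_homogeneous (w i)
  · rintro w i x y ⟨ρ₁, h₁⟩ ⟨ρ₂, h₂⟩
    refine ⟨max ρ₁ ρ₂, fun k => ?_⟩
    rw [MultilinearMap.map_update_add, smul_add]
    exact add_mem (PoleControl.filt_mono _ A c (le_max_left _ _) le_rfl (h₁ k))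
      (PoleControl.filt_mono _ A c (le_max_right _ _) le_rfl (h₂ k))
  · rintro w i t x ⟨ρ, h⟩
    refine ⟨ρ, fun k => ?_⟩
    rw [MultilinearMap.map_update_smul, smul_comm]
    exact PoleControl.complex_smul_mem_filt _ A c t (h k)
  · refine fun w i => ⟨0, fun k => ?_⟩
    rw [MultilinearMap.map_update_zero, smul_zero]
    exact zero_mem _
  · intro w hw
    choose r hr using hw
    refine ⟨(poleControl s).order r, fun k => ?_⟩
    rw [hc']
    exact fuchsFactor_pow_smul_mem_filt c hW hc s hD hr l k

end regularity

section system

variable {V : Type u} [AddCommGroup V] [Module ℂ V] {A : VOA V}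
  {W : Fin (p + 2) → ModData.{u, v} V}

theorem exists_fuchsian_relation {E : Type*} [AddCommGroup E] [Module ℂ E] [Module (RatFun p) E]
    [IsScalarTower ℂ (RatFun p) E] (c : MultilinearMap ℂ (fun i => (W i).carrier) E)
    (hW : ∀ i, IsDiscreteModule A (W i)) (hC : ∀ i, IsC1Cofinite A (W i))
    (hc : WardIdentities A W c) (s : SingularPoint p) (w : ∀ i, (W i).carrier) (l : Fin p) :
    ∃ n : ℕ, 0 < n ∧ ∃ b : ℕ → RatFun p, (∀ i, b i ∈ (poleControl s).S) ∧
      fuchsFactor s l ^ n • c (applyDerivative A w (midSlot l) n) = ∑ i ∈ Finset.range n,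
        b i • fuchsFactor s l ^ i • c (applyDerivative A w (midSlot l) i) := by
  have hW' : ∀ i, IsVOAModule A (W i) := fun i => (hW i).isModule
  choose B hB using fun i => (hC i).exists_weight_bound (hW' i)
  obtain ⟨ρ, hρ⟩ := exists_fuchsFactor_pow_smul_mem_filt c hW' hc s
    ((poleControl s).filt_le_of_bounds c hW' hc hB) w l
  have := (poleControl s).noetherian
  obtain ⟨n, hn, b, hb⟩ := exists_monic_relation ((poleControl s).fg_filt c hW ρ _) _ hρ
  exact ⟨n, hn, fun i => b i, fun i => (b i).2, hb⟩

/-- The universal correlation function, with one component for each correlation function. -/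
noncomputable def universalCorrelator (A : VOA V) (W : Fin (p + 2) → ModData.{u, v} V) :
    MultilinearMap ℂ (fun i => (W i).carrier)
      ({Φ : MultilinearMap ℂ (fun i => (W i).carrier) (RSeries p) // IsCorrelator A W Φ} →
        RSeries p) :=
  MultilinearMap.pi fun Φ => Φ.1

theorem universalCorrelator_ward : WardIdentities A W (universalCorrelator A W) where
  mid a w l M hM hM' := by
    funext Φ
    have := Φ.2.ward.mid a w l M hM hM'
    simpa [universalCorrelator] using this
  zero a w N M hM := by
    funext Φ
    have := Φ.2.ward.zero a w N M hM
    simpa [universalCorrelator] using this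

theorem sum_Icc_reflect {M : Type*} [AddCommMonoid M] (n : ℕ) (f : ℕ → M) :
    ∑ k ∈ Finset.Icc 1 n, f (n - k) = ∑ i ∈ Finset.range n, f i := by
  refine Finset.sum_nbij' (fun k => n - k) (fun i => n - i) ?_ ?_ ?_ ?_ fun _ _ => rfl
  all_goals
    intro k hk
    simp only [Finset.mem_Icc, Finset.mem_range] at hk ⊢
    omega

/-- Divide by g^n: the coefficient of the derivative of order n - k becomes -b_{n-k} g^{-k}, with
pole order controlled by `k`. -/
theorem monic_equation_of_relation {g : RatFun p} (hg : g ≠ 0) {n : ℕ} {b : ℕ → RatFun p}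
    {y : ℕ → RSeries p} (h : g ^ n • y n = ∑ i ∈ Finset.range n, b i • g ^ i • y i) :
    y n + ∑ k ∈ Finset.Icc 1 n, expand p (-(b (n - k)) * g⁻¹ ^ k) * y (n - k) = 0 := by
  have h1 : ∀ k ∈ Finset.Icc 1 n, expand p (-(b (n - k)) * g⁻¹ ^ k) * y (n - k) =
      -(g⁻¹ ^ n • b (n - k) • g ^ (n - k) • y (n - k)) := by
    intro k hk
    have hkn := (Finset.mem_Icc.1 hk).2
    rw [← ratFun_smul_def, smul_smul, smul_smul, ← neg_smul]
    congr 1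
    obtain ⟨i, rfl⟩ := Nat.exists_eq_add_of_le hkn
    rw [Nat.add_sub_cancel_left, pow_add, inv_pow, inv_pow]
    field_simp
  rw [Finset.sum_congr rfl h1, Finset.sum_neg_distrib,
    sum_Icc_reflect n fun i => g⁻¹ ^ n • b i • g ^ i • y i, ← Finset.smul_sum, ← h, smul_smul,
    ← mul_pow, inv_mul_cancel₀ hg, one_pow, one_smul, add_neg_cancel]

end system

end fuchs

theorem theorem2p4 {V : Type u} [AddCommGroup V] [Module ℂ V] (A : VOA V) (p : ℕ)
    (W : Fin (p + 2) → ModData.{u, v} V)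
    (hW : ∀ i, IsDiscreteModule A (W i)) (hC : ∀ i, IsC1Cofinite A (W i))
    (w : ∀ i, (W i).carrier) (s : SingularPoint p) :
    ∃ (m : Fin p → ℕ) (a : Fin p → ℕ → RatFun p),
      (∀ l, 0 < m l) ∧
      (∀ l, ∀ k ∈ Finset.Icc 1 (m l), a l k ∈ coeffRing p) ∧
      IsRegularAt s m a ∧
      ∀ F : (Fin p → ℝ) → (contragredient A (W 0) (hW 0).isModule).carrier,
        IsProduct A (W (Fin.last (p + 1))) (w (Fin.last (p + 1))) p
          (contragredient A (W 0) (hW 0).isModule)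
          (fun i => W i.succ.castSucc) (fun i => w i.succ.castSucc) F →
        ∃ φ : RSeries p, (∀ e : Fin p → ℝ, φ.coeff (expo e) = (F e).1 (w 0)) ∧
          SatisfiesSystem m a φ := by
  -- The relation is found before any product `F` is given; it specializes to the component of the
  -- correlator of `F`.
  choose m hm b hb hrel using exists_fuchsian_relation (universalCorrelator A W) hW hC
    universalCorrelator_ward s w
  refine ⟨m, fun l k => -(b l (m l - k)) * (fuchsFactor s l)⁻¹ ^ k, hm, fun l k _ => ?_,
    fun l k _ => ?_, fun F hF => ?_⟩
  · exact mul_mem (neg_mem (poleControl_le_coeffRing s (hb l _)))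
      (pow_mem (fuchsFactor_inv_mem_coeffRing s l) k)
  · have : fuchsFactor s l ^ k * (-(b l (m l - k)) * (fuchsFactor s l)⁻¹ ^ k) =
        -(b l (m l - k)) := by
      rw [mul_left_comm, ← mul_pow, mul_inv_cancel₀ (fuchsFactor_ne_zero s l), one_pow, mul_one]
    rw [this]
    exact noPole_of_mem_poleControl s (neg_mem (hb l _))
  · obtain ⟨Φ, hΦ, hcoeff⟩ := IsProduct.exists_correlator (fun i => (hW i).isModule) w hF
    refine ⟨Φ w, hcoeff, fun l => ?_⟩
    refine monic_equation_of_relation (fuchsFactor_ne_zero s l)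
      (y := fun k => (partialD l)^[k] (Φ w)) ?_
    have := congrFun (hrel l) ⟨Φ, hΦ⟩
    simp only [Finset.sum_apply, Pi.smul_apply] at this
    simp only [← hΦ.iterate_partialD]
    exact this
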